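/- **Proposition 5.1.** Let $k\ge 0$ be an integer, write points of $\mathbb{R}^{2k}$ as $z=(x,y)$ with $x,y\in\mathbb{R}^k$, and put $$Q(x,y)=-\|x\|^2+\|y\|^2,\qquad A=\{(x,y) : -1\le Q(x,y)\le 1,\ \|x\|\,\|y\|\le \sqrt2\}.$$ Let $C^\infty_k$ be the space of smooth functions $f:\mathbb{R}^{2k}\to\mathbb{R}$ which equal $Q$ outside the compact set $A$, with the $C^\infty$ topology (uniform convergence of all derivatives). Consider the following subspaces of $C^\infty_k\times(0,1)$. * $\mathcal{H}_k$ is the space of pairs $(f,b)$ such that $b$ is a regular value of $f$ and $f^{-1}(b)$ is isotopic to $Q^{-1}(b)$ keeping it fixed outside $A$; that is, there is a smooth family $(\Phi_t)_{t\in[0,1]}$ of diffeomorphisms of $\mathbb{R}^{2k}$, each equal to the identity outside $A$, with $\Phi_0=\mathrm{id}$ and $\Phi_1(Q^{-1}(b))=f^{-1}(b)$. * $\mathcal{U}_k\subset\mathcal{H}_k$ is the space of those $(f,b)\in \mathcal{H}_k$ for which $f$ has exactly one critical point in $f^{-1}((-\infty,b])$, and this critical point is non-degenerate with critical value $0$.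 * $\mathcal{M}_k$ is the space of pairs $(f,b)\in C^\infty_k\times(0,1)$ for which $f$ has exactly one critical point in $\mathbb{R}^{2k}$, and this critical point is non-degenerate with critical value $0$. For $c\in(0,1]$ let $f_c(z)=c^2f(c^{-1}z)$ be the shrinking of $f$ with factor $c$. Then: 1. $\mathcal{M}_k\subset\mathcal{U}_k\subset\mathcal{H}_k$. 2. For $(f,b)\in\mathcal{M}_k$, the following path from $(f,b)$ to $(Q,\tfrac12)$ lies in $\mathcal{H}_k$ and depends continuously on $(f,b)$, so that it defines a null-homotopy $N$ of the inclusion $\mathcal{M}_k\subset\mathcal{U}_k\subset\mathcal{H}_k$: for $t\in[0,\tfrac13]$ shrink $f$ to $f_b$ through $(f_c,b)$ with $c$ moving linearly from $1$ to $b$; for $t\in[\tfrac13,\tfrac23]$ interpolate convexly (linearly) from $f_b$ to $Q$, keeping $b$ fixed; for $t\in[\tfrac23,1]$ keep $Q$ and interpolate linearly from $b$ to $\tfrac12$. 3. The sequence $\mathcal{M}_k\subset\mathcal{U}_k\subset\mathcal{H}_k$ with the null-homotopy $N$ is a homotopy fibration sequence: the map $$\mathcal{M}_k\to\{(u,\gamma)\in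 \mathcal{U}_k\times \mathrm{Map}([0,1],\mathcal{H}_k) : \gamma(0)=u,\ \gamma(1)=(Q,\tfrac12)\},\qquad m\mapsto (m,\ t\mapsto N(t,m)),$$ to the homotopy fibre of $\mathcal{U}_k\subset\mathcal{H}_k$ over $(Q,\tfrac12)$ is a weak homotopy equivalence (it induces bijections on path components and on all homotopy groups $\pi_n$, $n\ge1$, at all base points). -/

import Mathlib

open scoped unitInterval ContDiff Distributions

/-! ### Homotopy theory: weak equivalences, homotopy fibres, homotopy fibration sequences -/

section HomotopyTheory

variable {X Y Z : Type*} [TopologicalSpace X] [TopologicalSpace Y] [TopologicalSpace Z]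

/-- The map on sets of path components induced by a continuous map. -/
def pathComponentsMap (f : C(X, Y)) : ZerothHomotopy X → ZerothHomotopy Y :=
  Quotient.map f fun _ _ h => Nonempty.map (fun p : Path _ _ => p.map f.continuous) h

/-- Composition of a generalized loop `(I^n, ∂I^n) → (X, x)` with a continuous map. -/
def genLoopMap (n : ℕ) (f : C(X, Y)) (x : X) (γ : GenLoop (Fin n) X x) :
    GenLoop (Fin n) Y (f x) :=
  ⟨f.comp γ.1, fun y hy => congrArg f (γ.2 y hy)⟩

/-- The map `π_n(X, x) → π_n(Y, f x)` induced by a continuous map. -/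
def homotopyGroupMap (n : ℕ) (f : C(X, Y)) (x : X) :
    HomotopyGroup (Fin n) X x → HomotopyGroup (Fin n) Y (f x) :=
  Quotient.map (genLoopMap n f x) fun _ _ h => h.map fun H => H.compContinuousMap f

/-- A continuous map is a weak homotopy equivalence if it induces a bijection on path components
and on all homotopy groups `π_n`, `n ≥ 1`, at all base points. -/
def IsWeakHomotopyEquiv (f : C(X, Y)) : Prop :=
  Function.Bijective (pathComponentsMap f) ∧
    ∀ (n : ℕ) (x : X), 1 ≤ n → Function.Bijective (homotopyGroupMap n f x)

/-- The homotopy fibre of `j : Y → Z` over `z₀`: pairs of a point `y` of `Y` and a path in `Z`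
from `j y` to `z₀`, with the compact-open topology on paths. -/
abbrev HomotopyFibre (j : C(Y, Z)) (z₀ : Z) : Type _ :=
  {q : Y × C(I, Z) // q.2 0 = j q.1 ∧ q.2 1 = z₀}

/-- The map `x ↦ (i x, t ↦ N (t, x))` to the homotopy fibre of `j` over `z₀` that is determined by
a null-homotopy `N` of `j ∘ i` ending at the constant map with value `z₀`. -/
def toHomotopyFibre (i : C(X, Y)) (j : C(Y, Z)) {z₀ : Z}
    (N : (j.comp i).Homotopy (ContinuousMap.const X z₀)) : C(X, HomotopyFibre j z₀) where
  toFun x := ⟨(i x, (N.toContinuousMap.comp ContinuousMap.prodSwap).curry x),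
    N.apply_zero x, N.apply_one x⟩
  continuous_toFun := by fun_prop

/-- `X → Y → Z` with the null-homotopy `N` of the composition is a homotopy fibration sequence
(over the base point `z₀` of `Z` at which `N` ends) if the induced map from `X` to the
homotopy fibre of `Y → Z` over `z₀` is a weak homotopy equivalence. -/
def IsHomotopyFibrationSequence (i : C(X, Y)) (j : C(Y, Z)) {z₀ : Z}
    (N : (j.comp i).Homotopy (ContinuousMap.const X z₀)) : Prop :=
  IsWeakHomotopyEquiv (toHomotopyFibre i j N)

end HomotopyTheory

/-! ### Regular values, non-degenerate critical points, isotopies -/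

section Calculus

variable {E : Type*} [NormedAddCommGroup E] [NormedSpace ℝ E]

/-- `z` is a critical point of `f`. -/
def IsCritical (f : E → ℝ) (z : E) : Prop := fderiv ℝ f z = 0

/-- `b` is a regular value of `f`: no critical point of `f` lies on the level set `f⁻¹(b)`. -/
def IsRegularValue (f : E → ℝ) (b : ℝ) : Prop := ∀ z, f z = b → ¬ IsCritical f z

/-- The Hessian (second derivative) of `f` at `z` is a non-degenerate bilinear form. -/
def HessianNondegenerate (f : E → ℝ) (z : E) : Prop :=
  ∀ v : E, (∀ w : E, fderiv ℝ (fderiv ℝ f) z v w = 0) → v = 0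

/-- `S` and `T` are isotopic keeping everything outside of `A` fixed: there is a smooth family
`Φ t`, `t ∈ [0,1]`, of diffeomorphisms of the ambient space, starting at the identity, all equal
to the identity outside of `A`, with `Φ 1` mapping `S` onto `T`. -/
def IsotopicFixingOutside (A S T : Set E) : Prop :=
  ∃ Φ : ℝ → E ≃ E,
    ContDiffOn ℝ ∞ (fun p : ℝ × E => Φ p.1 p.2) (Set.Icc 0 1 ×ˢ Set.univ) ∧
    ContDiffOn ℝ ∞ (fun p : ℝ × E => (Φ p.1).symm p.2) (Set.Icc 0 1 ×ˢ Set.univ) ∧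
    (∀ z, Φ 0 z = z) ∧
    (∀ t ∈ Set.Icc (0 : ℝ) 1, ∀ z, z ∉ A → Φ t z = z) ∧
    Φ 1 '' S = T

end Calculus

noncomputable section FunctionSpaces

/-- `ℝ^{2k} = ℝ^k × ℝ^k`, with points `(x, y)` and Euclidean norms on the two factors. (The norm on
the product only enters through the topology and the smooth structure.) -/
abbrev E2 (k : ℕ) : Type := EuclideanSpace ℝ (Fin k) × EuclideanSpace ℝ (Fin k)

/-- The standard quadratic form `Q(x, y) = -‖x‖² + ‖y‖²`. -/
def Q (k : ℕ) (z : E2 k) : ℝ := -‖z.1‖ ^ 2 + ‖z.2‖ ^ 2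

theorem contDiff_Q (k : ℕ) : ContDiff ℝ ∞ (Q k) :=
  (contDiff_fst.norm_sq ℝ).neg.add (contDiff_snd.norm_sq ℝ)

/-- The set `A = {-1 ≤ Q ≤ 1, ‖x‖ ‖y‖ ≤ √2}`. -/
def setA (k : ℕ) : Set (E2 k) := {z | Q k z ∈ Set.Icc (-1) 1 ∧ ‖z.1‖ * ‖z.2‖ ≤ √2}

theorem isCompact_setA (k : ℕ) : IsCompact (setA k) := by
  refine Metric.isCompact_of_isClosed_isBounded ?_ ?_
  · exact (isClosed_Icc.preimage (contDiff_Q k).continuous).inter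
      (isClosed_le (continuous_fst.norm.mul continuous_snd.norm) continuous_const)
  · refine (Metric.isBounded_closedBall (x := (0 : E2 k)) (r := 2)).subset ?_
    rintro ⟨x, y⟩ ⟨⟨h₁, h₂⟩, h₃⟩
    simp only [Q] at h₁ h₂ h₃
    have hx := norm_nonneg x
    have hy := norm_nonneg y
    have h₄ : (‖x‖ * ‖y‖) ^ 2 ≤ 2 := by
      calc (‖x‖ * ‖y‖) ^ 2 ≤ √2 ^ 2 := by gcongr
        _ = 2 := Real.sq_sqrt (by norm_num)
    rw [mem_closedBall_zero_iff, Prod.norm_mk, sup_le_iff]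
    constructor
    · by_contra! h
      have hx2 : 4 < ‖x‖ ^ 2 := by nlinarith
      have hy2 : 3 < ‖y‖ ^ 2 := by linarith
      rw [mul_pow] at h₄
      nlinarith
    · by_contra! h
      have hy2 : 4 < ‖y‖ ^ 2 := by nlinarith
      have hx2 : 3 < ‖x‖ ^ 2 := by linarith
      rw [mul_pow] at h₄
      nlinarith

/-- `A` as a bundled compact set. -/
def compactA (k : ℕ) : TopologicalSpace.Compacts (E2 k) := ⟨setA k, isCompact_setA k⟩

/-- The space `C^∞_k` of smooth functions on `ℝ^{2k}` that are equal to `Q` outside of `A`. -/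
structure CInf (k : ℕ) where
  toFun : E2 k → ℝ
  smooth : ContDiff ℝ ∞ toFun
  eq_Q : ∀ z, z ∉ setA k → toFun z = Q k z

/-- The difference `f - Q`, a smooth function that vanishes outside of `A`. -/
def CInf.subQ {k : ℕ} (f : CInf k) : 𝓓_{compactA k}(E2 k, ℝ) where
  toFun z := f.toFun z - Q k z
  contDiff' := f.smooth.sub (contDiff_Q k)
  zero_on_compl' := fun z hz => sub_eq_zero.2 (f.eq_Q z hz)

/-- The `C^∞` topology: uniform convergence of all derivatives of `f - Q`. -/
instance (k : ℕ) : TopologicalSpace (CInf k) := TopologicalSpace.induced CInf.subQ inferInstance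

/-- The space `H_k` of pairs `(f, b)` with `f ∈ C^∞_k` and `b ∈ (0,1)` such that `b` is a regular
value of `f` and `f⁻¹(b)` is isotopic to `Q⁻¹(b)` keeping it fixed outside of `A`. -/
def spaceH (k : ℕ) : Set (CInf k × ℝ) :=
  {p | p.2 ∈ Set.Ioo 0 1 ∧ IsRegularValue p.1.toFun p.2 ∧
    IsotopicFixingOutside (setA k) (Q k ⁻¹' {p.2}) (p.1.toFun ⁻¹' {p.2})}

/-- The space `U_k` of pairs `(f, b) ∈ H_k` such that `f` has exactly one critical point in
`f⁻¹((-∞, b])`, and this critical point is non-degenerate with critical value `0`. -/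
def spaceU (k : ℕ) : Set (CInf k × ℝ) :=
  {p | p ∈ spaceH k ∧ ∃ z : E2 k, (∀ w, (p.1.toFun w ≤ p.2 ∧ IsCritical p.1.toFun w) ↔ w = z) ∧
    HessianNondegenerate p.1.toFun z ∧ p.1.toFun z = 0}

/-- The space `M_k` of pairs `(f, b)` with `f ∈ C^∞_k` and `b ∈ (0,1)` such that `f` has exactly one
critical point (in all of `ℝ^{2k}`), and it is non-degenerate with critical value `0`. -/
def spaceM (k : ℕ) : Set (CInf k × ℝ) :=
  {p | p.2 ∈ Set.Ioo 0 1 ∧ ∃ z : E2 k, (∀ w, IsCritical p.1.toFun w ↔ w = z) ∧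
    HessianNondegenerate p.1.toFun z ∧ p.1.toFun z = 0}

theorem spaceU_subset_spaceH (k : ℕ) : spaceU k ⊆ spaceH k := fun _ h => h.1

/-- The inclusion of a subspace into a larger one, as a continuous map. -/
def inclusionMap {X : Type*} [TopologicalSpace X] {S T : Set X} (h : S ⊆ T) : C(S, T) :=
  ⟨Set.inclusion h, continuous_inclusion h⟩

/-- `Q` as a point of `C^∞_k`. -/
def CInf.ofQ (k : ℕ) : CInf k := ⟨Q k, contDiff_Q k, fun _ _ => rfl⟩

theorem isRegularValue_Q (k : ℕ) {b : ℝ} (hb : 0 < b) : IsRegularValue (Q k) b := by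
  rintro ⟨x, y⟩ hz hc
  have hd : HasFDerivAt (Q k) (fderiv ℝ (Q k) (x, y)) (x, y) :=
    ((contDiff_Q k).differentiable (by simp)).differentiableAt.hasFDerivAt
  have hl : HasDerivAt (fun t : ℝ => ((x, y) : E2 k) + t • ((0, y) : E2 k)) (0, y) 0 := by
    simpa using ((hasDerivAt_id (0 : ℝ)).smul_const ((0, y) : E2 k)).const_add ((x, y) : E2 k)
  have h₁ : HasDerivAt (fun t : ℝ => Q k ((x, y) + t • ((0, y) : E2 k))) 0 0 := by
    have := HasFDerivAt.comp_hasDerivAt (0 : ℝ) (by simpa using hd) hl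
    rw [show fderiv ℝ (Q k) (x, y) = 0 from hc] at this
    exact this
  have h₂ : HasDerivAt (fun t : ℝ => -‖x‖ ^ 2 + (1 + t) ^ 2 * ‖y‖ ^ 2) (2 * ‖y‖ ^ 2) 0 := by
    have := (((hasDerivAt_id (0 : ℝ)).const_add 1).pow 2).mul_const (‖y‖ ^ 2)
    simpa using this.const_add (-‖x‖ ^ 2)
  have h₃ : (fun t : ℝ => Q k ((x, y) + t • ((0, y) : E2 k))) =
      fun t : ℝ => -‖x‖ ^ 2 + (1 + t) ^ 2 * ‖y‖ ^ 2 := by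
    funext t
    have : y + t • y = (1 + t) • y := by rw [add_smul, one_smul]
    simp [Q, this, norm_smul, mul_pow]
  have h₄ := h₁.unique (h₃ ▸ h₂)
  have h₅ : Q k (x, y) = b := hz
  simp only [Q] at h₅
  nlinarith [sq_nonneg ‖x‖]

theorem Q_mem_spaceH (k : ℕ) {b : ℝ} (hb : b ∈ Set.Ioo (0 : ℝ) 1) :
    (CInf.ofQ k, b) ∈ spaceH k :=
  ⟨hb, isRegularValue_Q k hb.1, fun _ => Equiv.refl _, contDiff_snd.contDiffOn,
    contDiff_snd.contDiffOn, fun _ => rfl, fun _ _ _ _ => rfl, Set.image_id _⟩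

/-- The base point `(Q, 1/2)` of `H_k`. -/
def basePoint (k : ℕ) : spaceH k := ⟨(CInf.ofQ k, 1 / 2), Q_mem_spaceH k (by norm_num)⟩

/-- The shrinking `f_c(z) = c² f(c⁻¹ z)` of a function on `ℝ^{2k}` with factor `c ∈ (0,1]`. -/
def shrink {k : ℕ} (c : ℝ) (f : E2 k → ℝ) : E2 k → ℝ := fun z => c ^ 2 * f (c⁻¹ • z)

/-- Truncation of a real number to `[0,1]`. -/
def clamp (s : ℝ) : ℝ := max 0 (min s 1)

/-- The function part at time `t ∈ [0,1]` of the null-homotopy: for `t ≤ 1/3` the function `f` is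
shrunk, with the factor moving linearly from `1` to `b`; for `1/3 ≤ t ≤ 2/3` the function `f_b` is
interpolated convexly to `Q`; for `2/3 ≤ t` it stays `Q`. -/
def nullFun {k : ℕ} (t : ℝ) (f : E2 k → ℝ) (b : ℝ) : E2 k → ℝ := fun z =>
  (1 - clamp (3 * t - 1)) * shrink ((1 - clamp (3 * t)) + clamp (3 * t) * b) f z +
    clamp (3 * t - 1) * Q k z

/-- The level at time `t ∈ [0,1]` of the null-homotopy: it stays `b` for `t ≤ 2/3`, and is
interpolated linearly to `1/2` for `2/3 ≤ t`. -/
def nullLevel (t b : ℝ) : ℝ := (1 - clamp (3 * t - 2)) * b + clamp (3 * t - 2) * (1 / 2)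

end FunctionSpaces

/-! A point of the homotopy fibre is a path `(f_t, b_t)` in `H_k` from a point of `U_k` to `(Q,
1/2)`. The map from `M_k` is injective, so it is a weak equivalence as soon as every map of a cube
to the fibre whose boundary lands in `M_k` can be deformed into `M_k` relative to the boundary
(`isWeakHomotopyEquiv_of_compression`).

Every path can be brought to a normal form. Shrinking with factor `c` multiplies levels by `c²`, so
suitable factors make the level constant, equal to some `b ≤ 1/2`. Since `b` is then a regular value
of all `f_t`, there are diffeomorphisms `ψ_t`, fixed outside `A` and with `ψ_1 = id`, such that `f_t
∘ ψ_t` equals `Q` near the level `b` and lies on the same side of `b` as `Q` elsewhere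
(`exists_isLevelLift`). Replacing `f_t` by `f_t ∘ ψ_t` is a deformation within the fibre, and
functions of this kind form a convex set inside `H_k` (`AgreesAtLevel.lerp`). Let `g` be `f_0` with
its values on `{Q ≥ b}` replaced by `Q`. The straight line deforms the path to the linear path from
`g` to `Q`. It moves the starting function only above the level, which `U_k` does not see, so the
part of `f_0` above the level is forgotten. As `Q` has no critical point of positive value, `g` has
only the critical point below the level, hence lies in `M_k`. Finally the level is raised to `1/2`.

Conversely, for `(f, 1/2)` in `M_k` with `f` equal to `Q` from the level on, the path given by `N`
deforms linearly to the linear path from `f` to `Q`. Shrinking by `1/2` brings all of `M_k` into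
this form, with `f` even standard above `1/4`. On such linear paths the normalization is stationary,
so the homotopy extension property turns these deformations into one relative to the boundary
(`exists_compression_of_deformation`, `exists_compression_of_homotopy`).

The inclusion of `M_k` in `H_k` rests on the same isotopies: while `f` is shrunk to `f_b`, the level
`b` stays regular because the only critical value is `0`, and `f_b` has the level set of `Q` at `b`
because it is standard above `b² < b`.

The fibre is studied with a free end level, of which the homotopy fibre is a retract, because the
normalization moves the level of the end point. -/

/-! ### Families of maps that are smooth in one variable and continuous in a parameter -/

section ParametrizedSmoothness

universe u v

variable {P : Type v} [TopologicalSpace P]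
  {E F G H : Type u} [NormedAddCommGroup E] [NormedSpace ℝ E] [NormedAddCommGroup F]
  [NormedSpace ℝ F] [NormedAddCommGroup G] [NormedSpace ℝ G] [NormedAddCommGroup H]
  [NormedSpace ℝ H]

/-- `ParamContDiffOn n f Ω`: on the set `Ω` the map `f : P × E → F` is `n` times differentiable in
the second variable, with derivatives up to order `n` that are continuous in both variables. -/
def ParamContDiffOn : ∀ (_ : ℕ) {F : Type u} [NormedAddCommGroup F] [NormedSpace ℝ F]
    (_ : P × E → F) (_ : Set (P × E)), Prop
  | 0, _, _, _, f, Ω => ContinuousOn f Ω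
  | n + 1, _, _, _, f, Ω => ContinuousOn f Ω ∧
      (∀ q ∈ Ω, DifferentiableAt ℝ (fun z => f (q.1, z)) q.2) ∧
      ParamContDiffOn n (fun q => fderiv ℝ (fun z => f (q.1, z)) q.2) Ω

set_option linter.unusedSectionVars false

namespace ParamContDiffOn

variable {E' F' : Type} [NormedAddCommGroup E'] [NormedSpace ℝ E'] [NormedAddCommGroup F']
  [NormedSpace ℝ F']

variable {n : ℕ} {Ω : Set (P × E)} {f : P × E → F} {g : P × E → G}

theorem continuousOn (h : ParamContDiffOn n f Ω) : ContinuousOn f Ω := by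
  cases n with
  | zero => exact h
  | succ n => exact h.1

theorem mono {Ω' : Set (P × E)} (h : ParamContDiffOn n f Ω) (hs : Ω' ⊆ Ω) :
    ParamContDiffOn n f Ω' := by
  induction n generalizing F with
  | zero => exact ContinuousOn.mono h hs
  | succ n ih => exact ⟨h.1.mono hs, fun q hq => h.2.1 q (hs hq), ih h.2.2⟩

theorem eventually_slice (hΩ : IsOpen Ω) {q : P × E} (hq : q ∈ Ω) :
    ∀ᶠ z in nhds q.2, (q.1, z) ∈ Ω :=
  (Continuous.prodMk_right q.1).continuousAt.preimage_mem_nhds (hΩ.mem_nhds hq)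

theorem congr {f' : P × E → F} (hΩ : IsOpen Ω) (h : ParamContDiffOn n f Ω)
    (hf : ∀ q ∈ Ω, f' q = f q) : ParamContDiffOn n f' Ω := by
  induction n generalizing F with
  | zero => exact ContinuousOn.congr h hf
  | succ n ih =>
    have he : ∀ q ∈ Ω, (fun z => f' (q.1, z)) =ᶠ[nhds q.2] fun z => f (q.1, z) := fun q hq =>
      (eventually_slice hΩ hq).mono fun z hz => hf _ hz
    exact ⟨h.1.congr hf, fun q hq => (h.2.1 q hq).congr_of_eventuallyEq (he q hq),
      ih h.2.2 fun q hq => (he q hq).fderiv_eq⟩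

theorem of_succ (h : ParamContDiffOn (n + 1) f Ω) : ParamContDiffOn n f Ω := by
  induction n generalizing F with
  | zero => exact h.1
  | succ n ih => exact ⟨h.1, h.2.1, ih h.2.2⟩

theorem succ_of_hasFDerivAt (hΩ : IsOpen Ω) {f' : P × E → E →L[ℝ] F} (hc : ContinuousOn f Ω)
    (hd : ∀ q ∈ Ω, HasFDerivAt (fun z => f (q.1, z)) (f' q) q.2) (h : ParamContDiffOn n f' Ω) :
    ParamContDiffOn (n + 1) f Ω :=
  ⟨hc, fun q hq => (hd q hq).differentiableAt, h.congr hΩ fun q hq => (hd q hq).fderiv⟩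

theorem hasFDerivAt (h : ParamContDiffOn (n + 1) f Ω) {q : P × E} (hq : q ∈ Ω) :
    HasFDerivAt (fun z => f (q.1, z)) (fderiv ℝ (fun z => f (q.1, z)) q.2) q.2 :=
  (h.2.1 q hq).hasFDerivAt

theorem of_locally (h : ∀ q ∈ Ω, ∃ Ω' : Set (P × E), IsOpen Ω' ∧ q ∈ Ω' ∧
    ParamContDiffOn n f Ω') : ParamContDiffOn n f Ω := by
  induction n generalizing F with
  | zero =>
    intro q hq
    obtain ⟨Ω', ho, hm, hc⟩ := h q hq
    exact (ContinuousOn.continuousAt hc (ho.mem_nhds hm)).continuousWithinAt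
  | succ n ih =>
    refine ⟨?_, ?_, ih ?_⟩
    · intro q hq
      obtain ⟨Ω', ho, hm, hc⟩ := h q hq
      exact (hc.1.continuousAt (ho.mem_nhds hm)).continuousWithinAt
    · intro q hq
      obtain ⟨Ω', ho, hm, hc⟩ := h q hq
      exact hc.2.1 q hm
    · intro q hq
      obtain ⟨Ω', ho, hm, hc⟩ := h q hq
      exact ⟨Ω', ho, hm, hc.2.2⟩

/-- Glues functions that are given by different formulas on overlapping open sets, such as cut-off
displacements. -/
theorem union {Ω' : Set (P × E)} (hΩ : IsOpen Ω) (hΩ' : IsOpen Ω') (h : ParamContDiffOn n f Ω)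
    (h' : ParamContDiffOn n f Ω') : ParamContDiffOn n f (Ω ∪ Ω') :=
  of_locally fun _ hq => hq.elim (fun hq => ⟨Ω, hΩ, hq, h⟩) fun hq => ⟨Ω', hΩ', hq, h'⟩

theorem of_continuous_fst {c : P → F} (hc : Continuous c) :
    ParamContDiffOn n (fun q : P × E => c q.1) Ω := by
  induction n generalizing F with
  | zero => exact (hc.comp continuous_fst).continuousOn
  | succ n ih =>
    refine ⟨(hc.comp continuous_fst).continuousOn, fun q _ => differentiableAt_const (c q.1), ?_⟩
    simpa using ih (c := fun _ => (0 : E →L[ℝ] F)) continuous_const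

theorem const (c : F) : ParamContDiffOn n (fun _ : P × E => c) Ω :=
  of_continuous_fst (c := fun _ => c) continuous_const

theorem of_contDiffOn {O : Set E} (hO : IsOpen O) {h : E → F} (hh : ContDiffOn ℝ ∞ h O) :
    ParamContDiffOn n (fun q : P × E => h q.2) (Set.univ ×ˢ O) := by
  induction n generalizing F with
  | zero => exact hh.continuousOn.comp continuousOn_snd fun q hq => hq.2
  | succ n ih =>
    exact ⟨hh.continuousOn.comp continuousOn_snd fun q hq => hq.2,
      fun q hq => ((hh.differentiableOn (by simp)) q.2 hq.2).differentiableAt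
        (hO.mem_nhds hq.2), ih (hh.fderiv_of_isOpen hO (by simp))⟩

theorem of_contDiff {h : E → F} (hh : ContDiff ℝ ∞ h) :
    ParamContDiffOn n (fun q : P × E => h q.2) Ω :=
  (of_contDiffOn isOpen_univ hh.contDiffOn).mono fun _ _ => ⟨trivial, trivial⟩

theorem snd : ParamContDiffOn n (fun q : P × E => q.2) Ω := of_contDiff contDiff_id

theorem clm_apply (L : F →L[ℝ] G) (hΩ : IsOpen Ω) (h : ParamContDiffOn n f Ω) :
    ParamContDiffOn n (fun q => L (f q)) Ω := by
  induction n generalizing F G with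
  | zero => exact L.continuous.comp_continuousOn h
  | succ n ih =>
    exact succ_of_hasFDerivAt hΩ (L.continuous.comp_continuousOn h.1)
      (fun q hq => L.hasFDerivAt.comp q.2 (h.hasFDerivAt hq))
      (ih (ContinuousLinearMap.compL ℝ E F G L) h.2.2)

theorem prodMk (hΩ : IsOpen Ω) (hf : ParamContDiffOn n f Ω) (hg : ParamContDiffOn n g Ω) :
    ParamContDiffOn n (fun q => (f q, g q)) Ω := by
  induction n generalizing F G with
  | zero => exact ContinuousOn.prodMk hf hg
  | succ n ih =>
    exact succ_of_hasFDerivAt hΩ (ContinuousOn.prodMk hf.1 hg.1)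
      (fun q hq => (hf.hasFDerivAt hq).prodMk (hg.hasFDerivAt hq))
      ((ih hf.2.2 hg.2.2).clm_apply
        ((ContinuousLinearMap.prodₗᵢ ℝ : ((E →L[ℝ] F) × (E →L[ℝ] G)) ≃ₗᵢ[ℝ] (E →L[ℝ] F × G)
          ).toContinuousLinearEquiv : ((E →L[ℝ] F) × (E →L[ℝ] G)) →L[ℝ] (E →L[ℝ] F × G)) hΩ)

theorem add {f₁ f₂ : P × E → F} (hΩ : IsOpen Ω) (h₁ : ParamContDiffOn n f₁ Ω)
    (h₂ : ParamContDiffOn n f₂ Ω) : ParamContDiffOn n (fun q => f₁ q + f₂ q) Ω :=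
  (prodMk hΩ h₁ h₂).clm_apply (ContinuousLinearMap.fst ℝ F F + ContinuousLinearMap.snd ℝ F F) hΩ

theorem sub {f₁ f₂ : P × E → F} (hΩ : IsOpen Ω) (h₁ : ParamContDiffOn n f₁ Ω)
    (h₂ : ParamContDiffOn n f₂ Ω) : ParamContDiffOn n (fun q => f₁ q - f₂ q) Ω :=
  (prodMk hΩ h₁ h₂).clm_apply (ContinuousLinearMap.fst ℝ F F - ContinuousLinearMap.snd ℝ F F) hΩ

/-- The derivative of `B (f, g)` is a sum of bilinear expressions in `(f, dg)` and in `(df, g)`, so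
the induction closes once all bilinear maps are treated together. Products, scalar multiples and,
through composition of linear maps, the chain rule are instances. -/
theorem bilinear (B : F →L[ℝ] G →L[ℝ] H) (hΩ : IsOpen Ω) (hf : ParamContDiffOn n f Ω)
    (hg : ParamContDiffOn n g Ω) : ParamContDiffOn n (fun q => B (f q) (g q)) Ω := by
  induction n generalizing F G H with
  | zero =>
    exact ContinuousOn.clm_apply (B.continuous.comp_continuousOn hf) hg
  | succ n ih =>
    refine succ_of_hasFDerivAt hΩ
      (ContinuousOn.clm_apply (B.continuous.comp_continuousOn hf.1) hg.1)
      (fun q hq => B.hasFDerivAt_of_bilinear (hf.hasFDerivAt hq) (hg.hasFDerivAt hq)) ?_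
    exact add hΩ (ih (B.precompR E) hf.of_succ hg.2.2) (ih (B.precompL E) hf.2.2 hg.of_succ)

theorem mul {f₁ f₂ : P × E' → ℝ} {Ω : Set (P × E')} (hΩ : IsOpen Ω)
    (h₁ : ParamContDiffOn n f₁ Ω) (h₂ : ParamContDiffOn n f₂ Ω) :
    ParamContDiffOn n (fun q => f₁ q * f₂ q) Ω :=
  bilinear (ContinuousLinearMap.mul ℝ ℝ) hΩ h₁ h₂

theorem smul {c : P × E' → ℝ} {f : P × E' → F'} {Ω : Set (P × E')} (hΩ : IsOpen Ω)
    (hc : ParamContDiffOn n c Ω) (hf : ParamContDiffOn n f Ω) :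
    ParamContDiffOn n (fun q => c q • f q) Ω :=
  bilinear (ContinuousLinearMap.lsmul ℝ ℝ) hΩ hc hf

theorem comp {Ω' : Set (P × F)} {h : P × F → G} (hΩ : IsOpen Ω)
    (hh : ParamContDiffOn n h Ω') (hf : ParamContDiffOn n f Ω)
    (hm : ∀ q ∈ Ω, (q.1, f q) ∈ Ω') : ParamContDiffOn n (fun q => h (q.1, f q)) Ω := by
  induction n generalizing G with
  | zero => exact ContinuousOn.comp hh (continuousOn_fst.prodMk hf) hm
  | succ n ih =>
    refine succ_of_hasFDerivAt hΩ (ContinuousOn.comp hh.1 (continuousOn_fst.prodMk hf.1) hm)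
      (fun q hq => HasFDerivAt.comp (f := fun z => f (q.1, z)) (g := fun y => h (q.1, y)) q.2
        (hh.hasFDerivAt (hm q hq)) (hf.hasFDerivAt hq)) ?_
    exact bilinear (ContinuousLinearMap.compL ℝ E F G) hΩ (ih hh.2.2 hf.of_succ) hf.2.2

theorem contDiffOn_comp {O : Set F} {h : F → G} (hΩ : IsOpen Ω) (hO : IsOpen O)
    (hh : ContDiffOn ℝ ∞ h O) (hf : ParamContDiffOn n f Ω) (hm : ∀ q ∈ Ω, f q ∈ O) :
    ParamContDiffOn n (fun q => h (f q)) Ω :=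
  comp hΩ (of_contDiffOn (P := P) hO hh) hf fun q hq => ⟨trivial, hm q hq⟩

theorem contDiff_comp {h : F → G} (hΩ : IsOpen Ω) (hh : ContDiff ℝ ∞ h)
    (hf : ParamContDiffOn n f Ω) : ParamContDiffOn n (fun q => h (f q)) Ω :=
  contDiffOn_comp hΩ isOpen_univ hh.contDiffOn hf fun _ _ => trivial

theorem comp_fst {P' : Type*} [TopologicalSpace P'] {φ : P' → P} (hφ : Continuous φ)
    (h : ParamContDiffOn n f Ω) :
    ParamContDiffOn n (fun q : P' × E => f (φ q.1, q.2)) {q | (φ q.1, q.2) ∈ Ω} := by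
  have hc : Continuous fun q : P' × E => (φ q.1, q.2) := by fun_prop
  induction n generalizing F with
  | zero => exact ContinuousOn.comp h hc.continuousOn fun q hq => hq
  | succ n ih =>
    exact ⟨ContinuousOn.comp h.1 hc.continuousOn fun q hq => hq, fun q hq => h.2.1 _ hq,
      ih h.2.2⟩

theorem contDiffOn_slice (hΩ : IsOpen Ω) (h : ParamContDiffOn n f Ω) (p : P) :
    ContDiffOn ℝ n (fun z => f (p, z)) {z | (p, z) ∈ Ω} := by
  have ho : IsOpen {z | (p, z) ∈ Ω} := hΩ.preimage (Continuous.prodMk_right p)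
  induction n generalizing F with
  | zero =>
    exact contDiffOn_zero.2 (ContinuousOn.comp h (Continuous.prodMk_right p).continuousOn
      fun z hz => hz)
  | succ n ih =>
    push_cast
    rw [contDiffOn_succ_iff_fderiv_of_isOpen ho]
    exact ⟨fun z hz => (h.2.1 (p, z) hz).differentiableWithinAt, by simp, ih h.2.2⟩

/-- A continuous family of right inverses of a parametrized smooth family with invertible
derivatives is again parametrized smooth. -/
theorem of_inverse [CompleteSpace F] {Ω' : Set (P × F)} {a : P × F → E} {c : P × E → F}
    (hΩ : IsOpen Ω) (ha : ∀ n, ParamContDiffOn n a Ω')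
    (hc : ContinuousOn c Ω) (hm : ∀ q ∈ Ω, (q.1, c q) ∈ Ω')
    (hac : ∀ q ∈ Ω, a (q.1, c q) = q.2)
    (hinv : ∀ q ∈ Ω', (fderiv ℝ (fun z => a (q.1, z)) q.2).IsInvertible) :
    ParamContDiffOn n c Ω := by
  induction n with
  | zero => exact hc
  | succ n ih =>
    -- The derivative of `c` at `q` is the inverse of the derivative of `a` at `c q`. It involves
    -- `c` itself only to order `n`, so one order of smoothness is gained at each step.
    refine succ_of_hasFDerivAt hΩ hc (f' := fun q =>
      (fderiv ℝ (fun z => a (q.1, z)) (c q)).inverse) ?_ ?_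
    · intro q hq
      obtain ⟨e, he⟩ := hinv _ (hm q hq)
      have hd := (ha 1).hasFDerivAt (hm q hq)
      simp only at he hd
      rw [← he] at hd
      rw [← he, ContinuousLinearMap.inverse_equiv]
      refine HasFDerivAt.of_local_left_inverse ?_ hd ?_
      · exact ((hc.continuousAt (hΩ.mem_nhds hq)).comp
          (Continuous.prodMk_right q.1).continuousAt)
      · exact (eventually_slice hΩ hq).mono fun z hz => hac _ hz
    · have h₁ : ParamContDiffOn n (fun q => fderiv ℝ (fun z => a (q.1, z)) (c q)) Ω :=
        comp hΩ (ha (n + 1)).2.2 ih hm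
      have ho : IsOpen {L : F →L[ℝ] E | L.IsInvertible} := by
        have : {L : F →L[ℝ] E | L.IsInvertible} =
            Set.range ((↑) : (F ≃L[ℝ] E) → F →L[ℝ] E) := rfl
        rw [this]
        exact ContinuousLinearEquiv.isOpen
      exact contDiffOn_comp hΩ ho (fun L hL => (ContinuousLinearMap.IsInvertible.contDiffAt_map_inverse
        hL).contDiffWithinAt) h₁ fun q hq => hinv _ (hm q hq)

end ParamContDiffOn

end ParametrizedSmoothness

/-! ### Continuous families in `C^∞_k` as parametrized smooth maps -/

section SmoothFamilies

/-- Up to a linear isometry, the derivative of order `n + 1` of `f` is the derivative of order `n`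
of `fderiv f`. This is the recursion that defines `ParamContDiffOn`. -/
theorem ParamContDiffOn.continuous_iteratedFDeriv {P : Type*} [TopologicalSpace P] {E F : Type}
    [NormedAddCommGroup E] [NormedSpace ℝ E] [NormedAddCommGroup F] [NormedSpace ℝ F] {n : ℕ}
    {f : P × E → F} (h : ParamContDiffOn n f Set.univ) :
    Continuous fun q : P × E => iteratedFDeriv ℝ n (fun z => f (q.1, z)) q.2 := by
  induction n generalizing F with
  | zero =>
    have := (LinearIsometryEquiv.continuous
      (continuousMultilinearCurryFin0 ℝ E F).symm).comp (continuousOn_univ.1 h)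
    refine this.congr fun q => ?_
    rw [iteratedFDeriv_zero_eq_comp]
    rfl
  | succ n ih =>
    have := (LinearIsometryEquiv.continuous
      (continuousMultilinearCurryRightEquiv' ℝ n E F).symm).comp (ih h.2.2)
    refine this.congr fun q => ?_
    rw [iteratedFDeriv_succ_eq_comp_right]
    rfl

theorem paramContDiffOn_of_continuous_iteratedFDeriv {P : Type*} [TopologicalSpace P]
    {E F : Type} [NormedAddCommGroup E] [NormedSpace ℝ E] [NormedAddCommGroup F]
    [NormedSpace ℝ F] {f : P × E → F} (hs : ∀ p, ContDiff ℝ ∞ fun z => f (p, z))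
    (h : ∀ n, Continuous fun q : P × E => iteratedFDeriv ℝ n (fun z => f (q.1, z)) q.2)
    (n : ℕ) : ParamContDiffOn n f Set.univ := by
  have hc {F : Type} [NormedAddCommGroup F] [NormedSpace ℝ F] {f : P × E → F}
      (h : Continuous fun q : P × E => iteratedFDeriv ℝ 0 (fun z => f (q.1, z)) q.2) :
      Continuous f := by
    refine ((LinearIsometryEquiv.continuous
      (continuousMultilinearCurryFin0 ℝ E F)).comp h).congr fun q => ?_
    simp
  induction n generalizing F with
  | zero => exact (hc (h 0)).continuousOn
  | succ n ih =>
    refine ⟨(hc (h 0)).continuousOn,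
      fun q _ => ((hs q.1).differentiable (by simp)).differentiableAt, ih (fun p => ?_) fun m => ?_⟩
    · exact (hs p).fderiv_right (by simp)
    · refine ((LinearIsometryEquiv.continuous
        (continuousMultilinearCurryRightEquiv' ℝ m E F)).comp (h (m + 1))).congr fun q => ?_
      simp only [Function.comp_apply, iteratedFDeriv_succ_eq_comp_right]
      exact LinearIsometryEquiv.apply_symm_apply _ _

variable {k : ℕ}

theorem CInf.ext {f g : CInf k} (h : ∀ z, f.toFun z = g.toFun z) : f = g := by
  cases f; cases g
  congr
  exact funext h

theorem CInf.subQ_apply (f : CInf k) (z : E2 k) : f.subQ z = f.toFun z - Q k z := rfl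

variable {P : Type*} [TopologicalSpace P]

/-- The evaluation of a continuous family in `C^∞_k` is a parametrized smooth map. -/
theorem CInf.paramContDiffOn {f : P → CInf k} (hf : Continuous f) (n : ℕ) :
    ParamContDiffOn n (fun q : P × E2 k => (f q.1).toFun q.2) Set.univ := by
  have h₁ : Continuous fun p => (f p).subQ := continuous_induced_dom.comp hf
  have h₂ : ParamContDiffOn n (fun q : P × E2 k => (f q.1).subQ q.2) Set.univ := by
    refine paramContDiffOn_of_continuous_iteratedFDeriv
      (f := fun q : P × E2 k => (f q.1).subQ q.2) (fun p => (f p).subQ.contDiff) (fun m => ?_) n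
    have h₃ := (ContDiffMapSupportedIn.continuous_iff_comp _).1 h₁ m
    have h₄ : Continuous fun q : P × E2 k =>
        (ContDiffMapSupportedIn.structureMapCLM ℝ ⊤ m (f q.1).subQ) q.2 :=
      (h₃.comp continuous_fst).eval continuous_snd
    refine h₄.congr fun q => ?_
    rw [ContDiffMapSupportedIn.structureMapCLM_top_apply]
  refine (h₂.add isOpen_univ (ParamContDiffOn.of_contDiff (contDiff_Q k))).congr isOpen_univ
    fun q _ => ?_
  simp [CInf.subQ_apply]

/-- Joint continuity of the derivatives is enough for uniform convergence: the derivatives of `f -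
Q` vanish outside the compact set `A`, and over `A` the tube lemma applies. Together with
`CInf.paramContDiffOn` this reduces continuity of all constructions in `C^∞_k` to the calculus of
parametrized smooth maps. -/
theorem CInf.continuous_of_paramContDiffOn {f : P → CInf k}
    (h : ∀ n, ParamContDiffOn n (fun q : P × E2 k => (f q.1).toFun q.2) Set.univ) :
    Continuous f := by
  refine continuous_induced_rng.2 ((ContDiffMapSupportedIn.continuous_iff_comp _).2 fun m => ?_)
  have h₁ : Continuous fun q : P × E2 k => iteratedFDeriv ℝ m ((f q.1).subQ) q.2 :=
    ((h m).sub isOpen_univ (ParamContDiffOn.of_contDiff (contDiff_Q k))).continuous_iteratedFDeriv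
  obtain ⟨Φ, hΦ⟩ : ∃ Φ : P → BoundedContinuousFunction (E2 k) (E2 k [×m]→L[ℝ] ℝ),
      Φ = ContDiffMapSupportedIn.structureMapCLM ℝ ⊤ m ∘ (CInf.subQ ∘ f) := ⟨_, rfl⟩
  have hval : ∀ p z, Φ p z = iteratedFDeriv ℝ m ((f p).subQ) z := fun p z => by
    rw [hΦ, Function.comp_apply, Function.comp_apply, ContDiffMapSupportedIn.structureMapCLM_top_apply]
  rw [← hΦ]
  refine continuous_iff_continuousAt.2 fun p₀ => Metric.tendsto_nhds.2 fun ε hε => ?_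
  have ho : IsOpen {q : P × E2 k | dist (iteratedFDeriv ℝ m ((f q.1).subQ) q.2)
      (iteratedFDeriv ℝ m ((f p₀).subQ) q.2) < ε / 2} := by
    refine isOpen_lt (Continuous.dist h₁ ?_) continuous_const
    exact h₁.comp (f := fun q : P × E2 k => (p₀, q.2)) (by fun_prop)
  obtain ⟨u, v, hu, hv, hpu, hAv, huv⟩ := generalized_tube_lemma
    (isCompact_singleton (x := p₀)) (isCompact_setA k) ho (by
      rintro ⟨p, z⟩ ⟨rfl, -⟩
      simpa using hε)
  filter_upwards [hu.mem_nhds (hpu rfl)] with p hp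
  refine lt_of_le_of_lt ((BoundedContinuousFunction.dist_le (by positivity)).2 fun z => ?_)
    (half_lt_self hε)
  rw [hval, hval]
  by_cases hz : z ∈ setA k
  · have h₂ : (p, z) ∈ {q : P × E2 k | dist (iteratedFDeriv ℝ m ((f q.1).subQ) q.2)
        (iteratedFDeriv ℝ m ((f p₀).subQ) q.2) < ε / 2} := huv ⟨hp, hAv hz⟩
    rw [Set.mem_ofPred_eq] at h₂
    exact h₂.le
  · have h0 : ∀ p, iteratedFDeriv ℝ m ((f p).subQ) z = 0 := by
      intro p
      have h₂ : (fun z => (f p).subQ z) =ᶠ[nhds z] fun _ => 0 := by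
        filter_upwards [(isCompact_setA k).isClosed.isOpen_compl.mem_nhds hz] with y hy
        exact sub_eq_zero.2 ((f p).eq_Q y hy)
      have h₃ := h₂.iteratedFDeriv ℝ m
      exact h₃.eq_of_nhds.trans (by simp)
    rw [h0, h0, dist_self]
    positivity

theorem ParamContDiffOn.contDiff_slice {g : P × E2 k → ℝ}
    (hg : ∀ n, ParamContDiffOn n g Set.univ) (p : P) : ContDiff ℝ ∞ fun z => g (p, z) := by
  refine contDiff_infty.2 fun n => ?_
  have := (hg n).contDiffOn_slice isOpen_univ p
  simpa [contDiffOn_univ] using this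

/-- The member of `C^∞_k` given by a member of a parametrized smooth family. -/
def CInf.ofFamily (g : P × E2 k → ℝ) (hg : ∀ n, ParamContDiffOn n g Set.univ)
    (hQ : ∀ p, ∀ z ∉ setA k, g (p, z) = Q k z) (p : P) : CInf k :=
  ⟨fun z => g (p, z), ParamContDiffOn.contDiff_slice hg p, hQ p⟩

theorem CInf.continuous_ofFamily (g : P × E2 k → ℝ) (hg : ∀ n, ParamContDiffOn n g Set.univ)
    (hQ : ∀ p, ∀ z ∉ setA k, g (p, z) = Q k z) : Continuous (CInf.ofFamily g hg hQ) :=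
  CInf.continuous_of_paramContDiffOn hg

end SmoothFamilies

/-! ### Implicit and inverse functions with a continuous parameter -/

section ImplicitFunctions

variable {P : Type*} [TopologicalSpace P] {W E : Type} [NormedAddCommGroup W] [NormedSpace ℝ W]
  [FiniteDimensional ℝ W] [NormedAddCommGroup E] [NormedSpace ℝ E] [FiniteDimensional ℝ E]

omit [FiniteDimensional ℝ W] in
theorem ContinuousLinearMap.isInvertible_of_injective [FiniteDimensional ℝ W] {L : W →L[ℝ] W}
    (h : ∀ v, L v = 0 → v = 0) : L.IsInvertible := by
  have hi : Function.Injective (L : W →ₗ[ℝ] W) := by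
    rw [← LinearMap.ker_eq_bot, LinearMap.ker_eq_bot']
    exact h
  exact ⟨(LinearEquiv.ofInjectiveEndo _ hi).toContinuousLinearEquiv, by ext v; rfl⟩

/-- The implicit function theorem for a parametrized smooth family of functions that are strictly
increasing in a real variable. -/
theorem exists_paramContDiffOn_root {κ : P × (W × ℝ) → ℝ} {Ω : Set (P × W)} {r : ℝ}
    (hκ : ∀ n, ParamContDiffOn n κ Set.univ) (hΩ : IsOpen Ω)
    (hpos : ∀ q ∈ Ω, ∀ τ ∈ Set.Icc (-r) r,
      0 < fderiv ℝ (fun y => κ (q.1, y)) (q.2, τ) (0, 1))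
    (hneg : ∀ q ∈ Ω, κ (q.1, (q.2, -r)) < 0) (hpos' : ∀ q ∈ Ω, 0 < κ (q.1, (q.2, r))) (hr : 0 < r) :
    ∃ τ : P × W → ℝ, (∀ n, ParamContDiffOn n τ Ω) ∧ ∀ q ∈ Ω, τ q ∈ Set.Ioo (-r) r ∧
      κ (q.1, (q.2, τ q)) = 0 ∧ ∀ ξ ∈ Set.Icc (-r) r, κ (q.1, (q.2, ξ)) = 0 → ξ = τ q := by
  have hκc : Continuous κ := continuousOn_univ.1 (hκ 0)
  have hd : ∀ (p : P) (w : W) (ξ : ℝ), HasDerivAt (fun ξ => κ (p, (w, ξ)))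
      (fderiv ℝ (fun y => κ (p, y)) (w, ξ) (0, 1)) ξ := fun p w ξ =>
    HasFDerivAt.comp_hasDerivAt ξ ((hκ 1).hasFDerivAt (q := (p, (w, ξ))) trivial)
      ((hasDerivAt_const ξ w).prodMk (hasDerivAt_id ξ))
  have hmono : ∀ q ∈ Ω, StrictMonoOn (fun ξ => κ (q.1, (q.2, ξ))) (Set.Icc (-r) r) := by
    intro q hq
    refine strictMonoOn_of_deriv_pos (convex_Icc _ _) (by fun_prop) fun ξ hξ => ?_
    rw [(hd q.1 q.2 ξ).deriv]
    exact hpos q hq ξ (interior_subset hξ)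
  -- The equation `κ = s` is solved for all `s` between the values at the two ends, not only for `s
  -- = 0`. Then `(w, s) ↦ (w, ρ)` is a right inverse of `(w, ξ) ↦ (w, κ)`, and
  -- `ParamContDiffOn.of_inverse` gives its smoothness.
  let Ω₁ : Set (P × (W × ℝ)) := {q | (q.1, q.2.1) ∈ Ω ∧ κ (q.1, (q.2.1, -r)) < q.2.2 ∧
    q.2.2 < κ (q.1, (q.2.1, r))}
  let Ω₂ : Set (P × (W × ℝ)) := {q | (q.1, q.2.1) ∈ Ω ∧ q.2.2 ∈ Set.Ioo (-r) r}
  have hl₁ : IsOpen {q : P × (W × ℝ) | κ (q.1, (q.2.1, -r)) < q.2.2} :=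
    isOpen_lt (by fun_prop) (by fun_prop)
  have hl₂ : IsOpen {q : P × (W × ℝ) | q.2.2 < κ (q.1, (q.2.1, r))} :=
    isOpen_lt (by fun_prop) (by fun_prop)
  have hΩ₁ : IsOpen Ω₁ := (hΩ.preimage (f := fun q : P × (W × ℝ) => (q.1, q.2.1))
    (by fun_prop)).inter (hl₁.inter hl₂)
  have hroot : ∀ q : P × (W × ℝ), ∃ ξ, q ∈ Ω₁ → ξ ∈ Set.Ioo (-r) r ∧ κ (q.1, (q.2.1, ξ)) = q.2.2 := by
    intro q
    by_cases hq : q ∈ Ω₁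
    · obtain ⟨ξ, hξ, h⟩ := intermediate_value_Ioo (by linarith : -r ≤ r)
        (f := fun ξ => κ (q.1, (q.2.1, ξ))) (by fun_prop) ⟨hq.2.1, hq.2.2⟩
      exact ⟨ξ, fun _ => ⟨hξ, h⟩⟩
    · exact ⟨0, fun h => absurd h hq⟩
  choose ρ hρ using hroot
  -- By monotonicity, a bound `a` on the root amounts to comparing `κ` at `a` with the prescribed
  -- value, which is an open condition.
  have hρc : ContinuousOn ρ Ω₁ := by
    intro q₀ hq₀
    refine ContinuousAt.continuousWithinAt (tendsto_order.2 ⟨fun a ha => ?_, fun a ha => ?_⟩)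
    · rcases lt_or_ge a (-r) with h | h
      · filter_upwards [hΩ₁.mem_nhds hq₀] with q hq
        exact h.trans (hρ q hq).1.1
      · have ha' : a ∈ Set.Icc (-r) r := ⟨h, (ha.trans (hρ q₀ hq₀).1.2).le⟩
        have h₁ : κ (q₀.1, (q₀.2.1, a)) < q₀.2.2 := by
          have := hmono _ hq₀.1 ha' (Set.Ioo_subset_Icc_self (hρ q₀ hq₀).1) ha
          rwa [show q₀.2.2 = _ from (hρ q₀ hq₀).2.symm]
        have h₂ : IsOpen {q : P × (W × ℝ) | κ (q.1, (q.2.1, a)) < q.2.2} :=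
          isOpen_lt (by fun_prop) (by fun_prop)
        filter_upwards [hΩ₁.mem_nhds hq₀, h₂.mem_nhds h₁] with q hq hq'
        by_contra! hc
        have := (hmono _ hq.1).monotoneOn (Set.Ioo_subset_Icc_self (hρ q hq).1) ha' hc
        simp only [(hρ q hq).2] at this
        exact absurd hq' (not_lt.2 this)
    · rcases lt_or_ge r a with h | h
      · filter_upwards [hΩ₁.mem_nhds hq₀] with q hq
        exact (hρ q hq).1.2.trans h
      · have ha' : a ∈ Set.Icc (-r) r := ⟨((hρ q₀ hq₀).1.1.trans ha).le, h⟩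
        have h₁ : q₀.2.2 < κ (q₀.1, (q₀.2.1, a)) := by
          have := hmono _ hq₀.1 (Set.Ioo_subset_Icc_self (hρ q₀ hq₀).1) ha' ha
          rwa [show q₀.2.2 = _ from (hρ q₀ hq₀).2.symm]
        have h₂ : IsOpen {q : P × (W × ℝ) | q.2.2 < κ (q.1, (q.2.1, a))} :=
          isOpen_lt (by fun_prop) (by fun_prop)
        filter_upwards [hΩ₁.mem_nhds hq₀, h₂.mem_nhds h₁] with q hq hq'
        by_contra! hc
        have := (hmono _ hq.1).monotoneOn ha' (Set.Ioo_subset_Icc_self (hρ q hq).1) hc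
        simp only [(hρ q hq).2] at this
        exact absurd hq' (not_lt.2 this)
  have hs : ∀ n, ParamContDiffOn n (fun q : P × (W × ℝ) => (q.2.1, ρ q)) Ω₁ := by
    intro n
    refine ParamContDiffOn.of_inverse (Ω' := Ω₂) (a := fun q => (q.2.1, κ q)) hΩ₁
      (fun n => ((ParamContDiffOn.of_contDiff contDiff_fst).prodMk isOpen_univ (hκ n)).mono
        (Set.subset_univ _)) (ContinuousOn.prodMk (by fun_prop) hρc)
      (fun q hq => ⟨hq.1, (hρ q hq).1⟩) (fun q hq => ?_) (fun q hq => ?_)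
    · simp only [(hρ q hq).2]
    · have hf : HasFDerivAt (fun y : W × ℝ => (y.1, κ (q.1, y)))
          ((ContinuousLinearMap.fst ℝ W ℝ).prod (fderiv ℝ (fun y => κ (q.1, y)) q.2)) q.2 :=
        hasFDerivAt_fst.prodMk ((hκ 1).hasFDerivAt trivial)
      rw [hf.fderiv]
      refine ContinuousLinearMap.isInvertible_of_injective fun v hv => ?_
      obtain ⟨v, s⟩ := v
      simp only [ContinuousLinearMap.prod_apply, ContinuousLinearMap.coe_fst', Prod.mk_eq_zero] at hv
      obtain ⟨rfl, hv⟩ := hv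
      have h₁ : ((0 : W), s) = s • ((0 : W), (1 : ℝ)) := by simp
      rw [h₁, map_smul, smul_eq_mul, mul_eq_zero] at hv
      rcases hv with rfl | hv
      · rfl
      · exact absurd hv (hpos _ hq.1 _ (Set.Ioo_subset_Icc_self hq.2)).ne'
  have hm : ∀ q ∈ Ω, (q.1, (q.2, (0 : ℝ))) ∈ Ω₁ := fun q hq => ⟨hq, hneg q hq, hpos' q hq⟩
  refine ⟨fun q => ρ (q.1, (q.2, 0)), fun n => ?_, fun q hq => ?_⟩
  · exact (ParamContDiffOn.comp hΩ (hs n) (ParamContDiffOn.of_contDiff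
      (h := fun w : W => (w, (0 : ℝ))) (by fun_prop)) hm).clm_apply
      (ContinuousLinearMap.snd ℝ W ℝ) hΩ
  · have h := hρ _ (hm q hq)
    refine ⟨h.1, h.2, fun ξ hξ h0 => ?_⟩
    exact (hmono q hq).injOn hξ (Set.Ioo_subset_Icc_self h.1) (h0.trans h.2.symm)

/-- A parametrized smooth family of maps whose derivatives are close to the identity consists of
diffeomorphisms, and the inverses are again a parametrized smooth family. -/
theorem exists_paramContDiffOn_inverse {χ : P × (ℝ × E) → E} {U : Set P} {J : Set ℝ}
    (hU : IsOpen U) (hJ : IsOpen J) (hχ : ∀ n, ParamContDiffOn n χ (U ×ˢ (J ×ˢ Set.univ)))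
    (hsmall : ∀ p ∈ U, ∀ t ∈ J, ∀ z, ‖(fderiv ℝ (fun y => χ (p, y)) (t, z)).comp
      (ContinuousLinearMap.inr ℝ ℝ E) - ContinuousLinearMap.id ℝ E‖ ≤ 1 / 2) :
    ∃ χ' : P × (ℝ × E) → E, (∀ n, ParamContDiffOn n χ' (U ×ˢ (J ×ˢ Set.univ))) ∧
      ∀ p ∈ U, ∀ t ∈ J, (∀ z, χ' (p, (t, χ (p, (t, z)))) = z) ∧
        ∀ z, χ (p, (t, χ' (p, (t, z)))) = z := by
  have hΩ : IsOpen (U ×ˢ (J ×ˢ (Set.univ : Set E))) := hU.prod (hJ.prod isOpen_univ)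
  have hd : ∀ p ∈ U, ∀ t ∈ J, ∀ z, HasFDerivAt (fun z => χ (p, (t, z)) - z)
      ((fderiv ℝ (fun y => χ (p, y)) (t, z)).comp
      (ContinuousLinearMap.inr ℝ ℝ E) - ContinuousLinearMap.id ℝ E) z := by
    intro p hp t ht z
    have h₁ : HasFDerivAt (fun z : E => (t, z)) (ContinuousLinearMap.inr ℝ ℝ E) z :=
      hasFDerivAt_prodMk_right t z
    exact (HasFDerivAt.comp z ((hχ 1).hasFDerivAt (q := (p, (t, z))) ⟨hp, ht, trivial⟩) h₁).sub
      (hasFDerivAt_id z)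
  have hl : ∀ p ∈ U, ∀ t ∈ J, ∀ z z', ‖(χ (p, (t, z)) - z) - (χ (p, (t, z')) - z')‖ ≤
      1 / 2 * ‖z - z'‖ := by
    intro p hp t ht z z'
    exact convex_univ.norm_image_sub_le_of_norm_hasFDerivWithin_le
      (f := fun z => χ (p, (t, z)) - z)
      (fun x _ => (hd p hp t ht x).hasFDerivWithinAt) (fun x _ => hsmall p hp t ht x) trivial trivial
  have hanti : ∀ p ∈ U, ∀ t ∈ J, ∀ z z', ‖z - z'‖ ≤ 2 * ‖χ (p, (t, z)) - χ (p, (t, z'))‖ := by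
    intro p hp t ht z z'
    have h₁ := hl p hp t ht z z'
    have h₂ : ‖z - z'‖ ≤ ‖χ (p, (t, z)) - χ (p, (t, z'))‖ +
        ‖(χ (p, (t, z)) - z) - (χ (p, (t, z')) - z')‖ := by
      refine le_trans (le_of_eq ?_) (norm_sub_le _ _)
      congr 1
      abel
    linarith
  have hsurj : ∀ q : P × (ℝ × E), ∃ v, q ∈ U ×ˢ (J ×ˢ (Set.univ : Set E)) →
      χ (q.1, (q.2.1, v)) = q.2.2 := by
    rintro ⟨p, t, z⟩
    by_cases hq : (p, (t, z)) ∈ U ×ˢ (J ×ˢ (Set.univ : Set E))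
    -- A solution of `χ v = z` is a fixed point of `v ↦ z - (χ v - v)`.
    · have hc : ContractingWith (1 / 2) fun v => z - (χ (p, (t, v)) - v) := by
        refine ⟨by norm_num, LipschitzWith.of_dist_le_mul fun v v' => ?_⟩
        have := hl p hq.1 t hq.2.1 v' v
        rw [dist_eq_norm, dist_eq_norm, norm_sub_rev v v']
        refine le_trans (le_of_eq ?_) (this.trans (le_of_eq (by norm_num)))
        congr 1
        abel
      refine ⟨ContractingWith.fixedPoint _ hc, fun _ => ?_⟩
      have := hc.fixedPoint_isFixedPt
      rw [Function.IsFixedPt, sub_sub_eq_add_sub, sub_eq_iff_eq_add, add_comm] at this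
      exact (add_left_cancel this).symm
    · exact ⟨0, fun h => absurd h hq⟩
  choose χ' hχ' using hsurj
  have hcont : ContinuousOn χ' (U ×ˢ (J ×ˢ Set.univ)) := by
    intro q₀ hq₀
    have h₁ : ContinuousWithinAt (fun q : P × (ℝ × E) => 2 * ‖q.2.2 - χ (q.1, (q.2.1, χ' q₀))‖)
        (U ×ˢ (J ×ˢ Set.univ)) q₀ := by
      refine continuousWithinAt_const.mul (ContinuousWithinAt.norm (ContinuousWithinAt.sub
        (by fun_prop) ?_))
      refine ContinuousWithinAt.comp (f := fun q : P × (ℝ × E) => (q.1, (q.2.1, χ' q₀)))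
        ((hχ 0).continuousOn _ ?_) (by fun_prop) fun q hq => ?_
      · exact ⟨hq₀.1, hq₀.2.1, trivial⟩
      · exact ⟨hq.1, hq.2.1, trivial⟩
    rw [ContinuousWithinAt, tendsto_iff_norm_sub_tendsto_zero]
    have h₂ := h₁.tendsto
    simp only [hχ' q₀ hq₀, sub_self, norm_zero, mul_zero] at h₂
    refine squeeze_zero' (Filter.Eventually.of_forall fun _ => norm_nonneg _) ?_ h₂
    filter_upwards [self_mem_nhdsWithin] with q hq
    have := hanti q.1 hq.1 q.2.1 hq.2.1 (χ' q) (χ' q₀)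
    rwa [hχ' q hq] at this
  refine ⟨χ', fun n => ?_, fun p hp t ht => ⟨fun z => ?_, fun z => hχ' (p, (t, z)) ⟨hp, ht, trivial⟩⟩⟩
  -- Keeping the time as a coordinate gives a self-map of `ℝ × E` with block triangular derivative,
  -- so the inverse is smooth in time as well.
  · have hs : ParamContDiffOn n (fun q : P × (ℝ × E) => (q.2.1, χ' q)) (U ×ˢ (J ×ˢ Set.univ)) := by
      refine ParamContDiffOn.of_inverse (Ω' := U ×ˢ (J ×ˢ Set.univ))
        (a := fun q => (q.2.1, χ q)) hΩ
        (fun n => (ParamContDiffOn.of_contDiff contDiff_fst).prodMk hΩ (hχ n))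
        (ContinuousOn.prodMk (by fun_prop) hcont) (fun q hq => ⟨hq.1, hq.2.1, trivial⟩)
        (fun q hq => by simp only [hχ' q hq]) fun q hq => ?_
      have hf : HasFDerivAt (fun y : ℝ × E => (y.1, χ (q.1, y)))
          ((ContinuousLinearMap.fst ℝ ℝ E).prod (fderiv ℝ (fun y => χ (q.1, y)) q.2)) q.2 :=
        hasFDerivAt_fst.prodMk ((hχ 1).hasFDerivAt hq)
      rw [hf.fderiv]
      refine ContinuousLinearMap.isInvertible_of_injective fun v hv => ?_
      obtain ⟨s, v⟩ := v
      simp only [ContinuousLinearMap.prod_apply, ContinuousLinearMap.coe_fst', Prod.mk_eq_zero] at hv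
      obtain ⟨rfl, hv⟩ := hv
      have h₁ := ContinuousLinearMap.le_of_opNorm_le _ (hsmall q.1 hq.1 q.2.1 hq.2.1 q.2.2) v
      simp only [Prod.mk.eta, sub_apply, ContinuousLinearMap.comp_apply,
        ContinuousLinearMap.inr_apply, hv, ContinuousLinearMap.id_apply, zero_sub, norm_neg] at h₁
      have h₂ : ‖v‖ = 0 := le_antisymm (by linarith) (norm_nonneg v)
      rw [norm_eq_zero.1 h₂]
      rfl
    exact hs.clm_apply (ContinuousLinearMap.snd ℝ ℝ E) hΩ
  · have h₁ := hanti p hp t ht (χ' (p, (t, χ (p, (t, z))))) z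
    rw [hχ' (p, (t, χ (p, (t, z)))) ⟨hp, ht, trivial⟩] at h₁
    simp only [sub_self, norm_zero, mul_zero] at h₁
    exact sub_eq_zero.1 (norm_le_zero_iff.1 h₁)

end ImplicitFunctions

/-! ### Isotopies that follow a regular level under small changes of the function -/

section LevelIsotopy

/-- A linear map from the dual of a finite-dimensional space to the space that turns a nonzero
linear form into a vector on which it is positive. -/
theorem exists_dual_pos (E : Type) [NormedAddCommGroup E] [NormedSpace ℝ E]
    [FiniteDimensional ℝ E] :
    ∃ J : (E →L[ℝ] ℝ) →L[ℝ] E, ∀ l : E →L[ℝ] ℝ, l ≠ 0 → 0 < l (J l) := by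
  let v := Module.finBasis ℝ E
  refine ⟨∑ i, (ContinuousLinearMap.apply ℝ ℝ (v i)).smulRight (v i), fun l hl => ?_⟩
  have h₁ : l ((∑ i, (ContinuousLinearMap.apply ℝ ℝ (v i)).smulRight (v i)) l) =
      ∑ i, l (v i) * l (v i) := by
    simp [map_sum]
  rw [h₁]
  refine Finset.sum_pos' (fun i _ => mul_self_nonneg _) ?_
  by_contra! h
  refine hl (ContinuousLinearMap.coe_injective (v.ext fun i => ?_))
  exact mul_self_eq_zero.1 (le_antisymm (h i (Finset.mem_univ i)) (mul_self_nonneg _))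

theorem IsCompact.exists_isOpen_forall {P Y : Type*} [TopologicalSpace P] [TopologicalSpace Y]
    {P₀ : Set P} {K : Set Y} (hP₀ : IsCompact P₀) (hK : IsCompact K) {O : Set (P × Y)}
    (hO : IsOpen O) (h : ∀ p ∈ P₀, ∀ y ∈ K, (p, y) ∈ O) :
    ∃ U, IsOpen U ∧ P₀ ⊆ U ∧ ∀ p ∈ U, ∀ y ∈ K, (p, y) ∈ O := by
  obtain ⟨u, v, hu, -, hPu, hKv, huv⟩ := generalized_tube_lemma hP₀ hK hO
    (fun q hq => h q.1 hq.1 q.2 hq.2)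
  exact ⟨u, hu, hPu, fun p hp y hy => huv ⟨hp, hKv hy⟩⟩

variable {k : ℕ} {P : Type*} [TopologicalSpace P]

set_option maxHeartbeats 1000000 in
/-- If two families of functions with a regular level agree on a compact set of parameters, then
near this set, there is a parametrized smooth family of isotopies that fix everything outside of
`A` and take the first function to the second one near its level set, through the linear
interpolation of the functions. -/
theorem exists_levelIsotopy {P₀ : Set P} (hP₀ : IsCompact P₀) {F G : P → CInf k} {b : P → ℝ}
    (hF : Continuous F) (hG : Continuous G) (hb : Continuous b) (heq : ∀ p ∈ P₀, F p = G p)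
    (hreg : ∀ p ∈ P₀, IsRegularValue (G p).toFun (b p)) {δ₀ : ℝ} (hδ₀ : 0 < δ₀) :
    ∃ U : Set P, IsOpen U ∧ P₀ ⊆ U ∧ ∃ ε > 0, ∃ χ χ' : P × (ℝ × E2 k) → E2 k,
      (∀ n, ParamContDiffOn n χ (U ×ˢ (Set.Ioo (-1 / 2) (3 / 2) ×ˢ Set.univ))) ∧
      (∀ n, ParamContDiffOn n χ' (U ×ˢ (Set.Ioo (-1 / 2) (3 / 2) ×ˢ Set.univ))) ∧
      ∀ p ∈ U, ∀ t ∈ Set.Ioo (-1 / 2 : ℝ) (3 / 2),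
        (∀ z, χ' (p, (t, χ (p, (t, z)))) = z) ∧ (∀ z, χ (p, (t, χ' (p, (t, z)))) = z) ∧
        (∀ z ∉ setA k, χ (p, (t, z)) = z) ∧ (t = 0 → ∀ z, χ (p, (t, z)) = z) ∧
        (∀ z, |(G p).toFun z - b p| < ε →
          (1 - t) * (G p).toFun (χ (p, (t, z))) + t * (F p).toFun (χ (p, (t, z))) =
            (G p).toFun z) ∧
        (∀ z, ε ≤ |(G p).toFun z - b p| →
          |(1 - t) * (G p).toFun (χ (p, (t, z))) + t * (F p).toFun (χ (p, (t, z))) -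
            (G p).toFun z| < ε) ∧
        ((∀ z, |(G p).toFun z - b p| < δ₀ → (F p).toFun z = (G p).toFun z) →
          ∀ z, χ (p, (t, z)) = z) := by
  classical
  obtain ⟨r, hr⟩ := (isCompact_setA k).isBounded.subset_ball 0
  obtain ⟨J, hJ⟩ := exists_dual_pos (E2 k)
  let B : Set (E2 k) := Metric.closedBall 0 r
  have hB : IsCompact B := isCompact_closedBall 0 r
  have hAB : ∀ z, z ∉ Metric.ball (0 : E2 k) r → z ∉ setA k := fun z hz h => hz (hr h)
  let g : P × E2 k → ℝ := fun q => (G q.1).toFun q.2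
  let f : P × E2 k → ℝ := fun q => (F q.1).toFun q.2
  have hg : ∀ n, ParamContDiffOn n g Set.univ := CInf.paramContDiffOn hG
  have hf : ∀ n, ParamContDiffOn n f Set.univ := CInf.paramContDiffOn hF
  have hgc : Continuous g := continuousOn_univ.1 (hg 0)
  have hfc : Continuous f := continuousOn_univ.1 (hf 0)
  have hfg : ∀ p z, z ∉ setA k → f (p, z) = g (p, z) := fun p z hz =>
    ((F p).eq_Q z hz).trans ((G p).eq_Q z hz).symm
  let h : P × (ℝ × E2 k) → ℝ := fun q => (1 - q.2.1) * g (q.1, q.2.2) + q.2.1 * f (q.1, q.2.2)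
  have hh : ∀ n, ParamContDiffOn n h Set.univ := by
    intro n
    have h₁ : ParamContDiffOn n (fun q : P × (ℝ × E2 k) => q.2.2) Set.univ :=
      ParamContDiffOn.of_contDiff contDiff_snd
    have h₂ : ParamContDiffOn n (fun q : P × (ℝ × E2 k) => q.2.1) Set.univ :=
      ParamContDiffOn.of_contDiff contDiff_fst
    exact ((((ParamContDiffOn.const 1).sub isOpen_univ h₂).mul isOpen_univ
      ((hg n).comp isOpen_univ h₁ fun _ _ => trivial))).add isOpen_univ
      (h₂.mul isOpen_univ ((hf n).comp isOpen_univ h₁ fun _ _ => trivial))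
  have hhc : Continuous h := continuousOn_univ.1 (hh 0)
  have hheq : ∀ p t z, f (p, z) = g (p, z) → h (p, (t, z)) = g (p, z) := by
    intro p t z hz
    simp only [h, hz]
    ring
  -- A gradient-like field: the derivative of `g` along `ν` is positive wherever `dg` is nonzero,
  -- and `ν` is smooth even at critical points.
  let ν : P × E2 k → E2 k := fun q => J (fderiv ℝ (fun z => g (q.1, z)) q.2)
  have hν : ∀ n, ParamContDiffOn n ν Set.univ := fun n =>
    (hg (n + 1)).2.2.clm_apply J isOpen_univ
  have hνc : Continuous ν := continuousOn_univ.1 (hν 0)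
  have hνJ : ∀ p z, ν (p, z) = J (fderiv ℝ (fun z => g (p, z)) z) := fun _ _ => rfl
  have hh0 : ∀ p z, h (p, (0, z)) = g (p, z) := by
    intro p z
    simp [h]
  have hht : ∀ p t z, h (p, (t, z)) = (1 - t) * (G p).toFun z + t * (F p).toFun z :=
    fun _ _ _ => rfl
  clear_value ν h
  -- A zero `ξ` of `κ` is the distance by which `z` has to move along `ν z` so that `h t` takes
  -- there the value `g z`.
  let κ : P × ((ℝ × E2 k) × ℝ) → ℝ := fun q =>
    h (q.1, (q.2.1.1, q.2.1.2 + q.2.2 • ν (q.1, q.2.1.2))) - g (q.1, q.2.1.2)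
  have hκ : ∀ n, ParamContDiffOn n κ Set.univ := by
    intro n
    have h₁ : ParamContDiffOn n (fun q : P × ((ℝ × E2 k) × ℝ) => q.2.1.2) Set.univ :=
      ParamContDiffOn.of_contDiff (h := fun y : (ℝ × E2 k) × ℝ => y.1.2) (by fun_prop)
    have h₂ : ParamContDiffOn n (fun q : P × ((ℝ × E2 k) × ℝ) => q.2.1.1) Set.univ :=
      ParamContDiffOn.of_contDiff (h := fun y : (ℝ × E2 k) × ℝ => y.1.1) (by fun_prop)
    have h₃ : ParamContDiffOn n (fun q : P × ((ℝ × E2 k) × ℝ) => q.2.2) Set.univ :=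
      ParamContDiffOn.of_contDiff contDiff_snd
    exact ((hh n).comp isOpen_univ (h₂.prodMk isOpen_univ (h₁.add isOpen_univ
      (h₃.smul isOpen_univ ((hν n).comp isOpen_univ h₁ fun _ _ => trivial))))
      fun _ _ => trivial).sub isOpen_univ ((hg n).comp isOpen_univ h₁ fun _ _ => trivial)
  have hκc : Continuous κ := continuousOn_univ.1 (hκ 0)
  have hκh : ∀ p t z ξ, κ (p, ((t, z), ξ)) = h (p, (t, z + ξ • ν (p, z))) - g (p, z) :=
    fun _ _ _ _ => rfl
  clear_value κ
  have hκ0 : ∀ p t z, f (p, z) = g (p, z) → κ (p, ((t, z), 0)) = 0 := by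
    intro p t z hz
    rw [hκh, zero_smul, add_zero, hheq p t z hz, sub_self]
  -- the width of the collar of the level set
  obtain ⟨δ, hδ, hδδ₀, hδr⟩ : ∃ δ > 0, δ ≤ δ₀ ∧ ∀ p ∈ P₀, ∀ z ∈ B, |g (p, z) - b p| ≤ δ →
      fderiv ℝ (fun z => g (p, z)) z ≠ 0 := by
    have hc : IsCompact ((P₀ ×ˢ B) ∩ {q | fderiv ℝ (fun z => g (q.1, z)) q.2 = 0}) :=
      (hP₀.prod hB).inter_right (isClosed_eq (continuousOn_univ.1 (hg 1).2.2) continuous_const)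
    obtain ⟨a, ha, hmin⟩ := hc.exists_forall_le' (f := fun q => |g q - b q.1|) (a := 0)
      (by fun_prop) (by
        rintro ⟨p, z⟩ ⟨⟨hp, -⟩, hz⟩
        refine abs_pos.2 (sub_ne_zero.2 fun he => ?_)
        exact hreg p hp z he hz)
    refine ⟨min δ₀ (a / 2), lt_min hδ₀ (by linarith), min_le_left _ _, fun p hp z hz hle h0 => ?_⟩
    have := hmin (p, z) ⟨⟨hp, hz⟩, h0⟩
    have := min_le_right δ₀ (a / 2)
    simp only at *
    linarith
  let D : P × ((ℝ × E2 k) × ℝ) → ℝ := fun q => fderiv ℝ (fun y => κ (q.1, y)) q.2 (0, 1)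
  have hDc : Continuous D := (continuousOn_univ.1 (hκ 1).2.2).clm_apply continuous_const
  have hDκ : ∀ q, D q = fderiv ℝ (fun y => κ (q.1, y)) q.2 (0, 1) := fun _ => rfl
  have hD : ∀ p w ξ, HasDerivAt (fun ξ => κ (p, (w, ξ))) (D (p, (w, ξ))) ξ := fun p w ξ =>
    HasFDerivAt.comp_hasDerivAt ξ ((hκ 1).hasFDerivAt (q := (p, (w, ξ))) trivial)
      ((hasDerivAt_const ξ w).prodMk (hasDerivAt_id ξ))
  clear_value D
  let K : Set (ℝ × E2 k) := Set.Icc (-1) 2 ×ˢ B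
  have hK : IsCompact K := isCompact_Icc.prod hB
  -- On `P₀` all `h t` equal `g`, and at `ξ = 0` the derivative of `κ` is `dg (J dg)`, which is
  -- positive in the collar. Compactness extends this to nearby parameters and to small `ξ`,
  -- uniformly.
  obtain ⟨U₁, hU₁, hPU₁, ρ, hρ, hpos⟩ : ∃ U₁, IsOpen U₁ ∧ P₀ ⊆ U₁ ∧ ∃ ρ > 0, ∀ p ∈ U₁, ∀ w ∈ K,
      ∀ ξ ∈ Set.Icc (-ρ) ρ, δ < |g (p, w.2) - b p| ∨ 0 < D (p, (w, ξ)) := by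
    have ho₁ : IsOpen {q : P × ((ℝ × E2 k) × ℝ) | δ < |g (q.1, q.2.1.2) - b q.1|} :=
      isOpen_lt continuous_const (by fun_prop)
    have ho : IsOpen {q : P × ((ℝ × E2 k) × ℝ) | δ < |g (q.1, q.2.1.2) - b q.1| ∨ 0 < D q} :=
      ho₁.union (isOpen_lt continuous_const hDc)
    obtain ⟨u, v, hu, hv, hPu, hKv, huv⟩ := generalized_tube_lemma hP₀
      (hK.prod (isCompact_singleton (x := (0 : ℝ)))) ho (by
        rintro ⟨p, ⟨t, z⟩, ξ⟩ ⟨hp, ⟨-, hz⟩, rfl⟩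
        by_cases hc : δ < |g (p, z) - b p|
        · exact Or.inl hc
        · right
          have h₁ : HasDerivAt (fun ξ : ℝ => g (p, z + ξ • ν (p, z)) - g (p, z))
              (fderiv ℝ (fun z => g (p, z)) z (ν (p, z))) 0 := by
            have h₃ : HasDerivAt (fun ξ : ℝ => z + ξ • ν (p, z)) (ν (p, z)) 0 := by
              simpa using ((hasDerivAt_id (0 : ℝ)).smul_const (ν (p, z))).const_add z
            refine (HasFDerivAt.comp_hasDerivAt (0 : ℝ) (f := fun ξ : ℝ => z + ξ • ν (p, z))
              (l := fun z => g (p, z)) ?_ h₃).sub_const _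
            simpa using (hg 1).hasFDerivAt (q := (p, z)) trivial
          have h₂ : (fun ξ : ℝ => κ (p, ((t, z), ξ))) =
              fun ξ : ℝ => g (p, z + ξ • ν (p, z)) - g (p, z) := by
            funext ξ
            rw [hκh, hheq]
            simp only [f, g, heq p hp]
          have h₃ := (hD p (t, z) 0).unique (h₂ ▸ h₁)
          rw [h₃, hνJ]
          exact hJ _ (hδr p hp z hz (not_lt.1 hc)))
    obtain ⟨u', v', -, hv', hKu', h0v', huv'⟩ := generalized_tube_lemma hK
      (isCompact_singleton (x := (0 : ℝ))) hv hKv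
    obtain ⟨ρ, hρ, hρv⟩ := Metric.nhds_basis_closedBall.mem_iff.1 (hv'.mem_nhds (h0v' rfl))
    refine ⟨u, hu, hPu, ρ, hρ, fun p hp w hw ξ hξ => ?_⟩
    have hξv : ξ ∈ v' := hρv (by rwa [Real.closedBall_eq_Icc, zero_sub, zero_add])
    exact @huv (p, (w, ξ)) ⟨hp, huv' ⟨hKu' hw, hξv⟩⟩
  obtain ⟨U₂, hU₂, hPU₂, hsign⟩ := hP₀.exists_isOpen_forall hK
    (O := {q | δ < |g (q.1, q.2.2) - b q.1| ∨ (κ (q.1, (q.2, -ρ)) < 0 ∧ 0 < κ (q.1, (q.2, ρ)))})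
    (by
      have ho₁ : IsOpen {q : P × (ℝ × E2 k) | δ < |g (q.1, q.2.2) - b q.1|} :=
        isOpen_lt continuous_const (by fun_prop)
      have ho₂ : IsOpen {q : P × (ℝ × E2 k) | κ (q.1, (q.2, -ρ)) < 0} :=
        isOpen_lt (by fun_prop) continuous_const
      have ho₃ : IsOpen {q : P × (ℝ × E2 k) | 0 < κ (q.1, (q.2, ρ))} :=
        isOpen_lt continuous_const (by fun_prop)
      exact ho₁.union (ho₂.inter ho₃)) (by
      intro p hp w hw
      by_cases hc : δ < |g (p, w.2) - b p|
      · exact Or.inl hc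
      · right
        have hm : StrictMonoOn (fun ξ => κ (p, (w, ξ))) (Set.Icc (-ρ) ρ) := by
          refine strictMonoOn_of_deriv_pos (convex_Icc _ _) (by fun_prop) fun ξ hξ => ?_
          rw [(hD p w ξ).deriv]
          exact (hpos p (hPU₁ hp) w hw ξ (interior_subset hξ)).resolve_left hc
        have h0 : κ (p, (w, 0)) = 0 := hκ0 p w.1 w.2 (by simp only [f, g, heq p hp])
        have h₁ := hm (a := -ρ) (b := 0) ⟨le_rfl, by linarith⟩ ⟨by linarith, hρ.le⟩ (by linarith)
        have h₂ := hm (a := 0) (b := ρ) ⟨by linarith, hρ.le⟩ ⟨by linarith, le_rfl⟩ hρ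
        simp only [h0] at h₁ h₂
        exact ⟨h₁, h₂⟩)
  let Ω : Set (P × (ℝ × E2 k)) := {q | q.1 ∈ U₁ ∩ U₂ ∧ q.2.1 ∈ Set.Ioo (-1) 2 ∧
    q.2.2 ∈ Metric.ball (0 : E2 k) r ∧ |g (q.1, q.2.2) - b q.1| < δ}
  have hΩ : IsOpen Ω := by
    have ho₁ : IsOpen {q : P × (ℝ × E2 k) | |g (q.1, q.2.2) - b q.1| < δ} :=
      isOpen_lt (by fun_prop) continuous_const
    have ho₂ : IsOpen {q : P × (ℝ × E2 k) | q.2.1 ∈ Set.Ioo (-1 : ℝ) 2} :=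
      isOpen_Ioo.preimage (by fun_prop)
    have ho₃ : IsOpen {q : P × (ℝ × E2 k) | q.2.2 ∈ Metric.ball (0 : E2 k) r} :=
      Metric.isOpen_ball.preimage (by fun_prop)
    exact ((hU₁.inter hU₂).preimage continuous_fst).inter (ho₂.inter (ho₃.inter ho₁))
  have hΩK : ∀ q ∈ Ω, q.2 ∈ K := fun q hq =>
    ⟨Set.Ioo_subset_Icc_self hq.2.1, Metric.ball_subset_closedBall hq.2.2.1⟩
  obtain ⟨τ, hτ, hτr⟩ := exists_paramContDiffOn_root hκ hΩ (r := ρ)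
    (fun q hq ξ hξ => hDκ (q.1, (q.2, ξ)) ▸
      (hpos q.1 hq.1.1 q.2 (hΩK q hq) ξ hξ).resolve_left (not_lt.2 hq.2.2.2.le))
    (fun q hq => ((hsign q.1 hq.1.2 q.2 (hΩK q hq)).resolve_left (not_lt.2 hq.2.2.2.le)).1)
    (fun q hq => ((hsign q.1 hq.1.2 q.2 (hΩK q hq)).resolve_left (not_lt.2 hq.2.2.2.le)).2) hρ
  have hτ0 : ∀ q ∈ Ω, h q = g (q.1, q.2.2) → τ q = 0 := by
    intro q hq h0
    refine ((hτr q hq).2.2 0 ⟨by linarith, hρ.le⟩ ?_).symm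
    rw [hκh, zero_smul, add_zero]
    exact sub_eq_zero.2 h0
  -- The cutoff is `1` on half of the collar, where the equation for `χ` has to hold exactly, and
  -- `0` from `3/4` of it on, so that `Ω` and the region without motion overlap.
  let ϑ : ContDiffBump (0 : ℝ) := ⟨δ / 2, 3 / 4 * δ, by positivity, by linarith⟩
  let χ : P × (ℝ × E2 k) → E2 k := fun q =>
    if q ∈ Ω then q.2.2 + (ϑ (g (q.1, q.2.2) - b q.1) * τ q) • ν (q.1, q.2.2) else q.2.2
  have hχ1 : ∀ q, (q ∈ Ω → h q = g (q.1, q.2.2)) → χ q = q.2.2 := by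
    intro q h0
    simp only [χ]
    split_ifs with hq
    · rw [hτ0 q hq (h0 hq), mul_zero, zero_smul, add_zero]
    · rfl
  have hχA : ∀ q, q.2.2 ∉ setA k → χ q = q.2.2 := fun q hq =>
    hχ1 q fun _ => hheq q.1 q.2.1 q.2.2 (hfg q.1 q.2.2 hq)
  have hχP : ∀ q, q.1 ∈ P₀ → χ q = q.2.2 := fun q hq =>
    hχ1 q fun _ => hheq q.1 q.2.1 q.2.2 (by simp only [f, g, heq _ hq])
  have hχ2 : ∀ q, 3 / 4 * δ < |g (q.1, q.2.2) - b q.1| → χ q = q.2.2 := by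
    intro q h0
    simp only [χ]
    split_ifs with hq
    · rw [ϑ.zero_of_le_dist (by rw [Real.dist_eq, sub_zero]; exact h0.le), zero_mul, zero_smul,
        add_zero]
    · rfl
  let Ω₀ : Set (P × (ℝ × E2 k)) := (U₁ ∩ U₂) ×ˢ (Set.Ioo (-1) 2 ×ˢ Set.univ)
  have hΩ₀ : IsOpen Ω₀ := (hU₁.inter hU₂).prod (isOpen_Ioo.prod isOpen_univ)
  have hχ : ∀ n, ParamContDiffOn n χ Ω₀ := by
    intro n
    let Ω' : Set (P × (ℝ × E2 k)) :=
      {q | 3 / 4 * δ < |g (q.1, q.2.2) - b q.1|} ∪ {q | q.2.2 ∈ (setA k)ᶜ}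
    have ho₁ : IsOpen {q : P × (ℝ × E2 k) | 3 / 4 * δ < |g (q.1, q.2.2) - b q.1|} :=
      isOpen_lt continuous_const (by fun_prop)
    have ho₂ : IsOpen {q : P × (ℝ × E2 k) | q.2.2 ∈ (setA k)ᶜ} :=
      (isCompact_setA k).isClosed.isOpen_compl.preimage (by fun_prop)
    have hΩ' : IsOpen Ω' := ho₁.union ho₂
    have h₁ : ParamContDiffOn n χ Ω' := by
      refine (ParamContDiffOn.of_contDiff (contDiff_snd (E := ℝ) (F := E2 k))).congr hΩ' ?_
      rintro q (hq | hq)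
      · exact hχ2 q hq
      · exact hχA q hq
    have h₂ : ParamContDiffOn n χ Ω := by
      have hz : ParamContDiffOn n (fun q : P × (ℝ × E2 k) => q.2.2) Ω :=
        ParamContDiffOn.of_contDiff contDiff_snd
      have hg' := (hg n).comp hΩ hz fun _ _ => trivial
      have hν' := (hν n).comp hΩ hz fun _ _ => trivial
      refine (hz.add hΩ ((((hg'.sub hΩ (ParamContDiffOn.of_continuous_fst hb)).contDiff_comp hΩ
        ϑ.contDiff).mul hΩ (hτ n)).smul hΩ hν')).congr hΩ fun q hq => ?_
      simp only [χ, if_pos hq]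
    refine (h₂.union hΩ hΩ' h₁).mono fun q hq => ?_
    by_cases hc : 3 / 4 * δ < |g (q.1, q.2.2) - b q.1|
    · exact Or.inr (Or.inl hc)
    by_cases hA : q.2.2 ∈ setA k
    · exact Or.inl ⟨hq.1, hq.2.1, hr hA, by linarith⟩
    · exact Or.inr (Or.inr hA)
  let K' : Set (ℝ × E2 k) := Set.Icc (-1 / 2) (3 / 2) ×ˢ B
  have hK' : IsCompact K' := isCompact_Icc.prod hB
  have hK'Ω : ∀ p ∈ P₀, ∀ w ∈ K', (p, w) ∈ Ω₀ := fun p hp w hw =>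
    ⟨⟨hPU₁ hp, hPU₂ hp⟩, ⟨by linarith [hw.1.1], by linarith [hw.1.2]⟩, trivial⟩
  have hid : ∀ p, ∀ t ∈ Set.Ioo (-1 : ℝ) 2, ∀ z, (∀ᶠ z' in nhds z, ∀ t, χ (p, (t, z')) = z') →
      (fderiv ℝ (fun y => χ (p, y)) (t, z)).comp (ContinuousLinearMap.inr ℝ ℝ (E2 k)) =
        ContinuousLinearMap.id ℝ (E2 k) := by
    intro p t _ z hz
    have h₁ : (fun y => χ (p, y)) =ᶠ[nhds (t, z)] fun y => y.2 := by
      filter_upwards [continuous_snd.continuousAt.eventually hz] with y hy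
      exact hy y.1
    rw [h₁.fderiv_eq, fderiv_snd]
    exact ContinuousLinearMap.snd_comp_inr
  -- On `P₀` nothing moves, so near `P₀` the spatial derivative is close to the identity over the
  -- compact set `K'`; outside the ball it equals the identity.
  obtain ⟨U₃, hU₃, hPU₃, hsmall⟩ := hP₀.exists_isOpen_forall hK'
    (O := Ω₀ ∩ (fun q => ‖(fderiv ℝ (fun y => χ (q.1, y)) q.2).comp
      (ContinuousLinearMap.inr ℝ ℝ (E2 k)) - ContinuousLinearMap.id ℝ (E2 k)‖) ⁻¹' Set.Iio (1 / 2))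
    (by
      refine ContinuousOn.isOpen_inter_preimage ?_ hΩ₀ isOpen_Iio
      exact ((((hχ 1).2.2.continuousOn).clm_comp continuousOn_const).sub continuousOn_const).norm)
    (by
      intro p hp w hw
      refine ⟨hK'Ω p hp w hw, ?_⟩
      simp only [Set.mem_preimage]
      rw [hid p w.1 (hK'Ω p hp w hw).2.1 w.2 (Filter.Eventually.of_forall fun z t => hχP _ hp)]
      simp)
  -- Where the cutoff is not `1`, the value of `h t` at `χ` is only close to that of `g`. The bound
  -- `δ / 2` is the `ε` of the conclusion, so no value can reach the level.
  obtain ⟨U₄, hU₄, hPU₄, hclose⟩ := hP₀.exists_isOpen_forall hK'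
    (O := Ω₀ ∩ (fun q => |h (q.1, (q.2.1, χ q)) - g (q.1, q.2.2)|) ⁻¹' Set.Iio (δ / 2))
    (by
      refine ContinuousOn.isOpen_inter_preimage ?_ hΩ₀ isOpen_Iio
      refine ContinuousOn.abs (ContinuousOn.sub (hhc.comp_continuousOn ?_) (by fun_prop))
      exact continuousOn_fst.prodMk (ContinuousOn.prodMk (by fun_prop) (hχ 0).continuousOn))
    (by
      intro p hp w hw
      refine ⟨hK'Ω p hp w hw, ?_⟩
      simp only [Set.mem_preimage]
      rw [hχP _ hp, hheq p w.1 w.2 (by simp only [f, g, heq p hp])]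
      simpa using hδ)
  have hUΩ : ((U₁ ∩ U₂) ∩ (U₃ ∩ U₄)) ×ˢ (Set.Ioo (-1 / 2 : ℝ) (3 / 2) ×ˢ (Set.univ : Set (E2 k)))
      ⊆ Ω₀ := by
    rintro q ⟨hp, ht, -⟩
    exact ⟨hp.1, ⟨by linarith [ht.1], by linarith [ht.2]⟩, trivial⟩
  have hχU := fun n => (hχ n).mono hUΩ
  obtain ⟨χ', hχ', hinv⟩ := exists_paramContDiffOn_inverse ((hU₁.inter hU₂).inter (hU₃.inter hU₄))
    isOpen_Ioo hχU (by
      intro p hp t ht z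
      by_cases hz : z ∈ B
      · exact le_of_lt (hsmall p hp.2.1 (t, z) ⟨Set.Ioo_subset_Icc_self ht, hz⟩).2
      · rw [hid p t ⟨by linarith [ht.1], by linarith [ht.2]⟩ z ?_]
        · simp
        · filter_upwards [Metric.isClosed_closedBall.isOpen_compl.mem_nhds hz] with z' hz' t'
          exact hχA (p, (t', z')) (hAB z' fun h => hz' (Metric.ball_subset_closedBall h)))
  refine ⟨_, (hU₁.inter hU₂).inter (hU₃.inter hU₄),
    fun p hp => ⟨⟨hPU₁ hp, hPU₂ hp⟩, hPU₃ hp, hPU₄ hp⟩, δ / 2, by positivity, χ, χ', hχU, hχ',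
    fun p hp t ht => ⟨(hinv p hp t ht).1, (hinv p hp t ht).2, fun z hz => hχA _ hz, ?_, ?_, ?_, ?_⟩⟩
  · rintro rfl z
    exact hχ1 _ fun _ => hh0 p z
  · intro z hz
    by_cases hzr : z ∈ Metric.ball (0 : E2 k) r
    · have hq : (p, (t, z)) ∈ Ω := ⟨hp.1, ⟨by linarith [ht.1], by linarith [ht.2]⟩, hzr,
        hz.trans (half_lt_self hδ)⟩
      have h₁ : χ (p, (t, z)) = z + τ (p, (t, z)) • ν (p, z) := by
        simp only [χ, if_pos hq]
        rw [ϑ.one_of_mem_closedBall, one_mul]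
        rw [mem_closedBall_zero_iff, Real.norm_eq_abs]
        exact hz.le
      have h₂ := (hτr _ hq).2.1
      simp only at h₂
      rw [hκh, hht, sub_eq_zero] at h₂
      rw [h₁]
      exact h₂
    · have hzA := hAB z hzr
      rw [hχA (p, (t, z)) hzA]
      exact (hht p t z).symm.trans (hheq p t z (hfg p z hzA))
  · intro z _
    by_cases hzB : z ∈ B
    · have h₁ := (hclose p hp.2.2 (t, z) ⟨Set.Ioo_subset_Icc_self ht, hzB⟩).2
      simp only [Set.mem_preimage, Set.mem_Iio, hht] at h₁
      exact h₁
    · have hzA := hAB z fun h => hzB (Metric.ball_subset_closedBall h)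
      rw [hχA (p, (t, z)) hzA]
      have h₁ : (1 - t) * (G p).toFun z + t * (F p).toFun z = (G p).toFun z :=
        (hht p t z).symm.trans (hheq p t z (hfg p z hzA))
      rw [h₁, sub_self, abs_zero]
      positivity
  · intro h0 z
    refine hχ1 _ fun hq => hheq p t z (h0 z (hq.2.2.2.trans_le hδδ₀))

end LevelIsotopy

/-! ### Lifting paths of functions with a regular level to diffeomorphisms -/

section LevelLift

variable {k : ℕ}

/-- A Lebesgue number: on the compact complement of `U` the distance `|s - t|` has a positive lower
bound. It cuts paths into steps short enough for `exists_levelIsotopy`. -/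
theorem exists_nat_forall_near_diagonal {X : Type*} [TopologicalSpace X] [CompactSpace X]
    {U : Set (X × I × I)} (hU : IsOpen U) (hd : ∀ x t, (x, t, t) ∈ U) :
    ∃ N : ℕ, 0 < N ∧ ∀ x (s t : I), |(s : ℝ) - t| ≤ 1 / N → (x, s, t) ∈ U := by
  obtain ⟨a, ha, hle⟩ := hU.isClosed_compl.isCompact.exists_forall_le'
    (f := fun q : X × I × I => |(q.2.1 : ℝ) - q.2.2|) (a := 0) (by fun_prop) (by
      rintro ⟨x, s, t⟩ hq
      refine abs_pos.2 (sub_ne_zero.2 fun h => hq ?_)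
      obtain rfl : s = t := Subtype.ext h
      exact hd x s)
  obtain ⟨n, hn⟩ := exists_nat_one_div_lt ha
  refine ⟨n + 1, n.succ_pos, fun x s t h => ?_⟩
  by_contra hc
  have := hle (x, s, t) hc
  push_cast at h
  simp only at this
  linarith

theorem IsotopicFixingOutside.trans {E : Type*} [NormedAddCommGroup E] [NormedSpace ℝ E]
    {A S T R : Set E} (h₁ : IsotopicFixingOutside A S T) (h₂ : IsotopicFixingOutside A T R) :
    IsotopicFixingOutside A S R := by
  obtain ⟨Φ, hΦ, hΦ', hΦ0, hΦA, rfl⟩ := h₁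
  obtain ⟨Ψ, hΨ, hΨ', hΨ0, hΨA, rfl⟩ := h₂
  refine ⟨fun t => (Φ t).trans (Ψ t), ?_, ?_, fun z => ?_, fun t ht z hz => ?_, ?_⟩
  · exact hΨ.comp (contDiff_fst.contDiffOn.prodMk hΦ) fun q hq => ⟨hq.1, trivial⟩
  · exact hΦ'.comp (contDiff_fst.contDiffOn.prodMk hΨ') fun q hq => ⟨hq.1, trivial⟩
  · simp [hΦ0, hΨ0]
  · simp [hΦA t ht z hz, hΨA t ht z hz]
  · rw [Equiv.coe_trans, Set.image_comp]

theorem IsotopicFixingOutside.refl {E : Type*} [NormedAddCommGroup E] [NormedSpace ℝ E]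
    (A S : Set E) : IsotopicFixingOutside A S S :=
  ⟨fun _ => Equiv.refl _, contDiff_snd.contDiffOn, contDiff_snd.contDiffOn, fun _ => rfl,
    fun _ _ _ _ => rfl, Set.image_id _⟩

/-- For the values before and after an isotopy: near the level they coincide, and farther away the
error is less than the distance to the level, so the level is not crossed. -/
theorem lt_iff_lt_of_abs_sub_lt {x y b ε : ℝ} (h₁ : |x - b| < ε → y = x)
    (h₂ : ε ≤ |x - b| → |y - x| < ε) : (y < b ↔ x < b) ∧ (b < y ↔ b < x) := by
  rcases lt_or_ge |x - b| ε with h | h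
  · rw [h₁ h]
    exact ⟨Iff.rfl, Iff.rfl⟩
  · have h₃ := h₂ h
    rw [abs_lt] at h₃
    rcases le_abs.1 h with h | h
    · exact ⟨⟨fun _ => by linarith, fun _ => by linarith⟩, fun _ => by linarith, fun _ => by linarith⟩
    · exact ⟨⟨fun _ => by linarith, fun _ => by linarith⟩, fun _ => by linarith, fun _ => by linarith⟩

/-- The level sets at a common regular level of a continuous path in `C^∞_k` are isotopic. -/
theorem isotopicFixingOutside_of_path {f : I → CInf k} (hf : Continuous f) {b : ℝ}
    (hreg : ∀ t, IsRegularValue (f t).toFun b) :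
    IsotopicFixingOutside (setA k) ((f 0).toFun ⁻¹' {b}) ((f 1).toFun ⁻¹' {b}) := by
  -- The parameters are pairs of times `(s, t)`. The two functions agree on the compact diagonal, so
  -- the isotopies exist for all pairs of sufficiently close times. The factor `Unit` only matches
  -- the form of `exists_nat_forall_near_diagonal`.
  obtain ⟨U, hU, hdU, ε, -, χ, χ', hχ, hχ', h⟩ := exists_levelIsotopy
    (P := Unit × I × I) (P₀ := Set.range fun t : I => ((), t, t)) (isCompact_range (by fun_prop))
    (F := fun p => f p.2.2) (G := fun p => f p.2.1) (b := fun _ => b) (by fun_prop) (by fun_prop)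
    continuous_const (by rintro _ ⟨t, rfl⟩; rfl) (by rintro _ ⟨t, rfl⟩; exact hreg t)
    (δ₀ := 1) one_pos
  obtain ⟨N, hN, hNU⟩ := exists_nat_forall_near_diagonal hU fun _ t => hdU ⟨t, rfl⟩
  have hstep : ∀ s t : I, |(s : ℝ) - t| ≤ 1 / N →
      IsotopicFixingOutside (setA k) ((f s).toFun ⁻¹' {b}) ((f t).toFun ⁻¹' {b}) := by
    intro s t hst
    classical
    have hp := hNU () s t hst
    have hJ : ∀ t ∈ Set.Icc (0 : ℝ) 1, t ∈ Set.Ioo (-1 / 2 : ℝ) (3 / 2) := fun t ht =>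
      ⟨by linarith [ht.1], by linarith [ht.2]⟩
    have hsub : Set.Icc (0 : ℝ) 1 ×ˢ (Set.univ : Set (E2 k)) ⊆
        {w | (((), s, t), w) ∈ U ×ˢ (Set.Ioo (-1 / 2 : ℝ) (3 / 2) ×ˢ Set.univ)} :=
      fun w hw => ⟨hp, hJ _ hw.1, trivial⟩
    have hopen := hU.prod ((isOpen_Ioo (a := (-1 / 2 : ℝ)) (b := 3 / 2)).prod
      (isOpen_univ (X := E2 k)))
    -- Outside the interval the identity is a default value; only times in `[0, 1]` matter.
    let Φ : ℝ → E2 k ≃ E2 k := fun u =>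
      if hu : u ∈ Set.Ioo (-1 / 2 : ℝ) (3 / 2) then
        ⟨fun z => χ (((), s, t), (u, z)), fun z => χ' (((), s, t), (u, z)),
          (h _ hp u hu).1, (h _ hp u hu).2.1⟩ else Equiv.refl _
    have hΦ : ∀ u ∈ Set.Icc (0 : ℝ) 1, ∀ z, Φ u z = χ (((), s, t), (u, z)) := by
      intro u hu z
      simp only [Φ, dif_pos (hJ u hu)]
      rfl
    have hΦ' : ∀ u ∈ Set.Icc (0 : ℝ) 1, ∀ z, (Φ u).symm z = χ' (((), s, t), (u, z)) := by
      intro u hu z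
      simp only [Φ, dif_pos (hJ u hu)]
      rfl
    have h01 : (0 : ℝ) ∈ Set.Icc (0 : ℝ) 1 := ⟨le_rfl, zero_le_one⟩
    have h11 : (1 : ℝ) ∈ Set.Icc (0 : ℝ) 1 := ⟨zero_le_one, le_rfl⟩
    refine ⟨Φ, ?_, ?_, fun z => ?_, fun u hu z hz => ?_, ?_⟩
    · refine ContDiffOn.congr (f := fun w => χ (((), s, t), w)) ?_ fun w hw => hΦ _ hw.1 _
      exact contDiffOn_infty.2 fun n => ((hχ n).contDiffOn_slice hopen _).mono hsub
    · refine ContDiffOn.congr (f := fun w => χ' (((), s, t), w)) ?_ fun w hw => hΦ' _ hw.1 _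
      exact contDiffOn_infty.2 fun n => ((hχ' n).contDiffOn_slice hopen _).mono hsub
    · rw [hΦ 0 h01]
      exact (h _ hp 0 (hJ 0 h01)).2.2.2.1 rfl z
    · rw [hΦ u hu]
      exact (h _ hp u (hJ u hu)).2.2.1 z hz
    · have h₁ := (h _ hp 1 (hJ 1 h11)).2.2.2.2.1
      have h₂ := (h _ hp 1 (hJ 1 h11)).2.2.2.2.2.1
      simp only [sub_self, zero_mul, one_mul, zero_add] at h₁ h₂
      have h₃ : ∀ z, (f t).toFun (Φ 1 z) = b ↔ (f s).toFun z = b := by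
        intro z
        rw [hΦ 1 h11]
        have := lt_iff_lt_of_abs_sub_lt (h₁ z) (h₂ z)
        constructor
        · intro he
          have h₄ := this.1.not.1 (by linarith)
          have h₅ := this.2.not.1 (by linarith)
          linarith
        · intro he
          have h₄ := this.1.not.2 (by linarith)
          have h₅ := this.2.not.2 (by linarith)
          linarith
      ext z
      constructor
      · rintro ⟨y, hy, rfl⟩
        exact (h₃ y).2 hy
      · intro hz
        refine ⟨(Φ 1).symm z, (h₃ _).1 ?_, (Φ 1).apply_symm_apply z⟩
        rwa [(Φ 1).apply_symm_apply]
  have hN' : (0 : ℝ) < N := by exact_mod_cast hN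
  have hind : ∀ n : ℕ, IsotopicFixingOutside (setA k) ((f 0).toFun ⁻¹' {b})
      ((f (Set.projIcc 0 1 zero_le_one (n / N : ℝ))).toFun ⁻¹' {b}) := by
    intro n
    induction n with
    | zero =>
      have : Set.projIcc (0 : ℝ) 1 zero_le_one ((0 : ℕ) / N : ℝ) = 0 := by
        rw [Nat.cast_zero, zero_div, Set.projIcc_left]
        rfl
      rw [this]
      exact IsotopicFixingOutside.refl _ _
    | succ n ih =>
      refine ih.trans (hstep _ _ ?_)
      have h₁ := Set.abs_projIcc_sub_projIcc (zero_le_one (α := ℝ)) (c := (n / N : ℝ))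
        (d := ((n + 1 : ℕ) / N : ℝ))
      refine h₁.trans (le_of_eq ?_)
      rw [← sub_div, abs_div, abs_of_pos hN']
      push_cast
      norm_num
  have := hind N
  rw [div_self hN'.ne', Set.projIcc_right] at this
  exact this

/-- Families of diffeomorphisms `ψ` with inverses `ψ'` that fix everything outside of `A` and pull
functions back to functions that are equal to `Q` near the level `b`. -/
structure IsLevelLift {Y : Type*} [TopologicalSpace Y] (h : Y → CInf k) (b : Y → ℝ) (ε : ℝ)
    (ψ ψ' : Y × E2 k → E2 k) : Prop where
  smooth : ∀ n, ParamContDiffOn n ψ Set.univ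
  smooth' : ∀ n, ParamContDiffOn n ψ' Set.univ
  left_inv : ∀ y z, ψ' (y, ψ (y, z)) = z
  right_inv : ∀ y z, ψ (y, ψ' (y, z)) = z
  eq_self : ∀ y, ∀ z ∉ setA k, ψ (y, z) = z
  eq_Q : ∀ y z, |Q k z - b y| < ε → (h y).toFun (ψ (y, z)) = Q k z
  lt_iff : ∀ y z, (h y).toFun (ψ (y, z)) < b y ↔ Q k z < b y
  gt_iff : ∀ y z, b y < (h y).toFun (ψ (y, z)) ↔ b y < Q k z

/-- Lifting of a family of paths of functions with a regular level to families of
diffeomorphisms. -/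
theorem exists_isLevelLift {X : Type*} [TopologicalSpace X] [CompactSpace X] {f : X × I → CInf k}
    {b : X → ℝ} (hf : Continuous f) (hb : Continuous b) (h1 : ∀ x, f (x, 1) = CInf.ofQ k)
    (hreg : ∀ x t, IsRegularValue (f (x, t)).toFun (b x)) {δ₀ : ℝ} (hδ₀ : 0 < δ₀) :
    ∃ ε > 0, ∃ ψ ψ' : (X × I) × E2 k → E2 k, IsLevelLift f (fun y => b y.1) ε ψ ψ' ∧
      (∀ x z, ψ ((x, 1), z) = z) ∧
      ∀ x, (∀ s t z, |(f (x, s)).toFun z - b x| < δ₀ → (f (x, t)).toFun z = (f (x, s)).toFun z) →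
        ∀ t z, ψ ((x, t), z) = z := by
  obtain ⟨U, hU, hdU, ε₀, hε₀, χ, χ', hχ, hχ', h⟩ := exists_levelIsotopy
    (P := X × I × I) (P₀ := Set.range fun q : X × I => (q.1, q.2, q.2))
    (isCompact_range (by fun_prop))
    (F := fun p => f (p.1, p.2.2)) (G := fun p => f (p.1, p.2.1)) (b := fun p => b p.1)
    (by fun_prop) (by fun_prop) (by fun_prop) (by rintro _ ⟨q, rfl⟩; rfl)
    (by rintro _ ⟨q, rfl⟩; exact hreg q.1 q.2) hδ₀
  obtain ⟨N, hN, hNU⟩ := exists_nat_forall_near_diagonal hU fun x t => hdU ⟨(x, t), rfl⟩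
  have hN' : (0 : ℝ) < N := by exact_mod_cast hN
  -- The times `u j t` descend from `1`, where the function is `Q`, to `t` in steps of length at
  -- most `1 / N`. They stop at `t`, and so depend continuously on it.
  let u : ℕ → I → I := fun j t => Set.projIcc 0 1 zero_le_one (max (t : ℝ) (1 - j / N))
  have hu : ∀ j, Continuous (u j) := fun j => continuous_projIcc.comp (by fun_prop)
  have hu0 : ∀ t, u 0 t = 1 := by
    intro t
    simp only [u, Nat.cast_zero, zero_div, sub_zero]
    rw [Set.projIcc_of_right_le _ (le_max_right _ _)]
    rfl
  have hu1 : ∀ j, u j 1 = 1 := by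
    intro j
    simp only [u]
    rw [Set.projIcc_of_right_le _ (le_max_of_le_left (by simp))]
    rfl
  have huN : ∀ t, u N t = t := by
    intro t
    simp only [u, div_self hN'.ne', sub_self]
    rw [max_eq_left t.2.1, Set.projIcc_val]
  have hdist : ∀ j t, |(u j t : ℝ) - u (j + 1) t| ≤ 1 / N := by
    intro j t
    refine (Set.abs_projIcc_sub_projIcc (zero_le_one (α := ℝ))).trans
      ((abs_max_sub_max_le_max _ _ _ _).trans (le_of_eq ?_))
    rw [sub_self, abs_zero, sub_sub_sub_cancel_left, ← sub_div, abs_div, abs_of_pos hN']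
    push_cast
    rw [add_sub_cancel_left, abs_one, max_eq_right (by positivity)]
  have key : ∀ j, ∃ ε > 0, ∃ ψ ψ' : (X × I) × E2 k → E2 k,
      IsLevelLift (fun y => f (y.1, u j y.2)) (fun y => b y.1) ε ψ ψ' ∧
      (∀ x z, ψ ((x, 1), z) = z) ∧
      ∀ x, (∀ s t z, |(f (x, s)).toFun z - b x| < δ₀ → (f (x, t)).toFun z = (f (x, s)).toFun z) →
        ∀ t z, ψ ((x, t), z) = z := by
    intro j
    induction j with
    | zero =>
      refine ⟨1, one_pos, fun q => q.2, fun q => q.2, ⟨fun n => ParamContDiffOn.snd,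
        fun n => ParamContDiffOn.snd, fun _ _ => rfl, fun _ _ => rfl, fun _ _ _ => rfl, ?_, ?_, ?_⟩,
        fun _ _ => rfl, fun _ _ _ _ => rfl⟩
      · intro y z _
        simp only [hu0, h1]
        rfl
      · intro y z
        simp only [hu0, h1]
        rfl
      · intro y z
        simp only [hu0, h1]
        rfl
    | succ j ih =>
      obtain ⟨ε, hε, ψ, ψ', hψ, hψ1, hψr⟩ := ih
      let φ : X × I → X × I × I := fun y => (y.1, u j y.2, u (j + 1) y.2)
      have hφ : Continuous φ := continuous_fst.prodMk
        (((hu j).comp continuous_snd).prodMk ((hu (j + 1)).comp continuous_snd))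
      have hφU : ∀ y, φ y ∈ U := fun y => hNU _ _ _ (hdist j y.2)
      have h1J : (1 : ℝ) ∈ Set.Ioo (-1 / 2 : ℝ) (3 / 2) := by norm_num
      have hh := fun y => h (φ y) (hφU y) 1 h1J
      simp only [sub_self, zero_mul, one_mul, zero_add] at hh
      have hc : ∀ (χ : (X × I × I) × (ℝ × E2 k) → E2 k) (ψ : (X × I) × E2 k → E2 k),
          (∀ n, ParamContDiffOn n χ (U ×ˢ (Set.Ioo (-1 / 2) (3 / 2) ×ˢ Set.univ))) →
          (∀ n, ParamContDiffOn n ψ Set.univ) →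
          ∀ n, ParamContDiffOn n (fun q : (X × I) × E2 k => χ (φ q.1, (1, ψ q))) Set.univ := by
        intro χ ψ hχ hψ n
        exact ParamContDiffOn.comp isOpen_univ ((hχ n).comp_fst hφ)
          ((ParamContDiffOn.const (1 : ℝ)).prodMk isOpen_univ (hψ n))
          fun q _ => ⟨hφU q.1, h1J, trivial⟩
      have hlast : ∀ y, (∀ z, |(f (y.1, u j y.2)).toFun z - b y.1| < δ₀ →
          (f (y.1, u (j + 1) y.2)).toFun z = (f (y.1, u j y.2)).toFun z) →
          ∀ z, χ (φ y, (1, z)) = z := fun y => (hh y).2.2.2.2.2.2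
      -- The new diffeomorphism is the old one followed by the end of the isotopy from time `u j t`
      -- to time `u (j + 1) t`; near the level both preserve the value `Q z`.
      refine ⟨min ε ε₀, lt_min hε hε₀, fun q => χ (φ q.1, (1, ψ q)),
        fun q => ψ' (q.1, χ' (φ q.1, (1, q.2))), ⟨hc χ ψ hχ hψ.smooth, fun n => ?_,
        fun y z => ?_, fun y z => ?_, fun y z hz => ?_, fun y z hz => ?_, fun y z => ?_,
        fun y z => ?_⟩, fun x z => ?_, fun x hx t z => ?_⟩
      · exact ParamContDiffOn.comp isOpen_univ (hψ.smooth' n)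
          (hc χ' (fun q => q.2) hχ' (fun n => ParamContDiffOn.snd) n) fun _ _ => trivial
      · simp only [(hh y).1, hψ.left_inv]
      · simp only [hψ.right_inv, (hh y).2.1]
      · simp only [hψ.eq_self y z hz]
        exact (hh y).2.2.1 z hz
      · have h₁ := hψ.eq_Q y z (hz.trans_le (min_le_left _ _))
        have h₂ := (hh y).2.2.2.2.1 (ψ (y, z))
        rw [show (f ((φ y).1, (φ y).2.1)).toFun (ψ (y, z)) = Q k z from h₁] at h₂
        exact h₂ (hz.trans_le (min_le_right _ _))
      · exact (lt_iff_lt_of_abs_sub_lt ((hh y).2.2.2.2.1 (ψ (y, z)))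
          ((hh y).2.2.2.2.2.1 (ψ (y, z)))).1.trans (hψ.lt_iff y z)
      · exact (lt_iff_lt_of_abs_sub_lt ((hh y).2.2.2.2.1 (ψ (y, z)))
          ((hh y).2.2.2.2.2.1 (ψ (y, z)))).2.trans (hψ.gt_iff y z)
      · simp only [hψ1]
        refine hlast (x, 1) (fun z _ => ?_) z
        simp only [hu1]
      · simp only [hψr x hx]
        exact hlast (x, t) (fun z => hx _ _ z) z
  obtain ⟨ε, hε, ψ, ψ', hψ, h⟩ := key N
  refine ⟨ε, hε, ψ, ψ', ?_, h⟩
  have : (fun y : X × I => f (y.1, u N y.2)) = f := by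
    funext y
    rw [huN]
  rwa [this] at hψ

end LevelLift

/-! ### Critical points and Hessians under changes of coordinates -/

section CriticalPoints

variable {E : Type} [NormedAddCommGroup E] [NormedSpace ℝ E]

theorem isCritical_congr {f g : E → ℝ} {z : E} (h : f =ᶠ[nhds z] g) :
    IsCritical f z ↔ IsCritical g z := by
  rw [IsCritical, IsCritical, h.fderiv_eq]

theorem hessianNondegenerate_congr {f g : E → ℝ} {z : E} (h : f =ᶠ[nhds z] g) :
    HessianNondegenerate f z ↔ HessianNondegenerate g z := by
  rw [HessianNondegenerate, HessianNondegenerate, h.fderiv.fderiv_eq]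

theorem isCritical_const_mul_iff {f : E → ℝ} {a : ℝ} (ha : a ≠ 0) {z : E} :
    IsCritical (fun z => a * f z) z ↔ IsCritical f z := by
  have : (fun z => a * f z) = a • f := rfl
  rw [IsCritical, IsCritical, this, fderiv_const_smul_field, Pi.smul_apply,
    smul_eq_zero_iff_right ha]

theorem hessianNondegenerate_const_mul_iff {f : E → ℝ} {a : ℝ} (ha : a ≠ 0) {z : E} :
    HessianNondegenerate (fun z => a * f z) z ↔ HessianNondegenerate f z := by
  have h₁ : fderiv ℝ (fun z => a * f z) = a • fderiv ℝ f :=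
    fderiv_const_smul_field (f := f) a
  have h₂ : fderiv ℝ (a • fderiv ℝ f) = a • fderiv ℝ (fderiv ℝ f) :=
    fderiv_const_smul_field (f := fderiv ℝ f) a
  rw [HessianNondegenerate, HessianNondegenerate, h₁, h₂]
  simp [ha]

theorem isCritical_comp_iff {f : E → ℝ} {φ : E → E} {z : E} (hf : DifferentiableAt ℝ f (φ z))
    (hφ : DifferentiableAt ℝ φ z) (hi : (fderiv ℝ φ z).IsInvertible) :
    IsCritical (fun z => f (φ z)) z ↔ IsCritical f (φ z) := by
  obtain ⟨e, he⟩ := hi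
  have h₁ : fderiv ℝ (fun z => f (φ z)) z = (fderiv ℝ f (φ z)).comp (fderiv ℝ φ z) :=
    fderiv_comp z hf hφ
  rw [IsCritical, IsCritical, h₁, ← he]
  constructor
  · intro h
    ext v
    simpa using congrArg (fun L : E →L[ℝ] ℝ => L (e.symm v)) h
  · intro h
    rw [h, ContinuousLinearMap.zero_comp]

/-- In the second derivative of `f ∘ φ`, the term with the second derivative of `φ` is multiplied by
`df`, which vanishes at a critical point. So the Hessian changes by the invertible `dφ` only. -/
theorem hessianNondegenerate_comp {f : E → ℝ} {φ : E → E} {z : E} (hf : ContDiff ℝ ∞ f)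
    (hφ : ContDiff ℝ ∞ φ) (hi : (fderiv ℝ φ z).IsInvertible) (hc : IsCritical f (φ z))
    (hn : HessianNondegenerate f (φ z)) : HessianNondegenerate (fun z => f (φ z)) z := by
  obtain ⟨e, he⟩ := hi
  have hf' : Differentiable ℝ f := hf.differentiable (by simp)
  have hφ' : Differentiable ℝ φ := hφ.differentiable (by simp)
  have h₁ : fderiv ℝ (fun z => f (φ z)) = fun z => (fderiv ℝ f (φ z)).comp (fderiv ℝ φ z) := by
    funext w
    exact fderiv_comp w (hf' _) (hφ' _)
  have hdf : DifferentiableAt ℝ (fderiv ℝ f) (φ z) :=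
    ((hf.fderiv_right (m := ∞) (by simp)).differentiable (by simp)) _
  have hdφ : DifferentiableAt ℝ (fderiv ℝ φ) z :=
    ((hφ.fderiv_right (m := ∞) (by simp)).differentiable (by simp)) _
  have h₂ : HasFDerivAt (fun z => fderiv ℝ f (φ z))
      ((fderiv ℝ (fderiv ℝ f) (φ z)).comp (fderiv ℝ φ z)) z :=
    hdf.hasFDerivAt.comp z (hφ' z).hasFDerivAt
  have h₃ := (h₂.clm_comp hdφ.hasFDerivAt).fderiv
  intro v hv
  have h₄ : ∀ w, fderiv ℝ (fderiv ℝ f) (φ z) (e v) w = 0 := by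
    intro w
    have h₅ := hv (e.symm w)
    rw [h₁, h₃, ← he] at h₅
    rw [IsCritical] at hc
    simpa [hc] using h₅
  simpa using hn _ h₄

theorem isInvertible_fderiv_of_inverse [FiniteDimensional ℝ E] {φ φ' : E → E}
    (hφ : Differentiable ℝ φ) (hφ' : Differentiable ℝ φ') (h : ∀ z, φ' (φ z) = z) (z : E) :
    (fderiv ℝ φ z).IsInvertible := by
  refine ContinuousLinearMap.isInvertible_of_injective fun v hv => ?_
  have h₁ : fderiv ℝ (fun z => φ' (φ z)) z = (fderiv ℝ φ' (φ z)).comp (fderiv ℝ φ z) :=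
    fderiv_comp z (hφ' _) (hφ z)
  have h₂ : (fun z => φ' (φ z)) = id := funext h
  rw [h₂, fderiv_id] at h₁
  have h₃ := congrArg (fun L : E →L[ℝ] E => L v) h₁
  simpa [hv] using h₃

end CriticalPoints

/-! ### Shrinking, convex interpolation, and membership in the three spaces -/

noncomputable section ModelFunctions

variable {k : ℕ}

theorem Q_smul (c : ℝ) (z : E2 k) : Q k (c • z) = c ^ 2 * Q k z := by
  simp only [Q, Prod.smul_fst, Prod.smul_snd, norm_smul, mul_pow, Real.norm_eq_abs, sq_abs]
  ring

/-- `A` is star-shaped about the origin: scaling by `c ≤ 1` multiplies both `Q` and `‖x‖ ‖y‖` by `c²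
≤ 1`. -/
theorem inv_smul_notMem_setA {c : ℝ} (hc : c ∈ Set.Ioc (0 : ℝ) 1) {z : E2 k} (hz : z ∉ setA k) :
    c⁻¹ • z ∉ setA k := by
  intro h
  apply hz
  have hz' : z = c • (c⁻¹ • z) := by rw [smul_inv_smul₀ hc.1.ne']
  rw [hz']
  generalize c⁻¹ • z = w at h
  obtain ⟨⟨h₁, h₂⟩, h₃⟩ := h
  have hc2 : c ^ 2 ≤ 1 := pow_le_one₀ hc.1.le hc.2
  have hc2' : 0 < c ^ 2 := by have := hc.1; positivity
  refine ⟨⟨?_, ?_⟩, ?_⟩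
  · rw [Q_smul]
    nlinarith
  · rw [Q_smul]
    nlinarith
  · rw [Prod.smul_fst, Prod.smul_snd, norm_smul, norm_smul, Real.norm_of_nonneg hc.1.le]
    have h₄ : 0 ≤ ‖w.1‖ * ‖w.2‖ := by positivity
    calc c * ‖w.1‖ * (c * ‖w.2‖) = c ^ 2 * (‖w.1‖ * ‖w.2‖) := by ring
      _ ≤ 1 * (‖w.1‖ * ‖w.2‖) := by gcongr
      _ ≤ √2 := by rwa [one_mul]

theorem CInf.continuous_toFun (f : CInf k) : Continuous f.toFun := f.smooth.continuous

theorem CInf.differentiable (f : CInf k) : Differentiable ℝ f.toFun :=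
  f.smooth.differentiable (by simp)

theorem CInf.eq_Q_of_mem_closure (f : CInf k) {z : E2 k} (hz : z ∈ closure (setA k)ᶜ) :
    f.toFun z = Q k z := by
  have hc : IsClosed {z | f.toFun z = Q k z} :=
    isClosed_eq f.continuous_toFun (contDiff_Q k).continuous
  exact hc.closure_subset_iff.2 (fun z hz => f.eq_Q z hz) hz

/-- Points with `Q = 1` may lie in `A`, but they are limits of points outside: since `y ≠ 0`,
stretching `y` raises `Q` strictly above `1`. -/
theorem CInf.eq_Q_of_one_le (f : CInf k) {z : E2 k} (hz : 1 ≤ Q k z) : f.toFun z = Q k z := by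
  refine f.eq_Q_of_mem_closure ?_
  have h₁ : Filter.Tendsto (fun s : ℝ => ((z.1, (1 + s) • z.2) : E2 k)) (nhdsWithin 0 (Set.Ioi 0))
      (nhds z) := by
    have hc : Continuous fun s : ℝ => ((z.1, (1 + s) • z.2) : E2 k) := by fun_prop
    have := hc.tendsto 0
    simp only [add_zero, one_smul] at this
    exact this.mono_left nhdsWithin_le_nhds
  refine mem_closure_of_tendsto h₁ ?_
  filter_upwards [self_mem_nhdsWithin] with s hs
  rintro ⟨⟨-, h₂⟩, -⟩
  have hs' : (0 : ℝ) < s := hs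
  simp only [Q, norm_smul, mul_pow, Real.norm_eq_abs, sq_abs] at h₂ hz
  have h₃ : 0 < ‖z.2‖ ^ 2 := by nlinarith [sq_nonneg ‖z.1‖]
  have h₄ : (0 : ℝ) < ((1 + s) ^ 2 - 1) * ‖z.2‖ ^ 2 := mul_pos (by nlinarith) h₃
  linarith

/-- If all critical values are at most `1`, then so are the values on `{Q ≤ 1}`. -/
theorem CInf.le_one (f : CInf k) (hf : ∀ w, IsCritical f.toFun w → f.toFun w ≤ 1) {z : E2 k}
    (hz : Q k z ≤ 1) : f.toFun z ≤ 1 := by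
  by_cases hA : z ∈ setA k
  -- A maximum over `A` is either a limit of points outside `A`, where `f = Q ≤ 1`, or an interior
  -- point of `A`, hence critical.
  · obtain ⟨w, hw, hmax⟩ := (isCompact_setA k).exists_isMaxOn ⟨z, hA⟩
      f.continuous_toFun.continuousOn
    refine (hmax hA).trans ?_
    by_cases hcl : w ∈ closure (setA k)ᶜ
    · rw [f.eq_Q_of_mem_closure hcl]
      exact hw.1.2
    · rw [closure_compl, Set.notMem_compl_iff] at hcl
      exact hf w ((hmax.isLocalMax (mem_interior_iff_mem_nhds.1 hcl)).fderiv_eq_zero)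
  · rwa [f.eq_Q z hA]

/-- The functions `f ∈ C^∞_k` that are equal to `Q` near `Q⁻¹(b)` and for which the points on the
two sides of the level `b` are the same as for `Q`. -/
structure AgreesAtLevel (f : E2 k → ℝ) (b : ℝ) : Prop where
  eventuallyEq : ∀ z, Q k z = b → f =ᶠ[nhds z] Q k
  lt_iff : ∀ z, f z < b ↔ Q k z < b
  gt_iff : ∀ z, b < f z ↔ b < Q k z

theorem AgreesAtLevel.of_eps {f : E2 k → ℝ} {b ε : ℝ} (hε : 0 < ε)
    (h : ∀ z, |Q k z - b| < ε → f z = Q k z) (h₁ : ∀ z, f z < b ↔ Q k z < b)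
    (h₂ : ∀ z, b < f z ↔ b < Q k z) : AgreesAtLevel f b := by
  refine ⟨fun z hz => ?_, h₁, h₂⟩
  have ho : IsOpen {z : E2 k | |Q k z - b| < ε} :=
    isOpen_lt (by have := (contDiff_Q k).continuous; fun_prop) continuous_const
  filter_upwards [ho.mem_nhds (show |Q k z - b| < ε by simpa [hz] using hε)] with w hw
  exact h w hw

theorem AgreesAtLevel.eq_iff {f : E2 k → ℝ} {b : ℝ} (h : AgreesAtLevel f b) (z : E2 k) :
    f z = b ↔ Q k z = b := by
  have h₁ := h.lt_iff z
  have h₂ := h.gt_iff z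
  constructor
  · intro he
    exact le_antisymm (not_lt.1 fun hc => (h₂.2 hc).ne' he) (not_lt.1 fun hc => (h₁.2 hc).ne he)
  · intro he
    exact le_antisymm (not_lt.1 fun hc => (h₂.1 hc).ne' he) (not_lt.1 fun hc => (h₁.1 hc).ne he)

/-- At each point both functions lie on the same side of `b` as `Q`, hence so does a convex
combination. This convexity makes straight-line deformations stay in `H_k`. -/
theorem AgreesAtLevel.lerp {f g : E2 k → ℝ} {b t : ℝ} (hf : AgreesAtLevel f b)
    (hg : AgreesAtLevel g b) (ht : t ∈ Set.Icc (0 : ℝ) 1) :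
    AgreesAtLevel (fun z => (1 - t) * f z + t * g z) b := by
  have h₀ : 0 ≤ 1 - t := by linarith [ht.2]
  have h₁ : 0 ≤ t := ht.1
  have hlt : ∀ z, Q k z < b → (1 - t) * f z + t * g z < b := by
    intro z hz
    have h₂ := (hf.lt_iff z).2 hz
    have h₃ := (hg.lt_iff z).2 hz
    rcases h₁.lt_or_eq with h | h
    · nlinarith
    · rw [← h]
      linarith
  have hgt : ∀ z, b < Q k z → b < (1 - t) * f z + t * g z := by
    intro z hz
    have h₂ := (hf.gt_iff z).2 hz
    have h₃ := (hg.gt_iff z).2 hz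
    rcases h₁.lt_or_eq with h | h
    · nlinarith
    · rw [← h]
      linarith
  have heq : ∀ z, Q k z = b → (1 - t) * f z + t * g z = b := by
    intro z hz
    rw [(hf.eq_iff z).2 hz, (hg.eq_iff z).2 hz]
    ring
  refine ⟨fun z hz => ?_, fun z => ⟨fun h => ?_, hlt z⟩, fun z => ⟨fun h => ?_, hgt z⟩⟩
  · filter_upwards [hf.eventuallyEq z hz, hg.eventuallyEq z hz] with w h₂ h₃
    rw [h₂, h₃]
    ring
  · by_contra! hc
    rcases hc.lt_or_eq with hc | hc
    · exact absurd (hgt z hc) h.le.not_gt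
    · exact absurd (heq z hc.symm) h.ne
  · by_contra! hc
    rcases hc.lt_or_eq with hc | hc
    · exact absurd (hlt z hc) h.le.not_gt
    · exact absurd (heq z hc) h.ne'

/-- The level set is that of `Q` itself, so the constant isotopy suffices. -/
theorem AgreesAtLevel.mem_spaceH {f : CInf k} {b : ℝ} (h : AgreesAtLevel f.toFun b)
    (hb : b ∈ Set.Ioo (0 : ℝ) 1) : (f, b) ∈ spaceH k := by
  refine ⟨hb, fun z hz => ?_, ?_⟩
  · have h₁ := (h.eq_iff z).1 hz
    rw [isCritical_congr (h.eventuallyEq z h₁)]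
    exact isRegularValue_Q k hb.1 z h₁
  · have h₁ : f.toFun ⁻¹' {b} = Q k ⁻¹' {b} := Set.ext fun z => h.eq_iff z
    simp only [h₁]
    exact IsotopicFixingOutside.refl _ _

/-- The shrinking of a function in `C^∞_k`. -/
def CInf.shrink (c : Set.Ioc (0 : ℝ) 1) (f : CInf k) : CInf k where
  toFun := _root_.shrink (c : ℝ) f.toFun
  smooth := contDiff_const.mul (f.smooth.comp (contDiff_const_smul _))
  eq_Q z hz := by
    rw [_root_.shrink, f.eq_Q _ (inv_smul_notMem_setA c.2 hz), Q_smul]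
    have := c.2.1.ne'
    field_simp

theorem CInf.shrink_apply (c : Set.Ioc (0 : ℝ) 1) (f : CInf k) (z : E2 k) :
    (f.shrink c).toFun z = (c : ℝ) ^ 2 * f.toFun ((c : ℝ)⁻¹ • z) := rfl

theorem CInf.shrink_one (f : CInf k) : f.shrink ⟨1, one_pos, le_rfl⟩ = f :=
  CInf.ext fun z => by simp [CInf.shrink_apply]

theorem CInf.shrink_ofQ (c : Set.Ioc (0 : ℝ) 1) : (CInf.ofQ k).shrink c = CInf.ofQ k :=
  CInf.ext fun z => by
    have := c.2.1.ne'
    rw [CInf.shrink_apply]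
    simp only [CInf.ofQ, Q_smul]
    field_simp

/-- Linear interpolation of functions in `C^∞_k`. -/
def CInf.lerp (t : ℝ) (f g : CInf k) : CInf k where
  toFun z := (1 - t) * f.toFun z + t * g.toFun z
  smooth := (contDiff_const.mul f.smooth).add (contDiff_const.mul g.smooth)
  eq_Q z hz := by
    rw [f.eq_Q z hz, g.eq_Q z hz]
    ring

theorem CInf.lerp_apply (t : ℝ) (f g : CInf k) (z : E2 k) :
    (CInf.lerp t f g).toFun z = (1 - t) * f.toFun z + t * g.toFun z := rfl

@[simp]
theorem CInf.lerp_zero (f g : CInf k) : CInf.lerp 0 f g = f :=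
  CInf.ext fun z => by simp [CInf.lerp_apply]

@[simp]
theorem CInf.lerp_one (f g : CInf k) : CInf.lerp 1 f g = g :=
  CInf.ext fun z => by simp [CInf.lerp_apply]

@[simp]
theorem CInf.lerp_self (t : ℝ) (f : CInf k) : CInf.lerp t f f = f :=
  CInf.ext fun z => by simp only [CInf.lerp_apply]; ring

section Continuity

variable {P : Type*} [TopologicalSpace P]

theorem CInf.continuous_lerp {t : P → ℝ} {f g : P → CInf k} (ht : Continuous t)
    (hf : Continuous f) (hg : Continuous g) : Continuous fun p => CInf.lerp (t p) (f p) (g p) := by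
  refine CInf.continuous_of_paramContDiffOn fun n => ?_
  exact (((ParamContDiffOn.of_continuous_fst (c := fun p => 1 - t p) (by fun_prop)).mul isOpen_univ
    (CInf.paramContDiffOn hf n))).add isOpen_univ
    ((ParamContDiffOn.of_continuous_fst ht).mul isOpen_univ (CInf.paramContDiffOn hg n))

theorem CInf.continuous_shrink {c : P → Set.Ioc (0 : ℝ) 1} {f : P → CInf k} (hc : Continuous c)
    (hf : Continuous f) : Continuous fun p => (f p).shrink (c p) := by
  refine CInf.continuous_of_paramContDiffOn fun n => ?_
  have hc' : Continuous fun p => (c p : ℝ)⁻¹ :=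
    (continuous_subtype_val.comp hc).inv₀ fun p => (c p).2.1.ne'
  exact (ParamContDiffOn.of_continuous_fst (c := fun p => (c p : ℝ) ^ 2) (by fun_prop)).mul
    isOpen_univ ((CInf.paramContDiffOn hf n).comp isOpen_univ
      ((ParamContDiffOn.of_continuous_fst hc').smul isOpen_univ ParamContDiffOn.snd)
      fun _ _ => trivial)

end Continuity

theorem isCritical_shrink_iff (c : Set.Ioc (0 : ℝ) 1) (f : CInf k) (z : E2 k) :
    IsCritical (f.shrink c).toFun z ↔ IsCritical f.toFun ((c : ℝ)⁻¹ • z) := by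
  have hc := c.2.1.ne'
  have h₁ : IsCritical (f.shrink c).toFun z ↔
      IsCritical (fun z => f.toFun ((c : ℝ)⁻¹ • z)) z :=
    isCritical_const_mul_iff (pow_ne_zero 2 hc)
  rw [h₁]
  exact isCritical_comp_iff (f := f.toFun) (φ := fun z => (c : ℝ)⁻¹ • z) f.differentiable.differentiableAt
    (by fun_prop)
    (isInvertible_fderiv_of_inverse (φ' := fun z => (c : ℝ) • z) (by fun_prop) (by fun_prop)
      (fun z => smul_inv_smul₀ hc z) z)

theorem hessianNondegenerate_shrink (c : Set.Ioc (0 : ℝ) 1) (f : CInf k) {z : E2 k}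
    (hz : IsCritical f.toFun z) (h : HessianNondegenerate f.toFun z) :
    HessianNondegenerate (f.shrink c).toFun ((c : ℝ) • z) := by
  have hc := c.2.1.ne'
  refine (hessianNondegenerate_const_mul_iff (f := fun z => f.toFun ((c : ℝ)⁻¹ • z))
    (pow_ne_zero 2 hc)).2 ?_
  refine hessianNondegenerate_comp (f := f.toFun) (φ := fun z => (c : ℝ)⁻¹ • z) f.smooth
    (contDiff_const_smul _)
    (isInvertible_fderiv_of_inverse (φ' := fun z => (c : ℝ) • z) (by fun_prop) (by fun_prop)
      (fun z => smul_inv_smul₀ hc z) _) ?_ ?_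
  · rwa [inv_smul_smul₀ hc]
  · rwa [inv_smul_smul₀ hc]

theorem shrink_mem_spaceM {f : CInf k} {b b' : ℝ} (h : (f, b) ∈ spaceM k) (c : Set.Ioc (0 : ℝ) 1)
    (hb' : b' ∈ Set.Ioo (0 : ℝ) 1) : (f.shrink c, b') ∈ spaceM k := by
  obtain ⟨-, z, hz, hn, h0⟩ := h
  have hc := c.2.1.ne'
  refine ⟨hb', (c : ℝ) • z, fun w => ?_, ?_, ?_⟩
  · simp only [isCritical_shrink_iff]
    rw [hz, inv_smul_eq_iff₀ hc]
  · exact hessianNondegenerate_shrink c f ((hz z).2 rfl) hn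
  · simp only [CInf.shrink_apply]
    rw [inv_smul_smul₀ hc]
    simp only at h0
    rw [h0, mul_zero]

theorem shrink_eq_Q (f : CInf k) (c : Set.Ioc (0 : ℝ) 1) {z : E2 k} (hz : (c : ℝ) ^ 2 ≤ Q k z) :
    (f.shrink c).toFun z = Q k z := by
  have hc := c.2.1.ne'
  have hc2 : (0 : ℝ) < (c : ℝ) ^ 2 := by have := c.2.1; positivity
  rw [CInf.shrink_apply, f.eq_Q_of_one_le, Q_smul]
  · field_simp
  · rw [Q_smul, inv_pow, inv_mul_eq_div, le_div_iff₀ hc2, one_mul]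
    exact hz

theorem shrink_le {f : CInf k} {b : ℝ} (h : (f, b) ∈ spaceM k) (c : Set.Ioc (0 : ℝ) 1) {z : E2 k}
    (hz : Q k z ≤ (c : ℝ) ^ 2) : (f.shrink c).toFun z ≤ (c : ℝ) ^ 2 := by
  obtain ⟨-, w, hw, -, h0⟩ := h
  have hc2 : (0 : ℝ) < (c : ℝ) ^ 2 := by have := c.2.1; positivity
  rw [CInf.shrink_apply]
  refine mul_le_of_le_one_right hc2.le (f.le_one (fun y hy => ?_) ?_)
  · rw [(hw y).1 hy]
    simp only at h0
    rw [h0]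
    exact zero_le_one
  · rw [Q_smul, inv_pow, inv_mul_eq_div, div_le_one hc2]
    exact hz

/-- Functions that are equal to `Q` on `{a ≤ Q}` and at most `a` elsewhere. -/
def IsStandardAbove (f : E2 k → ℝ) (a : ℝ) : Prop :=
  (∀ z, a ≤ Q k z → f z = Q k z) ∧ ∀ z, Q k z ≤ a → f z ≤ a

theorem IsStandardAbove.mono {f : E2 k → ℝ} {a a' : ℝ} (h : IsStandardAbove f a) (ha : a ≤ a') :
    IsStandardAbove f a' := by
  refine ⟨fun z hz => h.1 z (ha.trans hz), fun z hz => ?_⟩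
  rcases le_total (Q k z) a with h₁ | h₁
  · exact (h.2 z h₁).trans ha
  · rwa [h.1 z h₁]

theorem IsStandardAbove.agreesAtLevel {f : E2 k → ℝ} {a b : ℝ} (h : IsStandardAbove f a)
    (hab : a < b) : AgreesAtLevel f b := by
  refine AgreesAtLevel.of_eps (ε := b - a) (by linarith) (fun z hz => h.1 z ?_) (fun z => ?_)
    fun z => ?_
  · rw [abs_lt] at hz
    linarith
  · rcases le_total (Q k z) a with h₁ | h₁
    · exact ⟨fun _ => by linarith, fun _ => by linarith [h.2 z h₁]⟩
    · rw [h.1 z h₁]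
  · rcases le_total (Q k z) a with h₁ | h₁
    · exact ⟨fun _ => by linarith [h.2 z h₁], fun _ => by linarith⟩
    · rw [h.1 z h₁]

theorem isStandardAbove_Q (a : ℝ) : IsStandardAbove (Q k) a := ⟨fun _ _ => rfl, fun _ h => h⟩

theorem IsStandardAbove.lerp {f g : E2 k → ℝ} {a t : ℝ} (hf : IsStandardAbove f a)
    (hg : IsStandardAbove g a) (ht : t ∈ Set.Icc (0 : ℝ) 1) :
    IsStandardAbove (fun z => (1 - t) * f z + t * g z) a := by
  refine ⟨fun z hz => ?_, fun z hz => ?_⟩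
  · simp only [hf.1 z hz, hg.1 z hz]
    ring
  · have h₁ := hf.2 z hz
    have h₂ := hg.2 z hz
    simp only
    nlinarith [ht.1, ht.2]

/-- The only critical value of `f` is `0`, so `CInf.le_one` bounds `f` by `1` on `{Q ≤ 1}`, while `f
= Q` on `{Q ≥ 1}`. Rescaling turns the bound `1` into `c²`. -/
theorem isStandardAbove_shrink {f : CInf k} {b : ℝ} (h : (f, b) ∈ spaceM k)
    (c : Set.Ioc (0 : ℝ) 1) : IsStandardAbove (f.shrink c).toFun ((c : ℝ) ^ 2) :=
  ⟨fun _ hz => shrink_eq_Q f c hz, fun _ hz => shrink_le h c hz⟩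

/-- All shrinkings of `f` have the single critical value `0`, so `b` is regular along the path from
`f_b` to `f` and the level sets at its ends are isotopic. Since `f_b` is standard above `b² < b`, it
has the level set of `Q`. -/
theorem spaceM_subset_spaceH (k : ℕ) : spaceM k ⊆ spaceH k := by
  rintro ⟨f, b⟩ h
  have hb := h.1
  simp only at hb
  let c : I → Set.Ioc (0 : ℝ) 1 := fun s => ⟨b + s * (1 - b), by
    have := mul_nonneg s.2.1 (sub_nonneg.2 hb.2.le)
    linarith [hb.1], by
    have := mul_le_of_le_one_left (sub_nonneg.2 hb.2.le) s.2.2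
    linarith⟩
  have hc : Continuous c := by fun_prop
  have hM : ∀ s, (f.shrink (c s), b) ∈ spaceM k := fun s => shrink_mem_spaceM h _ hb
  have hreg : ∀ s, IsRegularValue (f.shrink (c s)).toFun b := by
    intro s z hz hcr
    obtain ⟨-, w, hw, -, h0⟩ := hM s
    rw [(hw z).1 hcr] at hz
    simp only at h0
    rw [h0] at hz
    exact hb.1.ne hz
  have h₁ := isotopicFixingOutside_of_path (CInf.continuous_shrink hc continuous_const) hreg
  have h₂ : f.shrink (c 1) = f := by
    have : c 1 = ⟨1, one_pos, le_rfl⟩ := Subtype.ext (by simp [c])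
    rw [this, CInf.shrink_one]
  have h₃ : (f.shrink (c 0)).toFun ⁻¹' {b} = Q k ⁻¹' {b} := by
    have h₄ := (isStandardAbove_shrink h (c 0)).agreesAtLevel (b := b) (by
      simp only [c, Set.Icc.coe_zero, zero_mul, add_zero]
      nlinarith [hb.1, hb.2])
    exact Set.ext fun z => h₄.eq_iff z
  rw [h₂, h₃] at h₁
  refine ⟨hb, ?_, h₁⟩
  have := hreg 1
  rwa [h₂] at this

theorem spaceM_subset_spaceU (k : ℕ) : spaceM k ⊆ spaceU k := by
  intro p h
  refine ⟨spaceM_subset_spaceH k h, ?_⟩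
  obtain ⟨hb, z, hz, hn, h0⟩ := h
  refine ⟨z, fun w => ⟨fun hw => (hz w).1 hw.2, ?_⟩, hn, h0⟩
  rintro rfl
  exact ⟨h0.le.trans hb.1.le, (hz w).2 rfl⟩

/-- The isotopy is conjugated by the scaling. It still fixes everything outside `A`, since `c⁻¹ z`
is outside `A` whenever `z` is. -/
theorem shrink_mem_spaceH {f : CInf k} {b : ℝ} (h : (f, b) ∈ spaceH k) (c : Set.Ioc (0 : ℝ) 1) :
    (f.shrink c, (c : ℝ) ^ 2 * b) ∈ spaceH k := by
  obtain ⟨hb, hreg, Φ, hΦ, hΦ', hΦ0, hΦA, hΦ1⟩ := h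
  simp only at hb hreg hΦ1
  have hc := c.2.1
  have hc0 := hc.ne'
  have hc2 : (0 : ℝ) < (c : ℝ) ^ 2 := by positivity
  have hc1 : (c : ℝ) ^ 2 ≤ 1 := pow_le_one₀ hc.le c.2.2
  let e : E2 k ≃ E2 k := ⟨fun z => (c : ℝ) • z, fun z => (c : ℝ)⁻¹ • z,
    fun z => inv_smul_smul₀ hc0 z, fun z => smul_inv_smul₀ hc0 z⟩
  have hpre : ∀ g : CInf k, (g.shrink c).toFun ⁻¹' {(c : ℝ) ^ 2 * b} = e '' (g.toFun ⁻¹' {b}) := by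
    intro g
    rw [e.image_eq_preimage_symm]
    ext z
    simp only [Set.mem_preimage, Set.mem_singleton_iff, CInf.shrink_apply]
    exact mul_right_inj' hc2.ne'
  refine ⟨⟨by have := hb.1; positivity, by nlinarith [hb.1, hb.2]⟩, fun z hz => ?_,
    fun t => e.symm.trans ((Φ t).trans e), ?_, ?_, fun z => ?_, fun t ht z hz => ?_, ?_⟩
  · simp only [isCritical_shrink_iff]
    exact hreg _ (mul_left_cancel₀ hc2.ne' hz)
  · have h₁ : ContDiffOn ℝ ∞ (fun q : ℝ × E2 k => (q.1, (c : ℝ)⁻¹ • q.2))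
        (Set.Icc 0 1 ×ˢ Set.univ) := by fun_prop
    exact (hΦ.comp h₁ fun q hq => ⟨hq.1, trivial⟩).const_smul (c : ℝ)
  · have h₁ : ContDiffOn ℝ ∞ (fun q : ℝ × E2 k => (q.1, (c : ℝ)⁻¹ • q.2))
        (Set.Icc 0 1 ×ˢ Set.univ) := by fun_prop
    exact (hΦ'.comp h₁ fun q hq => ⟨hq.1, trivial⟩).const_smul (c : ℝ)
  · simp [hΦ0]
  · have h₁ : Φ t (e.symm z) = e.symm z := hΦA t ht _ (inv_smul_notMem_setA c.2 hz)
    simp [h₁]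
  · have h₁ := hpre (CInf.ofQ k)
    rw [CInf.shrink_ofQ] at h₁
    have h₂ : Q k ⁻¹' {(c : ℝ) ^ 2 * b} = e '' (Q k ⁻¹' {b}) := h₁
    simp only [hpre, h₂, ← hΦ1, ← Set.image_comp]
    congr 1
    funext z
    simp

theorem shrink_mem_spaceU {f : CInf k} {b : ℝ} (h : (f, b) ∈ spaceU k) (c : Set.Ioc (0 : ℝ) 1) :
    (f.shrink c, (c : ℝ) ^ 2 * b) ∈ spaceU k := by
  obtain ⟨hH, z, hz, hn, h0⟩ := h
  simp only at hz hn h0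
  have hc0 := c.2.1.ne'
  have hc2 : (0 : ℝ) < (c : ℝ) ^ 2 := by have := c.2.1; positivity
  refine ⟨shrink_mem_spaceH hH c, (c : ℝ) • z, fun w => ?_, ?_, ?_⟩
  · simp only [isCritical_shrink_iff, CInf.shrink_apply]
    rw [mul_le_mul_iff_right₀ hc2, hz, inv_smul_eq_iff₀ hc0]
  · exact hessianNondegenerate_shrink c f ((hz z).2 rfl).2 hn
  · simp only [CInf.shrink_apply]
    rw [inv_smul_smul₀ hc0, h0, mul_zero]

/-- Membership in `U_k` is preserved by composition with a diffeomorphism, as long as the result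
lies in `H_k`. -/
theorem comp_mem_spaceU {f g : CInf k} {b : ℝ} {φ φ' : E2 k → E2 k} (h : (f, b) ∈ spaceU k)
    (hg : (g, b) ∈ spaceH k) (hφ : ContDiff ℝ ∞ φ) (hφ' : ContDiff ℝ ∞ φ')
    (hl : ∀ z, φ' (φ z) = z) (hr : ∀ z, φ (φ' z) = z) (hfg : ∀ z, g.toFun z = f.toFun (φ z)) :
    (g, b) ∈ spaceU k := by
  obtain ⟨-, z, hz, hn, h0⟩ := h
  simp only at hz hn h0
  have hfg' : g.toFun = fun z => f.toFun (φ z) := funext hfg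
  have hinv : ∀ w, (fderiv ℝ φ w).IsInvertible := isInvertible_fderiv_of_inverse
    (hφ.differentiable (by simp)) (hφ'.differentiable (by simp)) hl
  have hcr : ∀ w, IsCritical g.toFun w ↔ IsCritical f.toFun (φ w) := by
    intro w
    rw [hfg']
    exact isCritical_comp_iff f.differentiable.differentiableAt
      ((hφ.differentiable (by simp)).differentiableAt) (hinv w)
  refine ⟨hg, φ' z, fun w => ?_, ?_, ?_⟩
  · simp only [hcr]
    rw [hfg w, hz]
    exact ⟨fun h => by rw [← h, hl], fun h => by rw [h, hr]⟩
  · simp only [hfg']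
    refine hessianNondegenerate_comp f.smooth hφ (hinv _) ?_ ?_
    · rw [hr]
      exact ((hz z).2 rfl).2
    · rwa [hr]
  · simp only [hfg, hr, h0]

/-- Membership in `U_k` only depends on the function near its sublevel set. -/
theorem congr_mem_spaceU {f g : CInf k} {b : ℝ} (h : (f, b) ∈ spaceU k) (hg : (g, b) ∈ spaceH k)
    (hle : ∀ z, g.toFun z ≤ b ↔ f.toFun z ≤ b)
    (hfg : ∀ z, f.toFun z ≤ b → g.toFun =ᶠ[nhds z] f.toFun) : (g, b) ∈ spaceU k := by
  obtain ⟨-, z, hz, hn, h0⟩ := h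
  simp only at hz hn h0
  have hzb := ((hz z).2 rfl).1
  refine ⟨hg, z, fun w => ?_, ?_, ?_⟩
  · simp only [hle]
    rw [← hz w]
    exact and_congr_right fun hw => isCritical_congr (hfg w hw)
  · exact (hessianNondegenerate_congr (hfg z hzb)).2 hn
  · exact (hfg z hzb).eq_of_nhds.trans h0

/-- A function in `U_k` that is equal to `Q` on `{b - ε < Q}` lies in `M_k`. -/
theorem mem_spaceM_of_spaceU {f : CInf k} {b b' ε : ℝ} (h : (f, b) ∈ spaceU k) (hε : 0 < ε)
    (hεb : ε < b) (hf : ∀ z, b - ε < Q k z → f.toFun z = Q k z)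
    (hlt : ∀ z, f.toFun z < b ↔ Q k z < b) (hb' : b' ∈ Set.Ioo (0 : ℝ) 1) : (f, b') ∈ spaceM k := by
  obtain ⟨-, z, hz, hn, h0⟩ := h
  simp only at hz hn h0
  have ho : IsOpen {z : E2 k | b - ε < Q k z} := isOpen_lt continuous_const (contDiff_Q k).continuous
  refine ⟨hb', z, fun w => ⟨fun hw => ?_, ?_⟩, hn, h0⟩
  · by_cases hQ : b - ε < Q k w
    · have h₁ : f.toFun =ᶠ[nhds w] Q k := by
        filter_upwards [ho.mem_nhds hQ] with y hy
        exact hf y hy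
      exact absurd ((isCritical_congr h₁).1 hw) (isRegularValue_Q k (by linarith) w rfl)
    · exact (hz w).1 ⟨((hlt w).2 (by linarith)).le, hw⟩
  · rintro rfl
    exact ((hz w).2 rfl).2

end ModelFunctions

/-! ### The homotopy extension property -/

section HomotopyExtension

variable {X Y Z : Type*} [TopologicalSpace X] [TopologicalSpace Y] [TopologicalSpace Z]

/-- `B` is a closed subset of `X` such that `I × X` retracts onto `{0} × X ∪ I × B`. -/
structure IsClosedCofibration (B : Set X) : Prop where
  isClosed : IsClosed B
  exists_retraction : ∃ r : C(I × X, I × X), (∀ p, (r p).1 = 0 ∨ (r p).2 ∈ B) ∧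
    (∀ x, r (0, x) = (0, x)) ∧ ∀ t, ∀ x ∈ B, r (t, x) = (t, x)

/-- Pasting a map on `{r₁ = 0}` with a map on `{r₂ ∈ B}`. -/
theorem IsClosedCofibration.exists_paste {B : Set X} (hB : IsClosed B) (r : C(I × X, I × X))
    (hr : ∀ p, (r p).1 = 0 ∨ (r p).2 ∈ B) (f : C(Z × X, Y)) (L : C(Z × I × B, Y))
    (hL : ∀ z, ∀ b : B, L (z, 0, b) = f (z, b)) :
    ∃ K : C(Z × I × X, Y), (∀ z p, (r p).1 = 0 → K (z, p) = f (z, (r p).2)) ∧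
      ∀ z p (h : (r p).2 ∈ B), K (z, p) = L (z, (r p).1, ⟨(r p).2, h⟩) := by
  classical
  let k : Z × I × X → Y := fun q =>
    if h : (r q.2).2 ∈ B then L (q.1, (r q.2).1, ⟨(r q.2).2, h⟩) else f (q.1, (r q.2).2)
  have h₂ : ∀ z p (h : (r p).2 ∈ B), k (z, p) = L (z, (r p).1, ⟨(r p).2, h⟩) :=
    fun z p h => dif_pos h
  have h₁ : ∀ z p, (r p).1 = 0 → k (z, p) = f (z, (r p).2) := by
    intro z p h
    by_cases h' : (r p).2 ∈ B
    · rw [h₂ z p h', h, hL]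
    · exact dif_neg h'
  have hc₁ : IsClosed {q : Z × I × X | (r q.2).1 = 0} :=
    isClosed_eq (by fun_prop) continuous_const
  have hc₂ : IsClosed {q : Z × I × X | (r q.2).2 ∈ B} := hB.preimage (by fun_prop)
  have hk₁ : ContinuousOn k {q : Z × I × X | (r q.2).1 = 0} := by
    refine ContinuousOn.congr (f := fun q => f (q.1, (r q.2).2)) ?_ fun q hq => h₁ q.1 q.2 hq
    fun_prop
  have hk₂ : ContinuousOn k {q : Z × I × X | (r q.2).2 ∈ B} := by
    rw [continuousOn_iff_continuous_domRestrict]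
    have : Set.domRestrict {q : Z × I × X | (r q.2).2 ∈ B} k =
        fun q => L (q.1.1, (r q.1.2).1, ⟨(r q.1.2).2, q.2⟩) :=
      funext fun q => h₂ q.1.1 q.1.2 q.2
    rw [this]
    fun_prop
  have hk : Continuous k := by
    rw [← continuousOn_univ]
    refine (hk₁.union_of_isClosed hk₂ hc₁ hc₂).mono fun q _ => hr q.2
  exact ⟨⟨k, hk⟩, h₁, h₂⟩

/-- The homotopy extension property. -/
theorem IsClosedCofibration.exists_extension {B : Set X} (hB : IsClosedCofibration B)
    (f : C(X, Y)) (L : C(I × B, Y)) (hL : ∀ b : B, L (0, b) = f b) :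
    ∃ K : C(I × X, Y), (∀ x, K (0, x) = f x) ∧ ∀ t, ∀ b : B, K (t, b) = L (t, b) := by
  obtain ⟨r, hr, hr₀, hrB⟩ := hB.exists_retraction
  obtain ⟨K, h₁, h₂⟩ := IsClosedCofibration.exists_paste (Z := Unit) hB.isClosed r hr
    (f.comp ContinuousMap.snd) (L.comp ContinuousMap.snd) fun _ b => hL b
  refine ⟨K.comp ⟨fun p => ((), p), by fun_prop⟩, fun x => ?_, fun t b => ?_⟩
  · have := h₁ () (0, x) (by rw [hr₀])
    simpa [hr₀] using this
  · have := h₂ () (t, b) (by rw [hrB t b b.2]; exact b.2)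
    simpa [hrB t b b.2] using this

/-- Two homotopies with the same restriction to `I × B` whose starting maps are homotopic relative
to `B` have final maps that are homotopic relative to `B`. -/
theorem IsClosedCofibration.homotopicRel_of_eq_on {B : Set X} (hB : IsClosedCofibration B)
    (K K' : C(I × X, Y)) (hK : ∀ t, ∀ b ∈ B, K (t, b) = K' (t, b))
    (h₀ : (K.comp (ContinuousMap.prodMk (ContinuousMap.const X 0) (ContinuousMap.id X))).HomotopicRel
      (K'.comp (ContinuousMap.prodMk (ContinuousMap.const X 0) (ContinuousMap.id X))) B) :
    (K.comp (ContinuousMap.prodMk (ContinuousMap.const X 1) (ContinuousMap.id X))).HomotopicRel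
      (K'.comp (ContinuousMap.prodMk (ContinuousMap.const X 1) (ContinuousMap.id X))) B := by
  obtain ⟨r, hr, hr₀, hrB⟩ := hB.exists_retraction
  let v : I → I → I → I := fun s t u => Set.projIcc 0 1 zero_le_one ((1 - (s : ℝ)) * t + s * u)
  have hv : Continuous fun q : I × I × I => v q.1 q.2.1 q.2.2 := by fun_prop
  have hv₀ : ∀ t u, v 0 t u = t := fun t u => by simp [v]
  have hv₁ : ∀ t u, v 1 t u = u := fun t u => by simp [v]
  have hvs : ∀ s t, v s t t = t := fun s t => by
    have : (1 - (s : ℝ)) * t + s * t = t := by ring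
    simp [v, this]
  -- The path in `I × X` from `(1, x)` to `r (1, x)` has second coordinate `(r (s, x)).2` and
  -- linearly changing first coordinate. It is constant for `x ∈ B`.
  have hret : ∀ K : C(I × X, Y),
      (K.comp (ContinuousMap.prodMk (ContinuousMap.const X 1) (ContinuousMap.id X))).HomotopicRel
      ((K.comp r).comp (ContinuousMap.prodMk (ContinuousMap.const X 1) (ContinuousMap.id X))) B := by
    intro K
    refine ⟨⟨⟨⟨fun q => K (v q.1 1 (r (1, q.2)).1, (r (q.1, q.2)).2), ?_⟩, fun x => ?_, fun x => ?_⟩,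
      fun t x hx => ?_⟩⟩
    · have h₁ : Continuous fun q : I × X => v q.1 1 (r (1, q.2)).1 :=
        hv.comp (f := fun q : I × X => (q.1, (1 : I), (r (1, q.2)).1)) (by fun_prop)
      exact K.continuous.comp (h₁.prodMk r.continuous.snd)
    · simp [hv₀, hr₀]
    · simp [hv₁]
    · simp [hrB _ x hx, hvs]
  refine ((hret K).trans ?_).trans (hret K').symm
  obtain ⟨H⟩ := h₀
  -- This connects `K ∘ r` with `K' ∘ r`: over the part that `r` sends to time `0` the given
  -- homotopy `H` is used, and over the part sent to `I × B` the two maps already agree.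
  obtain ⟨G, h₁, h₂⟩ := IsClosedCofibration.exists_paste (Z := I) hB.isClosed r hr
    H.toContinuousMap ⟨fun q => K (q.2.1, q.2.2), by fun_prop⟩ fun s b => by
      simpa using (H.prop s b b.2).symm
  refine ⟨⟨⟨⟨fun q => G (q.1, 1, q.2), by fun_prop⟩, fun x => ?_, fun x => ?_⟩,
    fun s x hx => ?_⟩⟩
  · rcases hr (1, x) with h | h
    · have : r (1, x) = (0, (r (1, x)).2) := Prod.ext h rfl
      refine (h₁ 0 _ h).trans ((H.apply_zero _).trans ?_)
      change K (0, (r (1, x)).2) = K (r (1, x))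
      rw [← this]
    · simp [h₂ 0 _ h]
  · rcases hr (1, x) with h | h
    · have : r (1, x) = (0, (r (1, x)).2) := Prod.ext h rfl
      refine (h₁ 1 _ h).trans ((H.apply_one _).trans ?_)
      change K' (0, (r (1, x)).2) = K' (r (1, x))
      rw [← this]
    · simp [h₂ 1 _ h, hK _ _ h]
  · have h : (r (1, x)).2 ∈ B := by rw [hrB 1 x hx]; exact hx
    simp [h₂ s _ h]

end HomotopyExtension

/-! ### Changing the target of a compression problem -/

section Compression

variable {X M F : Type*} [TopologicalSpace X] [TopologicalSpace M] [TopologicalSpace F]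

/-- Let `D` be a deformation of `M` into `M₀`. If the maps `(X, B) → (F, m M₀)` can be compressed
into `M`, then so can the maps `(X, B) → (F, m M)`. -/
theorem exists_compression_of_deformation {B : Set X} (hB : IsClosedCofibration B) {m : C(M, F)}
    (hm : Topology.IsEmbedding m) (D : C(I × M, M)) (hD : ∀ x, D (0, x) = x) {M₀ : Set M}
    (hD₁ : ∀ x, D (1, x) ∈ M₀)
    (H : ∀ β : C(X, F), (∀ x ∈ B, β x ∈ m '' M₀) → ∃ g : C(X, M), β.HomotopicRel (m.comp g) B)
    (β : C(X, F)) (hβ : ∀ x ∈ B, β x ∈ Set.range m) :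
    ∃ g : C(X, M), β.HomotopicRel (m.comp g) B := by
  choose g hg using fun b : B => hβ b b.2
  have hgc : Continuous g := by
    rw [hm.continuous_iff, show m ∘ g = fun b : B => β b from funext hg]
    fun_prop
  obtain ⟨K, hK₀, hKB⟩ := hB.exists_extension β ⟨fun q => m (D (q.1, g q.2)), by fun_prop⟩
    fun b => by simp [hD, hg]
  obtain ⟨g₁, hg₁⟩ := H (K.comp (ContinuousMap.prodMk (ContinuousMap.const X 1)
    (ContinuousMap.id X))) fun x hx => ⟨_, hD₁ (g ⟨x, hx⟩), by simpa using (hKB 1 ⟨x, hx⟩).symm⟩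
  have hg₁B : ∀ b : B, g₁ b = D (1, g b) := fun b => by
    obtain ⟨G⟩ := hg₁
    refine hm.injective ?_
    have h₁ := G.eq_snd 1 b.2
    rw [G.apply_one] at h₁
    have h₂ := G.eq_fst 1 b.2
    rw [G.apply_one] at h₂
    simpa [hKB] using h₂
  -- The deformation is run backwards from the compressed map. On `B` this retraces `K`, so
  -- reversing `K` and applying `m` to `K'` give homotopies with the same restriction to `B`, to
  -- which `homotopicRel_of_eq_on` applies.
  obtain ⟨K', hK'₀, hK'B⟩ := hB.exists_extension g₁
    ⟨fun q => D (σ q.1, g q.2), by fun_prop⟩ fun b => by simp [hg₁B]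
  refine ⟨K'.comp (ContinuousMap.prodMk (ContinuousMap.const X 1) (ContinuousMap.id X)), ?_⟩
  have := hB.homotopicRel_of_eq_on (K.comp ⟨fun q : I × X => (σ q.1, q.2), by fun_prop⟩)
    (m.comp K') (fun t b hb => by simpa [hK'B t ⟨b, hb⟩] using hKB (σ t) ⟨b, hb⟩)
    (by
      convert hg₁ using 1
      · ext x; simp
      · ext x; simp [hK'₀])
  convert this using 1
  · ext x; simp [hK₀]
  · rfl

/-- Let `T` be a homotopy from `m` to an injective map `T₁`. If the maps `(X, B) → (F, T₁ M₀)` can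
be compressed by `T₁`, then the maps `(X, B) → (F, m M₀)` can be compressed by `m`. -/
theorem exists_compression_of_homotopy {B : Set X} (hB : IsClosedCofibration B) {m : C(M, F)}
    (hm : Topology.IsEmbedding m) (T : C(I × M, F)) (hT : ∀ x, T (0, x) = m x)
    (hT₁ : Function.Injective fun x => T (1, x)) {M₀ : Set M}
    (H : ∀ β : C(X, F), (∀ x ∈ B, β x ∈ (fun x => T (1, x)) '' M₀) → ∃ g : C(X, M),
      β.HomotopicRel (T.comp (ContinuousMap.prodMk (ContinuousMap.const X 1) g)) B)
    (β : C(X, F)) (hβ : ∀ x ∈ B, β x ∈ m '' M₀) :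
    ∃ g : C(X, M), β.HomotopicRel (m.comp g) B := by
  choose g hg₀ hg using fun b : B => hβ b b.2
  have hgc : Continuous g := by
    rw [hm.continuous_iff, show m ∘ g = fun b : B => β b from funext hg]
    fun_prop
  obtain ⟨K, hK₀, hKB⟩ := hB.exists_extension β ⟨fun q => T (q.1, g q.2), by fun_prop⟩
    fun b => by simp [hT, hg]
  obtain ⟨g₁, hg₁⟩ := H (K.comp (ContinuousMap.prodMk (ContinuousMap.const X 1)
    (ContinuousMap.id X))) fun x hx => ⟨_, hg₀ ⟨x, hx⟩, by simpa using (hKB 1 ⟨x, hx⟩).symm⟩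
  -- Injectivity of the final map is needed here: the values of `g₁` on `B` are known only after `T
  -- 1` is applied.
  have hg₁B : ∀ b : B, g₁ b = g b := fun b => by
    obtain ⟨G⟩ := hg₁
    refine hT₁ ?_
    have h₂ := G.eq_fst 1 b.2
    rw [G.apply_one] at h₂
    simpa [hKB] using h₂
  refine ⟨g₁, ?_⟩
  have := hB.homotopicRel_of_eq_on (K.comp ⟨fun q : I × X => (σ q.1, q.2), by fun_prop⟩)
    ⟨fun q => T (σ q.1, g₁ q.2), by fun_prop⟩
    (fun t b hb => by simpa [hg₁B ⟨b, hb⟩] using hKB (σ t) ⟨b, hb⟩)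
    (by
      convert hg₁ using 1
      · ext x; simp
      · ext x; simp)
  convert this using 1
  · ext x; simp [hK₀]
  · ext x; simp [hT]

end Compression

/-! ### Cubes and weak homotopy equivalences -/

section Cube

/-- The boundary of a cube is a closed cofibration. -/
theorem isClosedCofibration_boundary (n : ℕ) :
    IsClosedCofibration (Cube.boundary (Fin n)) := by
  let v : (Fin n → I) → Fin n → ℝ := fun y i => 2 * (y i : ℝ) - 1
  have hv : Continuous v := by fun_prop
  have hv₁ : ∀ y, ‖v y‖ ≤ 1 := fun y => by
    refine (pi_norm_le_iff_of_nonneg zero_le_one).2 fun i => ?_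
    have := (y i).2
    rw [Real.norm_eq_abs, abs_le]
    constructor <;> simp only [v] <;> linarith [this.1, this.2]
  have hvb : ∀ y, y ∈ Cube.boundary (Fin n) ↔ ‖v y‖ = 1 := by
    intro y
    constructor
    · rintro ⟨i, hi⟩
      refine le_antisymm (hv₁ y) (le_trans ?_ (norm_le_pi_norm (v y) i))
      rcases hi with hi | hi <;> simp only [v, hi] <;> norm_num
    · intro h
      by_contra hy
      have h₁ : ‖v y‖ < 1 := by
        refine (pi_norm_lt_iff zero_lt_one).2 fun i => ?_
        have h₂ : ¬ (y i = 0 ∨ y i = 1) := fun h => hy ⟨i, h⟩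
        push Not at h₂
        have h₃ : (0 : ℝ) < y i := lt_of_le_of_ne (y i).2.1 fun h => h₂.1 (Subtype.ext h.symm)
        have h₄ : (y i : ℝ) < 1 := lt_of_le_of_ne (y i).2.2 fun h => h₂.2 (Subtype.ext h)
        rw [Real.norm_eq_abs, abs_lt]
        constructor <;> simp only [v] <;> linarith
      exact h₁.ne h
  -- The retraction is the projection from the point at time `2` over the centre of the cube, with
  -- `v` the coordinates about the centre. The ray through `(t, v)` consists of the points `(2 - (2
  -- - t) / μ, v / μ)`; it reaches the bottom for `μ = (2 - t) / 2` and the side for `μ = ‖v‖`, and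
  -- the larger value is met first.
  let μ : I × (Fin n → I) → ℝ := fun p => max ‖v p.2‖ ((2 - (p.1 : ℝ)) / 2)
  have hμc : Continuous μ := by fun_prop
  have hμ₀ : ∀ p, (2 - (p.1 : ℝ)) / 2 ≤ μ p := fun p => le_max_right _ _
  have hμ₂ : ∀ p, ‖v p.2‖ ≤ μ p := fun p => le_max_left _ _
  have hμ₁ : ∀ p, 0 < μ p := fun p => lt_of_lt_of_le (by linarith [p.1.2.2]) (hμ₀ p)
  let r : I × (Fin n → I) → I × (Fin n → I) := fun p =>
    (Set.projIcc 0 1 zero_le_one (2 - (2 - (p.1 : ℝ)) / μ p),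
      fun i => Set.projIcc 0 1 zero_le_one ((v p.2 i / μ p + 1) / 2))
  have hrc : Continuous r := by
    have := fun p => (hμ₁ p).ne'
    fun_prop (disch := assumption)
  have hμbd : ∀ t, ∀ y ∈ Cube.boundary (Fin n), μ (t, y) = 1 := fun t y hy => by
    have := (hvb y).1 hy
    simp only [μ, this]
    exact max_eq_left (by linarith [t.2.1])
  refine ⟨?_, ⟨r, hrc⟩, fun p => ?_, fun x => ?_, fun t x hx => ?_⟩
  · have : Cube.boundary (Fin n) = {y | ‖v y‖ = 1} := Set.ext hvb
    rw [this]
    exact isClosed_eq (by fun_prop) continuous_const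
  · rcases le_total ‖v p.2‖ ((2 - (p.1 : ℝ)) / 2) with h | h
    · left
      have h₁ : μ p = (2 - (p.1 : ℝ)) / 2 := max_eq_right h
      have h₂ : 2 - (p.1 : ℝ) ≠ 0 := by linarith [p.1.2.2]
      have h₃ : 2 - (2 - (p.1 : ℝ)) / μ p = 0 := by
        rw [h₁]
        field_simp
        ring
      simp [r, h₃]
    · right
      have h₁ : μ p = ‖v p.2‖ := max_eq_left h
      rw [hvb]
      have h₂ : v (r p).2 = (μ p)⁻¹ • v p.2 := by
        funext i
        have h₃ : |v p.2 i / μ p| ≤ 1 := by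
          rw [abs_div, abs_of_pos (hμ₁ p), div_le_one (hμ₁ p)]
          exact (norm_le_pi_norm (v p.2) i).trans (hμ₂ p)
        rw [abs_le] at h₃
        have h₄ : (v p.2 i / μ p + 1) / 2 ∈ Set.Icc (0 : ℝ) 1 :=
          ⟨by linarith, by linarith⟩
        have h₅ : v (r p).2 i = 2 * ((v p.2 i / μ p + 1) / 2) - 1 := by
          simp only [r]
          change 2 * (Set.projIcc (0 : ℝ) 1 zero_le_one _ : ℝ) - 1 = _
          rw [Set.projIcc_of_mem _ h₄]
        rw [h₅, Pi.smul_apply, smul_eq_mul]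
        ring
      change ‖v (r p).2‖ = 1
      rw [h₂, norm_smul, norm_inv, Real.norm_eq_abs, abs_of_pos (hμ₁ p), ← h₁,
        inv_mul_cancel₀ (hμ₁ p).ne']
  · have h : μ (0, x) = 1 := by
      simp only [μ]
      rw [max_eq_right] <;> simp [hv₁ x]
    change r (0, x) = _
    simp [r, h, v]
  · change r (t, x) = _
    simp [r, hμbd t x hx, v]

theorem continuous_finCons {n : ℕ} :
    Continuous fun q : I × (Fin n → I) => (Fin.cons q.1 q.2 : Fin (n + 1) → I) := by
  refine continuous_pi fun i => ?_
  refine Fin.cases ?_ (fun i => ?_) i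
  · simpa using continuous_fst
  · simp only [Fin.cons_succ]
    fun_prop

/-- An injective map into which all maps of cubes can be compressed is a weak homotopy
equivalence. -/
theorem isWeakHomotopyEquiv_of_compression {M F : Type*} [TopologicalSpace M] [TopologicalSpace F]
    {m : C(M, F)} (hm : Function.Injective m)
    (H : ∀ (n : ℕ) (β : C(Fin n → I, F)), (∀ x ∈ Cube.boundary (Fin n), β x ∈ Set.range m) →
      ∃ g : C(Fin n → I, M), β.HomotopicRel (m.comp g) (Cube.boundary (Fin n))) :
    IsWeakHomotopyEquiv m := by
  refine ⟨⟨?_, ?_⟩, fun n x _ => ⟨?_, ?_⟩⟩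
  · rintro ⟨x⟩ ⟨y⟩ h
    obtain ⟨p⟩ : Joined (m x) (m y) := Quotient.exact h
    -- A path between image points is a map of the `1`-cube with boundary in the image. As `m` is
    -- injective, the end points of the compressed path are `x` and `y`.
    obtain ⟨g, ⟨G⟩⟩ := H 1 (p.toContinuousMap.comp ⟨fun y => y 0, by fun_prop⟩) (by
      rintro z ⟨i, hi⟩
      obtain rfl := Subsingleton.elim i 0
      rcases hi with hi | hi
      · exact ⟨x, by simp [hi]⟩
      · exact ⟨y, by simp [hi]⟩)
    have hG : ∀ z ∈ Cube.boundary (Fin 1), m (g z) = p (z 0) := fun z hz => by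
      have h₂ := G.eq_fst 1 hz
      rw [G.apply_one] at h₂
      simpa using h₂
    refine Quotient.sound ⟨⟨⟨fun t => g fun _ => t, by fun_prop⟩, hm ?_, hm ?_⟩⟩
    · exact (hG _ ⟨0, Or.inl rfl⟩).trans p.source
    · exact (hG _ ⟨0, Or.inr rfl⟩).trans p.target
  · rintro ⟨y⟩
    -- The `0`-cube has empty boundary, so compression just joins `y` to the image.
    obtain ⟨g, ⟨G⟩⟩ := H 0 (ContinuousMap.const _ y) (by
      rintro z ⟨i, -⟩
      exact i.elim0)
    refine ⟨Quotient.mk _ (g 0), Quotient.sound (Joined.symm ⟨⟨⟨fun t => G (t, 0), by fun_prop⟩,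
      ?_, ?_⟩⟩)⟩
    · simp
    · simp
  · rintro ⟨γ⟩ ⟨γ'⟩ h
    obtain ⟨G⟩ : (m.comp γ.1).HomotopicRel (m.comp γ'.1) (Cube.boundary (Fin n)) :=
      Quotient.exact h
    -- A homotopy of loops is a map of the cube of dimension `n + 1`, with the time as first
    -- coordinate; its boundary values come from `γ`, `γ'` and the base point.
    obtain ⟨g, ⟨K⟩⟩ := H (n + 1) (G.toContinuousMap.comp
        ⟨fun y : Fin (n + 1) → I => (y 0, Fin.tail y), by unfold Fin.tail; fun_prop⟩) (by
      rintro z ⟨i, hi⟩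
      revert hi
      refine Fin.cases ?_ (fun i => ?_) i
      · rintro (hi | hi)
        · exact ⟨γ.1 (Fin.tail z), by simp [hi]⟩
        · exact ⟨γ'.1 (Fin.tail z), by simp [hi]⟩
      · intro hi
        exact ⟨γ.1 (Fin.tail z), (G.eq_fst (z 0) ⟨i, hi⟩).symm⟩)
    have hK : ∀ z ∈ Cube.boundary (Fin (n + 1)), m (g z) = G (z 0, Fin.tail z) := fun z hz => by
      have h₂ := K.eq_fst 1 hz
      rw [K.apply_one] at h₂
      simpa using h₂
    refine Quotient.sound ⟨⟨⟨⟨fun q => g (Fin.cons q.1 q.2), g.continuous.comp continuous_finCons⟩,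
      fun y => hm ?_, fun y => hm ?_⟩, fun t y hy => hm ?_⟩⟩
    · change m (g (Fin.cons 0 y)) = m (γ.1 y)
      rw [hK _ ⟨0, Or.inl rfl⟩]
      simp
    · change m (g (Fin.cons 1 y)) = m (γ'.1 y)
      rw [hK _ ⟨0, Or.inr rfl⟩]
      simp
    · obtain ⟨i, hi⟩ := hy
      change m (g (Fin.cons t y)) = m (γ.1 y)
      rw [hK _ ⟨i.succ, by simpa using hi⟩]
      simpa using G.eq_fst t ⟨i, hi⟩
  · rintro ⟨γ⟩
    obtain ⟨g, ⟨K⟩⟩ := H n γ.1 fun z hz => ⟨x, (γ.2 z hz).symm⟩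
    refine ⟨Quotient.mk _ ⟨g, fun z hz => hm ?_⟩, Quotient.sound ?_⟩
    · have h₂ := K.eq_fst 1 hz
      rw [K.apply_one] at h₂
      exact h₂.trans (γ.2 z hz)
    · exact ContinuousMap.HomotopicRel.symm ⟨K⟩

end Cube

/-! ### Functions that are equal to `Q` from a level on -/

section StandardFrom

variable {k : ℕ}

/-- `f` is equal to `Q` on a neighbourhood `{Q > b - ε}` of `{Q ≥ b}` and less than `b` on
`{Q < b}`. -/
def IsStandardFrom (f : E2 k → ℝ) (b : ℝ) : Prop :=
  (∃ ε > 0, ∀ z, b - ε < Q k z → f z = Q k z) ∧ ∀ z, Q k z < b → f z < b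

theorem IsStandardAbove.isStandardFrom {f : E2 k → ℝ} {a b : ℝ} (h : IsStandardAbove f a)
    (hab : a < b) : IsStandardFrom f b := by
  refine ⟨⟨b - a, by linarith, fun z hz => h.1 z (by linarith)⟩, fun z hz => ?_⟩
  rcases le_total (Q k z) a with h₁ | h₁
  · linarith [h.2 z h₁]
  · rwa [h.1 z h₁]

theorem IsStandardFrom.mono {f : E2 k → ℝ} {b b' : ℝ} (h : IsStandardFrom f b) (hb : b ≤ b') :
    IsStandardFrom f b' := by
  obtain ⟨⟨ε, hε, h₁⟩, h₂⟩ := h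
  refine ⟨⟨ε, hε, fun z hz => h₁ z (by linarith)⟩, fun z hz => ?_⟩
  rcases lt_or_ge (Q k z) b with h₃ | h₃
  · linarith [h₂ z h₃]
  · rwa [h₁ z (by linarith)]

theorem isStandardFrom_Q (b : ℝ) : IsStandardFrom (Q k) b :=
  ⟨⟨1, one_pos, fun _ _ => rfl⟩, fun _ h => h⟩

theorem IsStandardFrom.lerp {f g : E2 k → ℝ} {b t : ℝ} (hf : IsStandardFrom f b)
    (hg : IsStandardFrom g b) (ht : t ∈ Set.Icc (0 : ℝ) 1) :
    IsStandardFrom (fun z => (1 - t) * f z + t * g z) b := by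
  obtain ⟨⟨ε, hε, h₁⟩, h₂⟩ := hf
  obtain ⟨⟨ε', hε', h₁'⟩, h₂'⟩ := hg
  refine ⟨⟨min ε ε', lt_min hε hε', fun z hz => ?_⟩, fun z hz => ?_⟩
  · simp only [h₁ z (by linarith [min_le_left ε ε']), h₁' z (by linarith [min_le_right ε ε'])]
    ring
  · have h₃ := h₂ z hz
    have h₄ := h₂' z hz
    simp only
    rcases ht.1.eq_or_lt with h | h
    · rw [← h]
      linarith
    · nlinarith [ht.2]

/-- Where `Q` is positive, passing from `z` to `c⁻¹ z` can only increase it, so `c⁻¹ z` stays in the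
region where `f = Q`. The collar is restricted to width `b` to keep `Q` positive on it. -/
theorem IsStandardFrom.shrink {f : CInf k} {b : ℝ} (h : IsStandardFrom f.toFun b) (hb : 0 < b)
    (c : Set.Ioc (0 : ℝ) 1) : IsStandardFrom (f.shrink c).toFun b := by
  obtain ⟨⟨ε, hε, h₁⟩, h₂⟩ := h
  have hc := c.2.1
  have hc2 : (0 : ℝ) < (c : ℝ) ^ 2 := by positivity
  have hc1 : (c : ℝ) ^ 2 ≤ 1 := pow_le_one₀ hc.le c.2.2
  have hQ : ∀ z, Q k z = (c : ℝ) ^ 2 * Q k ((c : ℝ)⁻¹ • z) := fun z => by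
    rw [Q_smul]
    field_simp
  have hs : ∀ z, b - ε < Q k ((c : ℝ)⁻¹ • z) → (f.shrink c).toFun z = Q k z := fun z hz => by
    rw [CInf.shrink_apply, h₁ _ hz, hQ z]
  refine ⟨⟨min ε b, lt_min hε hb, fun z hz => hs z ?_⟩, fun z hz => ?_⟩
  · have h₃ : 0 < Q k z := by linarith [min_le_right ε b]
    have h₄ : Q k z ≤ Q k ((c : ℝ)⁻¹ • z) := by
      have h₅ : 0 < Q k ((c : ℝ)⁻¹ • z) := by
        rw [hQ] at h₃
        exact pos_of_mul_pos_right h₃ hc2.le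
      rw [hQ z]
      exact mul_le_of_le_one_left h₅.le hc1
    linarith [min_le_left ε b]
  · rcases lt_or_ge (Q k ((c : ℝ)⁻¹ • z)) b with h₃ | h₃
    · have := h₂ _ h₃
      rw [CInf.shrink_apply]
      nlinarith
    · rwa [hs z (by linarith)]

theorem IsStandardFrom.lt_iff {f : E2 k → ℝ} {b : ℝ} (h : IsStandardFrom f b) (z : E2 k) :
    f z < b ↔ Q k z < b := by
  obtain ⟨⟨ε, hε, h₁⟩, h₂⟩ := h
  refine ⟨fun hz => ?_, h₂ z⟩
  by_contra! h₃
  rw [h₁ z (by linarith)] at hz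
  linarith

theorem IsStandardFrom.agreesAtLevel {f : E2 k → ℝ} {b : ℝ} (h : IsStandardFrom f b) :
    AgreesAtLevel f b := by
  have hlt := h.lt_iff
  obtain ⟨⟨ε, hε, h₁⟩, h₂⟩ := h
  refine AgreesAtLevel.of_eps hε (fun z hz => h₁ z ?_) hlt fun z => ?_
  · rw [abs_lt] at hz
    linarith
  · rcases lt_or_ge (Q k z) b with h₃ | h₃
    · exact ⟨fun h => by linarith [h₂ z h₃], fun h => by linarith⟩
    · rw [h₁ z (by linarith)]

theorem IsStandardFrom.mem_spaceM {f : CInf k} {b b' : ℝ} (h : IsStandardFrom f.toFun b)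
    (hU : (f, b) ∈ spaceU k) (hb' : b' ∈ Set.Ioo (0 : ℝ) 1) : (f, b') ∈ spaceM k := by
  have hlt := h.lt_iff
  obtain ⟨⟨ε, hε, h₁⟩, h₂⟩ := h
  have hb : 0 < b := hU.1.1.1
  refine mem_spaceM_of_spaceU hU (ε := min ε (b / 2)) (lt_min hε (by linarith)) ?_
    (fun z hz => h₁ z ?_) hlt hb'
  · linarith [min_le_right ε (b / 2)]
  · linarith [min_le_left ε (b / 2)]

end StandardFrom

/-! ### The null-homotopy -/

section NullHomotopy

variable {k : ℕ}

theorem clamp_mem (s : ℝ) : clamp s ∈ Set.Icc (0 : ℝ) 1 :=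
  ⟨le_max_left _ _, max_le zero_le_one (min_le_right _ _)⟩

theorem continuous_clamp : Continuous clamp := by
  unfold clamp
  fun_prop

theorem clamp_of_nonpos {s : ℝ} (h : s ≤ 0) : clamp s = 0 :=
  max_eq_left ((min_le_left _ _).trans h)

theorem clamp_of_one_le {s : ℝ} (h : 1 ≤ s) : clamp s = 1 := by
  rw [clamp, min_eq_right h, max_eq_right zero_le_one]

theorem one_sub_add_mul_mem_Ioc {s a : ℝ} (hs : s ∈ Set.Icc (0 : ℝ) 1) (ha : a ∈ Set.Ioc (0 : ℝ) 1) :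
    (1 - s) + s * a ∈ Set.Ioc (0 : ℝ) 1 := by
  obtain ⟨h₀, h₁⟩ := hs
  obtain ⟨h₂, h₃⟩ := ha
  refine ⟨?_, by nlinarith⟩
  rcases h₁.eq_or_lt with h | h
  · rw [h]
    linarith
  · nlinarith

theorem lerp_mem_Ioo {s a b : ℝ} (hs : s ∈ Set.Icc (0 : ℝ) 1) (ha : a ∈ Set.Ioo (0 : ℝ) 1)
    (hb : b ∈ Set.Ioo (0 : ℝ) 1) : (1 - s) * a + s * b ∈ Set.Ioo (0 : ℝ) 1 :=
  convex_Ioo (0 : ℝ) 1 ha hb (by linarith [hs.2]) hs.1 (by ring)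

/-- The function at time `t` of the null-homotopy. -/
noncomputable def nullCInf (t : ℝ) (p : spaceM k) : CInf k :=
  CInf.lerp (clamp (3 * t - 1))
    (p.1.1.shrink ⟨_, one_sub_add_mul_mem_Ioc (clamp_mem (3 * t)) ⟨p.2.1.1, p.2.1.2.le⟩⟩)
    (CInf.ofQ k)

theorem nullCInf_toFun (t : ℝ) (p : spaceM k) :
    (nullCInf t p).toFun = nullFun t p.1.1.toFun p.1.2 := rfl

theorem continuous_nullCInf : Continuous fun q : ℝ × spaceM k => nullCInf q.1 q.2 := by
  have := continuous_clamp
  refine CInf.continuous_lerp (by fun_prop) (CInf.continuous_shrink ?_ (by fun_prop))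
    continuous_const
  exact Continuous.subtype_mk (by fun_prop) _

theorem continuous_nullLevel : Continuous fun q : ℝ × ℝ => nullLevel q.1 q.2 := by
  have := continuous_clamp
  unfold nullLevel
  fun_prop

theorem nullCInf_zero (p : spaceM k) : nullCInf 0 p = p.1.1 := by
  refine CInf.ext fun z => ?_
  rw [nullCInf_toFun]
  simp [nullFun, shrink, clamp]

theorem nullCInf_of_le {t : ℝ} (ht : 2 / 3 ≤ t) (p : spaceM k) : nullCInf t p = CInf.ofQ k := by
  rw [nullCInf, clamp_of_one_le (by linarith), CInf.lerp_one]

theorem nullLevel_zero (b : ℝ) : nullLevel 0 b = b := by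
  simp [nullLevel, clamp]

theorem nullLevel_one (b : ℝ) : nullLevel 1 b = 1 / 2 := by
  rw [nullLevel, clamp_of_one_le (by norm_num)]
  ring

theorem nullLevel_half (t : ℝ) : nullLevel t (1 / 2) = 1 / 2 := by
  rw [nullLevel]
  ring

/-- In the first third the path stays in `M_k`. In the second, `f_b` is standard above `b² < b`, so
its interpolation with `Q` keeps the level set of `Q`. In the last, the function is `Q` and the
level stays in `(0, 1)`. -/
theorem null_mem_spaceH (t : ℝ) (p : spaceM k) :
    (nullCInf t p, nullLevel t p.1.2) ∈ spaceH k := by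
  have hb : p.1.2 ∈ Set.Ioo (0 : ℝ) 1 := p.2.1
  rcases le_total (2 / 3) t with h | h
  · rw [nullCInf_of_le h]
    exact Q_mem_spaceH k (lerp_mem_Ioo (clamp_mem _) hb (by norm_num))
  · have hl : nullLevel t p.1.2 = p.1.2 := by
      rw [nullLevel, clamp_of_nonpos (by linarith)]
      ring
    rw [hl]
    rcases le_total t (1 / 3) with h₁ | h₁
    · rw [nullCInf, clamp_of_nonpos (show 3 * t - 1 ≤ 0 by linarith), CInf.lerp_zero]
      exact spaceM_subset_spaceH k (shrink_mem_spaceM p.2 _ hb)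
    · refine AgreesAtLevel.mem_spaceH (IsStandardFrom.agreesAtLevel ?_) hb
      refine IsStandardFrom.lerp ?_ (isStandardFrom_Q _) (clamp_mem _)
      refine (isStandardAbove_shrink p.2 _).isStandardFrom ?_
      simp only [clamp_of_one_le (show 1 ≤ 3 * t by linarith), sub_self, zero_add, one_mul]
      nlinarith [hb.1, hb.2]

/-- The null-homotopy of the inclusion of `M_k` into `H_k`. -/
noncomputable def nullHomotopy (k : ℕ) :
    ((inclusionMap (spaceU_subset_spaceH k)).comp (inclusionMap (spaceM_subset_spaceU k))).Homotopy
      (ContinuousMap.const (spaceM k) (basePoint k)) where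
  toFun q := ⟨(nullCInf q.1 q.2, nullLevel q.1 q.2.1.2), null_mem_spaceH _ _⟩
  continuous_toFun := by
    refine Continuous.subtype_mk (Continuous.prodMk ?_ ?_) _
    · exact continuous_nullCInf.comp (f := fun q : I × spaceM k => ((q.1 : ℝ), q.2)) (by fun_prop)
    · exact continuous_nullLevel.comp (f := fun q : I × spaceM k => ((q.1 : ℝ), q.2.1.2))
        (by fun_prop)
  map_zero_left p := Subtype.ext (Prod.ext (nullCInf_zero p) (nullLevel_zero _))
  map_one_left p := Subtype.ext (Prod.ext (nullCInf_of_le (by norm_num) p) (nullLevel_one _))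

end NullHomotopy

/-! ### The fibre with free end level, and its retraction onto the homotopy fibre -/

section FreeFibre

/-- Points of `U_k` with a path in `H_k` to some `(Q, e)`. -/
abbrev FreeFibre (k : ℕ) : Type :=
  {q : spaceU k × C(I, spaceH k) //
    q.2 0 = inclusionMap (spaceU_subset_spaceH k) q.1 ∧ (q.2 1).1.1 = CInf.ofQ k}

variable {k : ℕ} {X : Type*} [TopologicalSpace X]

/-- The path in `C^∞_k × ℝ` of a point of the free fibre. -/
noncomputable def FreeFibre.path (q : FreeFibre k) (t : I) : CInf k × ℝ := (q.1.2 t).1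

theorem FreeFibre.path_mem (q : FreeFibre k) (t : I) : q.path t ∈ spaceH k := (q.1.2 t).2

theorem FreeFibre.path_zero_mem (q : FreeFibre k) : q.path 0 ∈ spaceU k := by
  have h : q.path 0 = q.1.1.1 := congrArg Subtype.val q.2.1
  rw [h]
  exact q.1.1.2

theorem FreeFibre.path_one (q : FreeFibre k) : (q.path 1).1 = CInf.ofQ k := q.2.2

theorem FreeFibre.ext {q q' : FreeFibre k} (h : ∀ t, q.path t = q'.path t) : q = q' := by
  have h₁ : q.1.2 = q'.1.2 := ContinuousMap.ext fun t => Subtype.ext (h t)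
  refine Subtype.ext (Prod.ext (Subtype.ext ?_) h₁)
  have h₂ : q.path 0 = q.1.1.1 := congrArg Subtype.val q.2.1
  have h₃ : q'.path 0 = q'.1.1.1 := congrArg Subtype.val q'.2.1
  rw [← h₂, ← h₃, h]

theorem FreeFibre.continuous_path : Continuous fun q : FreeFibre k × I => q.1.path q.2 := by
  unfold FreeFibre.path
  fun_prop

/-- The map to the free fibre given by a continuous family of paths. -/
noncomputable def FreeFibre.ofFamily (f : X × I → CInf k × ℝ) (hf : Continuous f) (hH : ∀ p, f p ∈ spaceH k)
    (hU : ∀ x, f (x, 0) ∈ spaceU k) (h₁ : ∀ x, (f (x, 1)).1 = CInf.ofQ k) : C(X, FreeFibre k) where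
  toFun x := ⟨(⟨f (x, 0), hU x⟩,
    (⟨fun p => ⟨f p, hH p⟩, hf.subtype_mk _⟩ : C(X × I, spaceH k)).curry x), rfl, h₁ x⟩
  continuous_toFun := by
    refine Continuous.subtype_mk (Continuous.prodMk ?_ ?_) _
    · exact Continuous.subtype_mk (by fun_prop) _
    · fun_prop

@[simp]
theorem FreeFibre.ofFamily_path (f : X × I → CInf k × ℝ) (hf : Continuous f)
    (hH : ∀ p, f p ∈ spaceH k) (hU : ∀ x, f (x, 0) ∈ spaceU k)
    (h₁ : ∀ x, (f (x, 1)).1 = CInf.ofQ k) (x : X) (t : I) :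
    (FreeFibre.ofFamily f hf hH hU h₁ x).path t = f (x, t) := rfl

/-- A homotopy of maps to the free fibre given by a continuous family of paths. -/
theorem FreeFibre.homotopicRel {B : Set X} {β β' : C(X, FreeFibre k)}
    (f : (I × X) × I → CInf k × ℝ) (hf : Continuous f) (hH : ∀ p, f p ∈ spaceH k)
    (hU : ∀ q, f (q, 0) ∈ spaceU k) (h₁ : ∀ q, (f (q, 1)).1 = CInf.ofQ k)
    (hβ : ∀ x t, f ((0, x), t) = (β x).path t) (hβ' : ∀ x t, f ((1, x), t) = (β' x).path t)
    (hB : ∀ s, ∀ x ∈ B, ∀ t, f ((s, x), t) = (β x).path t) : β.HomotopicRel β' B := by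
  refine ⟨⟨⟨FreeFibre.ofFamily f hf hH hU h₁, fun x => FreeFibre.ext fun t => ?_,
    fun x => FreeFibre.ext fun t => ?_⟩, fun s x hx => FreeFibre.ext fun t => ?_⟩⟩
  · exact hβ x t
  · exact hβ' x t
  · exact hB s x hx t

/-- The inclusion of the homotopy fibre into the free fibre. -/
noncomputable def FreeFibre.ofHomotopyFibre (k : ℕ) :
    C(HomotopyFibre (inclusionMap (spaceU_subset_spaceH k)) (basePoint k), FreeFibre k) where
  toFun q := ⟨q.1, q.2.1, by rw [q.2.2]; rfl⟩
  continuous_toFun := by fun_prop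

/-- The motion of the level that is appended to a path to `(Q, 1/2 - δ)`. -/
noncomputable def levelMotion (t δ : ℝ) : ℝ := max 0 (δ - (1 - t)) + min 0 (δ + (1 - t))

theorem levelMotion_of_le {t δ : ℝ} (h : |δ| ≤ 1 - t) : levelMotion t δ = 0 := by
  rw [abs_le] at h
  rw [levelMotion, max_eq_left (by linarith), min_eq_left (by linarith), add_zero]

theorem levelMotion_one (δ : ℝ) : levelMotion 1 δ = δ := by
  rw [levelMotion, sub_self, sub_zero, add_zero]
  rcases le_total 0 δ with h | h
  · rw [max_eq_right h, min_eq_left h, add_zero]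
  · rw [max_eq_left h, min_eq_right h, zero_add]

theorem levelMotion_mem {t δ e : ℝ} (ht : t ≤ 1) (he : e ∈ Set.Ioo (0 : ℝ) 1)
    (hδ : e + δ ∈ Set.Ioo (0 : ℝ) 1) : e + levelMotion t δ ∈ Set.Ioo (0 : ℝ) 1 := by
  obtain ⟨h₁, h₂⟩ := he
  obtain ⟨h₃, h₄⟩ := hδ
  rw [levelMotion]
  rcases max_cases 0 (δ - (1 - t)) with h | h <;> rcases min_cases 0 (δ + (1 - t)) with h' | h' <;>
    constructor <;> linarith

theorem FreeFibre.level_mem (q : FreeFibre k) (t : I) : (q.path t).2 ∈ Set.Ioo (0 : ℝ) 1 :=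
  (q.path_mem t).1

theorem FreeFibre.abs_lt_half (q : FreeFibre k) : |1 / 2 - (q.path 1).2| < 1 / 2 := by
  have := q.level_mem 1
  rw [abs_lt]
  constructor <;> linarith [this.1, this.2]

/-- The path that runs along a path of the free fibre and then moves the level to `1/2`. -/
noncomputable def FreeFibre.extendPath (p : FreeFibre k × I) : CInf k × ℝ :=
  -- The given path is run during `[0, 1 - |δ|]`, a nondegenerate interval since `|δ| < 1/2`, and
  -- the level then moves by `δ` with unit speed. For `δ = 0` nothing changes, so points of the
  -- homotopy fibre are fixed.
  let δ := 1 / 2 - (p.1.path 1).2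
  let γ := p.1.path (Set.projIcc 0 1 zero_le_one ((p.2 : ℝ) / (1 - |δ|)))
  (γ.1, γ.2 + levelMotion p.2 δ)

theorem FreeFibre.continuous_extendPath :
    Continuous (FreeFibre.extendPath : FreeFibre k × I → CInf k × ℝ) := by
  have h₁ : Continuous fun p : FreeFibre k × I => 1 / 2 - (p.1.path 1).2 := by
    have := FreeFibre.continuous_path.comp (f := fun p : FreeFibre k × I => (p.1, (1 : I)))
      (by fun_prop)
    exact continuous_const.sub this.snd
  have h₂ : ∀ p : FreeFibre k × I, 1 - |1 / 2 - (p.1.path 1).2| ≠ 0 := fun p => by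
    linarith [p.1.abs_lt_half]
  have h₃ : Continuous fun p : FreeFibre k × I => p.1.path
      (Set.projIcc 0 1 zero_le_one ((p.2 : ℝ) / (1 - |1 / 2 - (p.1.path 1).2|))) := by
    refine FreeFibre.continuous_path.comp (f := fun p : FreeFibre k × I => (p.1,
      Set.projIcc 0 1 zero_le_one ((p.2 : ℝ) / (1 - |1 / 2 - (p.1.path 1).2|))))
      (continuous_fst.prodMk (continuous_projIcc.comp ?_))
    exact Continuous.div (by fun_prop) (by fun_prop) h₂
  unfold FreeFibre.extendPath levelMotion
  simp only
  fun_prop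

theorem FreeFibre.extendPath_of_le {q : FreeFibre k} {t : I}
    (h : 1 - |1 / 2 - (q.path 1).2| ≤ t) :
    FreeFibre.extendPath (q, t) =
      (CInf.ofQ k, (q.path 1).2 + levelMotion t (1 / 2 - (q.path 1).2)) := by
  have h₁ : Set.projIcc (0 : ℝ) 1 zero_le_one ((t : ℝ) / (1 - |1 / 2 - (q.path 1).2|)) = 1 := by
    refine Set.projIcc_of_right_le _ ?_
    rwa [le_div_iff₀ (by linarith [q.abs_lt_half]), one_mul]
  simp only [FreeFibre.extendPath, h₁, q.path_one]

theorem FreeFibre.extendPath_mem (q : FreeFibre k) (t : I) :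
    FreeFibre.extendPath (q, t) ∈ spaceH k := by
  rcases le_total (1 - |1 / 2 - (q.path 1).2|) t with h | h
  · rw [FreeFibre.extendPath_of_le h]
    exact Q_mem_spaceH k (levelMotion_mem t.2.2 (q.level_mem 1) (by norm_num))
  · simp only [FreeFibre.extendPath]
    rw [levelMotion_of_le (by linarith), add_zero]
    exact q.path_mem _

/-- The retraction of the free fibre onto the homotopy fibre. -/
noncomputable def FreeFibre.retraction (k : ℕ) :
    C(FreeFibre k, HomotopyFibre (inclusionMap (spaceU_subset_spaceH k)) (basePoint k)) where
  toFun q := ⟨(q.1.1, (⟨fun p => ⟨FreeFibre.extendPath p, FreeFibre.extendPath_mem p.1 p.2⟩,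
      FreeFibre.continuous_extendPath.subtype_mk _⟩ : C(FreeFibre k × I, spaceH k)).curry q), by
    rw [← q.2.1]
    refine Subtype.ext ?_
    change FreeFibre.extendPath (q, 0) = q.path 0
    have h := q.abs_lt_half
    simp only [FreeFibre.extendPath]
    rw [levelMotion_of_le (by rw [Set.Icc.coe_zero]; linarith), add_zero]
    simp, by
    refine Subtype.ext ?_
    change FreeFibre.extendPath (q, 1) = (CInf.ofQ k, 1 / 2)
    rw [FreeFibre.extendPath_of_le (by rw [Set.Icc.coe_one]; linarith [abs_nonneg (1 / 2 - (q.path 1).2)])]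
    rw [Set.Icc.coe_one, levelMotion_one]
    norm_num⟩
  continuous_toFun := by fun_prop

theorem FreeFibre.retraction_ofHomotopyFibre
    (q : HomotopyFibre (inclusionMap (spaceU_subset_spaceH k)) (basePoint k)) :
    FreeFibre.retraction k (FreeFibre.ofHomotopyFibre k q) = q := by
  refine Subtype.ext (Prod.ext rfl (ContinuousMap.ext fun t => Subtype.ext ?_))
  change FreeFibre.extendPath (FreeFibre.ofHomotopyFibre k q, t) = (q.1.2 t).1
  have h : ((FreeFibre.ofHomotopyFibre k q).path 1).2 = 1 / 2 := by
    change (q.1.2 1).1.2 = 1 / 2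
    rw [q.2.2]
    rfl
  simp only [FreeFibre.extendPath, h, sub_self, abs_zero, sub_zero, div_one]
  rw [levelMotion_of_le (by simpa using t.2.2), add_zero, Set.projIcc_val]
  rfl

end FreeFibre

/-! ### Comparing the null-homotopy with linear paths -/

section Comparison

variable {k : ℕ}

/-- The map from `M_k` to the free fibre determined by the null-homotopy. -/
noncomputable def toFreeFibre (k : ℕ) : C(spaceM k, FreeFibre k) :=
  (FreeFibre.ofHomotopyFibre k).comp (toHomotopyFibre (inclusionMap (spaceM_subset_spaceU k))
    (inclusionMap (spaceU_subset_spaceH k)) (nullHomotopy k))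

theorem toFreeFibre_path (p : spaceM k) (t : I) :
    (toFreeFibre k p).path t = (nullCInf t p, nullLevel t p.1.2) := rfl

/-- The starting point of the path recovers the point of `M_k`. -/
theorem isEmbedding_toFreeFibre (k : ℕ) : Topology.IsEmbedding (toFreeFibre k) := by
  refine Topology.IsEmbedding.of_comp (g := fun q : FreeFibre k => q.1.1.1)
    (toFreeFibre k).continuous (by fun_prop) ?_
  exact Topology.IsEmbedding.subtypeVal

/-- The deformation of `M_k` that shrinks by `1/2` and moves the level to `1/2`. -/
noncomputable def shrinkDeformation (k : ℕ) : C(I × spaceM k, spaceM k) where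
  toFun q := ⟨(q.2.1.1.shrink ⟨_, one_sub_add_mul_mem_Ioc q.1.2
      (show (1 / 2 : ℝ) ∈ Set.Ioc (0 : ℝ) 1 by norm_num)⟩,
    (1 - (q.1 : ℝ)) * q.2.1.2 + q.1 * (1 / 2)),
    shrink_mem_spaceM q.2.2 _ (lerp_mem_Ioo q.1.2 q.2.2.1 (by norm_num))⟩
  continuous_toFun := by
    refine Continuous.subtype_mk (Continuous.prodMk (CInf.continuous_shrink ?_ (by fun_prop))
      (by fun_prop)) _
    exact Continuous.subtype_mk (by fun_prop) _

/-- The points `(f, 1/2)` of `M_k` such that `f` is standard above `1/4`. -/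
def quarterStandard (k : ℕ) : Set (spaceM k) :=
  {p | p.1.2 = 1 / 2 ∧ IsStandardAbove p.1.1.toFun (1 / 4)}

theorem shrinkDeformation_zero (p : spaceM k) : shrinkDeformation k (0, p) = p := by
  refine Subtype.ext (Prod.ext (CInf.ext fun z => ?_) ?_)
  · change (_ : ℝ) ^ 2 * _ = _
    simp
  · simp [shrinkDeformation]

theorem shrinkDeformation_one_mem (p : spaceM k) :
    shrinkDeformation k (1, p) ∈ quarterStandard k := by
  refine ⟨by simp [shrinkDeformation], ?_⟩
  have h : IsStandardAbove (shrinkDeformation k (1, p)).1.1.toFun _ :=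
    isStandardAbove_shrink p.2 ⟨_, one_sub_add_mul_mem_Ioc (1 : I).2
      (show (1 / 2 : ℝ) ∈ Set.Ioc (0 : ℝ) 1 by norm_num)⟩
  exact h.mono (by norm_num)

/-- The points `(f, 1/2)` of `M_k` such that `f` is standard from `1/2` on. -/
def HalfStandard (k : ℕ) : Type :=
  {p : spaceM k // p.1.2 = 1 / 2 ∧ IsStandardFrom p.1.1.toFun (1 / 2)}

noncomputable instance : TopologicalSpace (HalfStandard k) := instTopologicalSpaceSubtype

/-- The linear deformation of the path `t ↦ N (t, (f, 1/2))` to the linear path from `f` to `Q`. -/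
noncomputable def linearDeformation (k : ℕ) : C((I × HalfStandard k), FreeFibre k) :=
  FreeFibre.ofFamily (fun q => (CInf.lerp q.1.1 (nullCInf q.2 q.1.2.1)
    (CInf.lerp q.2 q.1.2.1.1.1 (CInf.ofQ k)), 1 / 2))
    (by
      have h₁ : Continuous fun q : (I × HalfStandard k) × I => q.1.2.1 :=
        continuous_subtype_val.comp (by fun_prop)
      refine Continuous.prodMk (CInf.continuous_lerp (by fun_prop) ?_
        (CInf.continuous_lerp (by fun_prop) (by fun_prop) continuous_const)) continuous_const
      exact continuous_nullCInf.comp (f := fun q : (I × HalfStandard k) × I =>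
        ((q.2 : ℝ), q.1.2.1)) (by fun_prop))
    (fun q => by
      have h := q.1.2.2.2
      refine AgreesAtLevel.mem_spaceH (IsStandardFrom.agreesAtLevel ?_) (by norm_num)
      exact ((h.shrink (by norm_num) _).lerp (isStandardFrom_Q _) (clamp_mem _)).lerp
        (h.lerp (isStandardFrom_Q _) q.2.2) q.1.1.2)
    (fun q => by
      simp only [Set.Icc.coe_zero, nullCInf_zero, CInf.lerp_zero, CInf.lerp_self]
      have h : (q.2.1.1.1, (1 / 2 : ℝ)) = q.2.1.1 := Prod.ext rfl q.2.2.1.symm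
      rw [h]
      exact spaceM_subset_spaceU k q.2.1.2)
    (fun q => by
      simp only [Set.Icc.coe_one, CInf.lerp_one, nullCInf_of_le (show (2 / 3 : ℝ) ≤ 1 by norm_num),
        CInf.lerp_self])

theorem linearDeformation_zero (p : HalfStandard k) :
    linearDeformation k (0, p) = toFreeFibre k p.1 := by
  refine FreeFibre.ext fun t => ?_
  rw [toFreeFibre_path, p.2.1, nullLevel_half]
  simp [linearDeformation]

theorem linearDeformation_one_path (p : HalfStandard k) (t : I) :
    (linearDeformation k (1, p)).path t = (CInf.lerp t p.1.1.1 (CInf.ofQ k), 1 / 2) := by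
  simp [linearDeformation]

theorem linearDeformation_one_injective :
    Function.Injective fun p : HalfStandard k => linearDeformation k (1, p) := by
  intro p p' h
  have h₁ := congrArg (fun q : FreeFibre k => (q.path 0).1) h
  simp only [linearDeformation_one_path, Set.Icc.coe_zero, CInf.lerp_zero] at h₁
  exact Subtype.ext (Subtype.ext (Prod.ext h₁ (p.2.1.trans p'.2.1.symm)))

end Comparison

/-! ### Normal forms of families of paths in the free fibre -/

section Normalization

variable {k : ℕ} {X : Type*} [TopologicalSpace X]

theorem FreeFibre.continuous_family (β : C(X, FreeFibre k)) :
    Continuous fun p : X × I => (β p.1).path p.2 :=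
  FreeFibre.continuous_path.comp (f := fun p : X × I => (β p.1, p.2)) (by fun_prop)

/-- The paths of a family can be shrunk such that their levels become constant and at most `1/2`. -/
theorem FreeFibre.exists_homotopicRel_constant_level {B : Set X} (β : C(X, FreeFibre k))
    (hB : ∀ x ∈ B, ∀ t, ((β x).path t).2 = 1 / 2) :
    ∃ (β' : C(X, FreeFibre k)) (b : X → ℝ), Continuous b ∧ (∀ x, b x ≤ 1 / 2) ∧
      (∀ x t, ((β' x).path t).2 = b x) ∧ β.HomotopicRel β' B := by
  have hβ := FreeFibre.continuous_family β
  have hK (x : X) : IsCompact ((fun t => ((β x).path t).2) '' Set.univ) := by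
    refine isCompact_univ.image ?_
    exact hβ.snd.comp (f := fun t : I => (x, t)) (by fun_prop)
  have hne (x : X) : ((fun t => ((β x).path t).2) '' Set.univ).Nonempty :=
    Set.univ_nonempty.image _
  -- Shrinking only lowers positive levels, so the target is the minimum along the path. The cap at
  -- `1/2` lets the level be raised to `1/2` at the end, and leaves paths of constant level `1/2`
  -- unchanged.
  let b : X → ℝ := fun x => min (1 / 2) (sInf ((fun t => ((β x).path t).2) '' Set.univ))
  have hb : Continuous b := by
    have : Continuous fun x => sInf ((fun t => ((β x).path t).2) '' Set.univ) :=
      isCompact_univ.continuous_sInf (f := fun (x : X) (t : I) => ((β x).path t).2) hβ.snd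
    fun_prop
  have hb_le : ∀ x t, b x ≤ ((β x).path t).2 := fun x t =>
    (min_le_right _ _).trans (csInf_le (hK x).bddBelow ⟨t, trivial, rfl⟩)
  have hb_pos : ∀ x, 0 < b x := fun x => by
    obtain ⟨t, -, ht⟩ := (hK x).sInf_mem (hne x)
    refine lt_min (by norm_num) ?_
    rw [← ht]
    exact ((β x).level_mem t).1
  have hbB : ∀ x ∈ B, b x = 1 / 2 := fun x hx => by
    obtain ⟨t, -, ht⟩ := (hK x).sInf_mem (hne x)
    simp only [b]
    rw [← ht]
    simp only [hB x hx, min_self]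
  -- A square root, since shrinking with factor `c` multiplies the level by `c²`.
  have hratio : ∀ x t, √(b x / ((β x).path t).2) ∈ Set.Ioc (0 : ℝ) 1 := fun x t =>
    ⟨Real.sqrt_pos.2 (div_pos (hb_pos x) ((β x).level_mem t).1),
      Real.sqrt_le_one.2 (div_le_one_of_le₀ (hb_le x t) ((β x).level_mem t).1.le)⟩
  let c : (I × X) × I → Set.Ioc (0 : ℝ) 1 := fun q =>
    ⟨_, one_sub_add_mul_mem_Ioc q.1.1.2 (hratio q.1.2 q.2)⟩
  have hβ' : Continuous fun q : (I × X) × I => (β q.1.2).path q.2 :=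
    hβ.comp (f := fun q : (I × X) × I => (q.1.2, q.2)) (by fun_prop)
  have hc : Continuous c := by
    refine Continuous.subtype_mk ?_ _
    have h₁ : Continuous fun q : (I × X) × I => √(b q.1.2 / ((β q.1.2).path q.2).2) :=
      Real.continuous_sqrt.comp (Continuous.div (by fun_prop) hβ'.snd
        fun q => ((β q.1.2).level_mem q.2).1.ne')
    fun_prop
  let f : (I × X) × I → CInf k × ℝ := fun q =>
    (((β q.1.2).path q.2).1.shrink (c q), (c q : ℝ) ^ 2 * ((β q.1.2).path q.2).2)
  have hf : Continuous f := by
    refine Continuous.prodMk (CInf.continuous_shrink hc hβ'.fst) ?_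
    have := hβ'.snd
    fun_prop
  have hfH : ∀ q, f q ∈ spaceH k := fun q => shrink_mem_spaceH ((β q.1.2).path_mem q.2) _
  have hfU : ∀ q, f (q, 0) ∈ spaceU k := fun q => shrink_mem_spaceU (β q.2).path_zero_mem _
  have hf₁ : ∀ q, (f (q, 1)).1 = CInf.ofQ k := fun q => by
    simp only [f, (β q.2).path_one, CInf.shrink_ofQ]
  have hcf : ∀ x t s, c ((s, x), t) = ⟨1, one_pos, le_rfl⟩ → f ((s, x), t) = (β x).path t := by
    intro x t s h
    refine Prod.ext ?_ ?_
    · simp only [f]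
      rw [h, CInf.shrink_one]
    · simp only [f]
      rw [h]
      simp
  refine ⟨FreeFibre.ofFamily (fun q : X × I => f ((1, q.1), q.2)) (by fun_prop) (fun q => hfH _)
    (fun x => hfU _) (fun x => hf₁ _), b, hb, fun x => min_le_left _ _, fun x t => ?_,
    FreeFibre.homotopicRel f hf hfH hfU hf₁ (fun x t => hcf x t 0 ?_) (fun x t => rfl)
    fun s x hx t => hcf x t s ?_⟩
  · have h₁ := ((β x).level_mem t).1
    simp only [FreeFibre.ofFamily_path, f, c, Set.Icc.coe_one, sub_self, one_mul, zero_add]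
    rw [Real.sq_sqrt (div_pos (hb_pos x) h₁).le, div_mul_cancel₀ _ h₁.ne']
  · exact Subtype.ext (by simp [c])
  · exact Subtype.ext (by simp [c, hbB x hx, hB x hx])

/-- The functions of a family of paths of constant level can be made to agree with `Q` near
the level. -/
theorem FreeFibre.exists_homotopicRel_agreesAtLevel [CompactSpace X] {B : Set X}
    (β : C(X, FreeFibre k)) {b : X → ℝ} (hb : Continuous b)
    (hβb : ∀ x t, ((β x).path t).2 = b x)
    (hB : ∀ x ∈ B, b x = 1 / 2 ∧ ∀ t, IsStandardAbove ((β x).path t).1.toFun (1 / 4)) :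
    ∃ β' : C(X, FreeFibre k), (∀ x t, ((β' x).path t).2 = b x) ∧
      (∃ ε > 0, ∀ x t z, |Q k z - b x| < ε → ((β' x).path t).1.toFun z = Q k z) ∧
      (∀ x t, AgreesAtLevel ((β' x).path t).1.toFun (b x)) ∧ β.HomotopicRel β' B := by
  have hβ := FreeFibre.continuous_family β
  have hmem : ∀ x t, (((β x).path t).1, b x) ∈ spaceH k := fun x t => by
    rw [← hβb x t]
    exact (β x).path_mem t
  obtain ⟨ε, hε, ψ, ψ', hψ, hψ₁, hψB⟩ := exists_isLevelLift
    (f := fun p : X × I => ((β p.1).path p.2).1) hβ.fst hb (fun x => (β x).path_one)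
    (fun x t => (hmem x t).2.1) (show (0 : ℝ) < 1 / 8 by norm_num)
  -- Over `B` the functions are at most `1/4` where `Q ≤ 1/4`, so values within `1/8` of `1/2` occur
  -- only where they all equal `Q`. Near the level the path is thus stationary, and the lift is the
  -- identity.
  have hψB' : ∀ x ∈ B, ∀ t z, ψ ((x, t), z) = z := by
    intro x hx
    obtain ⟨hb₁, hst⟩ := hB x hx
    refine hψB x fun s t z hz => ?_
    have h₁ : 1 / 4 ≤ Q k z := by
      by_contra! h
      have := (hst s).2 z h.le
      rw [hb₁, abs_lt] at hz
      linarith [hz.1]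
    rw [(hst s).1 z h₁, (hst t).1 z h₁]
  have hinv : ∀ y z, ψ (y, z) = z → ψ' (y, z) = z := fun y z h => by
    conv_lhs => rw [← h]
    exact hψ.left_inv y z
  -- At stage `s` the function at time `t` is `f_t ∘ ψ_t ∘ ψ_m⁻¹` with `m = max t s`. This is `f_t`
  -- for `s = 0`, and `f_t ∘ ψ_t` for `s = 1` since `ψ_1 = id`; at `t = 1` it remains `Q`
  -- throughout.
  let h : ((I × X) × I) × E2 k → ℝ := fun q => ((β q.1.1.2).path q.1.2).1.toFun
    (ψ ((q.1.1.2, q.1.2), ψ' ((q.1.1.2, max q.1.2 q.1.1.1), q.2)))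
  have hh : ∀ n, ParamContDiffOn n h Set.univ := by
    intro n
    have h₁ : ParamContDiffOn n (fun q : ((I × X) × I) × E2 k =>
        ψ' ((q.1.1.2, max q.1.2 q.1.1.1), q.2)) Set.univ :=
      (hψ.smooth' n).comp_fst (φ := fun p : (I × X) × I => (p.1.2, max p.2 p.1.1)) (by fun_prop)
    have h₂ : ParamContDiffOn n (fun q : ((I × X) × I) × E2 k =>
        ψ ((q.1.1.2, q.1.2), q.2)) Set.univ :=
      (hψ.smooth n).comp_fst (φ := fun p : (I × X) × I => (p.1.2, p.2)) (by fun_prop)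
    have h₃ : ParamContDiffOn n (fun q : ((I × X) × I) × E2 k =>
        ((β q.1.1.2).path q.1.2).1.toFun q.2) Set.univ :=
      (CInf.paramContDiffOn hβ.fst n).comp_fst (φ := fun p : (I × X) × I => (p.1.2, p.2))
        (by fun_prop)
    exact h₃.comp isOpen_univ (h₂.comp isOpen_univ h₁ fun _ _ => trivial) fun _ _ => trivial
  have hhQ : ∀ p, ∀ z ∉ setA k, h (p, z) = Q k z := by
    intro p z hz
    simp only [h]
    rw [hinv _ _ (hψ.eq_self _ z hz), hψ.eq_self _ z hz]
    exact CInf.eq_Q _ z hz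
  let F : (I × X) × I → CInf k := CInf.ofFamily h hh hhQ
  have hF : Continuous F := CInf.continuous_ofFamily h hh hhQ
  have hFv : ∀ s x t z, (F ((s, x), t)).toFun z = ((β x).path t).1.toFun
    (ψ ((x, t), ψ' ((x, max t s), z))) := fun _ _ _ _ => rfl
  have hsm : ∀ y, ContDiff ℝ ∞ fun z => ψ (y, z) := fun y => contDiff_infty.2 fun n => by
    simpa [contDiffOn_univ] using (hψ.smooth n).contDiffOn_slice isOpen_univ y
  have hsm' : ∀ y, ContDiff ℝ ∞ fun z => ψ' (y, z) := fun y => contDiff_infty.2 fun n => by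
    simpa [contDiffOn_univ] using (hψ.smooth' n).contDiffOn_slice isOpen_univ y
  have heq : ∀ x t z, ((β x).path t).1.toFun (ψ ((x, t), z)) = b x ↔ Q k z = b x := by
    intro x t z
    have h₁ := hψ.lt_iff (x, t) z
    have h₂ := hψ.gt_iff (x, t) z
    simp only at h₁ h₂
    rw [le_antisymm_iff, ← not_lt, ← not_lt, h₁, h₂, not_lt, not_lt, ← le_antisymm_iff]
  have hFH : ∀ s x t, (F ((s, x), t), b x) ∈ spaceH k := by
    intro s x t
    obtain ⟨hb₀, hreg, -⟩ := hmem x t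
    obtain ⟨-, -, hiso⟩ := hmem x (max t s)
    refine ⟨hb₀, fun z hz hcr => ?_, ?_⟩
    · have hcr' : IsCritical (fun z => ((β x).path t).1.toFun
          ((fun w => ψ ((x, t), ψ' ((x, max t s), w))) z)) z := hcr
      rw [isCritical_comp_iff (f := ((β x).path t).1.toFun)
        (φ := fun w => ψ ((x, t), ψ' ((x, max t s), w)))] at hcr'
      · exact hreg _ hz hcr'
      · exact (CInf.differentiable _).differentiableAt
      · exact (((hsm _).comp (hsm' _)).differentiable (by simp)).differentiableAt
      · refine isInvertible_fderiv_of_inverse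
          (φ' := fun w => ψ ((x, max t s), ψ' ((x, t), w)))
          (((hsm _).comp (hsm' _)).differentiable (by simp))
          (((hsm _).comp (hsm' _)).differentiable (by simp)) (fun z => ?_) z
        change ψ (_, ψ' (_, ψ (_, ψ' (_, z)))) = z
        rw [hψ.left_inv, hψ.right_inv]
    -- The level set is the image under `ψ_m` of that of `Q`, so it is the level set of the original
    -- path at time `m = max t s`.
    · convert hiso using 1
      ext z
      simp only [Set.mem_preimage, Set.mem_singleton_iff, hFv, heq]
      rw [← heq x (max t s), hψ.right_inv]
  have hFU : ∀ s x, (F ((s, x), 0), b x) ∈ spaceU k := by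
    intro s x
    have hU : (((β x).path 0).1, b x) ∈ spaceU k := by
      rw [← hβb x 0]
      exact (β x).path_zero_mem
    refine comp_mem_spaceU hU (hFH s x 0)
      (φ := fun w => ψ ((x, 0), ψ' ((x, max 0 s), w)))
      (φ' := fun w => ψ ((x, max 0 s), ψ' ((x, 0), w)))
      ((hsm _).comp (hsm' _)) ((hsm _).comp (hsm' _)) (fun z => ?_) (fun z => ?_) fun z => hFv s x 0 z
    · simp only [hψ.left_inv, hψ.right_inv]
    · simp only [hψ.left_inv, hψ.right_inv]
  have hF₁ : ∀ q : I × X, F (q, 1) = CInf.ofQ k := by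
    intro q
    refine CInf.ext fun z => ?_
    rw [hFv q.1 q.2 1 z, (β q.2).path_one, max_eq_left unitInterval.le_one', hψ₁, hinv _ _ (hψ₁ _ z)]
  have hF1s : ∀ x t z, (F ((1, x), t)).toFun z = ((β x).path t).1.toFun (ψ ((x, t), z)) := by
    intro x t z
    rw [hFv, max_eq_right unitInterval.le_one', hinv _ _ (hψ₁ _ z)]
  let f : (I × X) × I → CInf k × ℝ := fun q => (F q, b q.1.2)
  have hf : Continuous f := by fun_prop
  refine ⟨FreeFibre.ofFamily (fun q : X × I => f ((1, q.1), q.2)) (by fun_prop)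
    (fun q => hFH _ _ _) (fun x => hFU _ _) (fun x => hF₁ _), fun x t => rfl,
    ⟨ε, hε, fun x t z hz => ?_⟩, fun x t => ?_,
    FreeFibre.homotopicRel f hf (fun q => hFH _ _ _) (fun q => hFU _ _) hF₁ (fun x t => ?_)
      (fun x t => rfl) fun s x hx t => ?_⟩
  · exact (hF1s x t z).trans (hψ.eq_Q (x, t) z hz)
  · refine AgreesAtLevel.of_eps hε (fun z hz => ?_) (fun z => ?_) fun z => ?_
    · exact (hF1s x t z).trans (hψ.eq_Q (x, t) z hz)
    · change (F ((1, x), t)).toFun z < b x ↔ _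
      rw [hF1s]
      exact hψ.lt_iff (x, t) z
    · change b x < (F ((1, x), t)).toFun z ↔ _
      rw [hF1s]
      exact hψ.gt_iff (x, t) z
  · refine Prod.ext (CInf.ext fun z => ?_) (hβb x t).symm
    change (F ((0, x), t)).toFun z = _
    rw [hFv, max_eq_left unitInterval.nonneg', hψ.right_inv]
  · refine Prod.ext (CInf.ext fun z => ?_) (hβb x t).symm
    change (F ((s, x), t)).toFun z = _
    rw [hFv, hψB' x hx, hinv _ _ (hψB' x hx _ z)]

/-- Continuous families of functions that agree with `Q` near a level can be replaced by `Q` above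
the level. -/
theorem exists_replace_above {f : X → CInf k} (hf : Continuous f) {b : X → ℝ} (hb : Continuous b)
    {ε : ℝ} (hε : 0 < ε) (h : ∀ x z, |Q k z - b x| < ε → (f x).toFun z = Q k z) :
    ∃ g : X → CInf k, Continuous g ∧ (∀ x z, Q k z < b x + ε → (g x).toFun z = (f x).toFun z) ∧
      ∀ x z, b x - ε < Q k z → (g x).toFun z = Q k z := by
  classical
  -- On the band `|Q - b| < ε` both formulas agree, so the cut along the level does not harm
  -- smoothness.
  let G : X × E2 k → ℝ := fun q => if Q k q.2 < b q.1 then (f q.1).toFun q.2 else Q k q.2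
  have h₁ : ∀ x z, Q k z < b x + ε → G (x, z) = (f x).toFun z := by
    intro x z hz
    simp only [G]
    split_ifs with h'
    · rfl
    · refine (h x z ?_).symm
      rw [abs_lt]
      constructor <;> linarith
  have h₂ : ∀ x z, b x - ε < Q k z → G (x, z) = Q k z := by
    intro x z hz
    simp only [G]
    split_ifs with h'
    · refine h x z ?_
      rw [abs_lt]
      constructor <;> linarith
    · rfl
  have hQ : Continuous fun q : X × E2 k => Q k q.2 := (contDiff_Q k).continuous.comp continuous_snd
  have ho₁ : IsOpen {q : X × E2 k | Q k q.2 < b q.1 + ε} := isOpen_lt hQ (by fun_prop)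
  have ho₂ : IsOpen {q : X × E2 k | b q.1 - ε < Q k q.2} := isOpen_lt (by fun_prop) hQ
  have hG : ∀ n, ParamContDiffOn n G Set.univ := by
    intro n
    refine ParamContDiffOn.mono (ParamContDiffOn.union ho₁ ho₂
      (ParamContDiffOn.congr ho₁ ((CInf.paramContDiffOn hf n).mono (Set.subset_univ _))
        fun q hq => h₁ q.1 q.2 hq)
      (ParamContDiffOn.congr ho₂ (ParamContDiffOn.of_contDiff (contDiff_Q k))
        fun q hq => h₂ q.1 q.2 hq)) fun q _ => ?_
    rcases lt_or_ge (Q k q.2) (b q.1 + ε) with h' | h'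
    · exact Or.inl h'
    · exact Or.inr (show b q.1 - ε < Q k q.2 by linarith)
  have hGQ : ∀ x, ∀ z ∉ setA k, G (x, z) = Q k z := by
    intro x z hz
    simp only [G, (f x).eq_Q z hz, ite_self]
  exact ⟨CInf.ofFamily G hG hGQ, CInf.continuous_ofFamily G hG hGQ, h₁, h₂⟩

/-- Families of paths that agree with `Q` near their constant levels can be deformed to families of
linear paths. -/
theorem FreeFibre.exists_homotopicRel_linear {B : Set X} (β : C(X, FreeFibre k)) {b : X → ℝ}
    (hb : Continuous b) (hb₁ : ∀ x, b x ≤ 1 / 2) (hβb : ∀ x t, ((β x).path t).2 = b x)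
    {ε : ℝ} (hε : 0 < ε)
    (hβQ : ∀ x t z, |Q k z - b x| < ε → ((β x).path t).1.toFun z = Q k z)
    (hβa : ∀ x t, AgreesAtLevel ((β x).path t).1.toFun (b x))
    (hB : ∀ x ∈ B, ∃ p : HalfStandard k, β x = linearDeformation k (1, p)) :
    ∃ g : C(X, HalfStandard k), β.HomotopicRel
      ((linearDeformation k).comp (ContinuousMap.prodMk (ContinuousMap.const X 1) g)) B := by
  have hβ := FreeFibre.continuous_family β
  have hb₀ : ∀ x, b x ∈ Set.Ioo (0 : ℝ) 1 := fun x => hβb x 0 ▸ (β x).level_mem 0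
  have hU : ∀ x, (((β x).path 0).1, b x) ∈ spaceU k := fun x => by
    rw [← hβb x 0]
    exact (β x).path_zero_mem
  obtain ⟨g, hg, hg₁, hg₂⟩ := exists_replace_above
    (f := fun x => ((β x).path 0).1) (hβ.fst.comp (f := fun x : X => (x, (0 : I))) (by fun_prop))
    hb hε fun x z hz => hβQ x 0 z hz
  have hgs : ∀ x, IsStandardFrom (g x).toFun (b x) := fun x => by
    refine ⟨⟨ε, hε, hg₂ x⟩, fun z hz => ?_⟩
    rw [hg₁ x z (by linarith)]
    exact ((hβa x 0).lt_iff z).2 hz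
  have hgB : ∀ x ∈ B, b x = 1 / 2 ∧
      ∀ t : I, ((β x).path t).1 = CInf.lerp t (g x) (CInf.ofQ k) := by
    intro x hx
    obtain ⟨p, hp⟩ := hB x hx
    have h₁ : b x = 1 / 2 := by rw [← hβb x 0, hp, linearDeformation_one_path]
    -- Over `B` the starting function already equals `Q` above the level, so the replacement does
    -- not change it.
    have h₂ : g x = p.1.1.1 := by
      have h₃ : ((β x).path 0).1 = p.1.1.1 := by rw [hp, linearDeformation_one_path]; simp
      refine CInf.ext fun z => ?_
      rcases lt_or_ge (Q k z) (b x + ε) with h | h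
      · rw [hg₁ x z h, h₃]
      · rw [hg₂ x z (by linarith)]
        obtain ⟨⟨ε', hε', h₄⟩, -⟩ := p.2.2
        exact (h₄ z (by linarith)).symm
    refine ⟨h₁, fun t => ?_⟩
    rw [hp, linearDeformation_one_path, h₂]
  have hl : ∀ x (t : I), IsStandardFrom (CInf.lerp t (g x) (CInf.ofQ k)).toFun (b x) := fun x t =>
    (hgs x).lerp (isStandardFrom_Q _) t.2
  -- the straight line from the given path to the linear path
  let f₁ : (I × X) × I → CInf k × ℝ := fun q =>
    (CInf.lerp q.1.1 ((β q.1.2).path q.2).1 (CInf.lerp q.2 (g q.1.2) (CInf.ofQ k)), b q.1.2)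
  have hf₁ : Continuous f₁ := by
    have h₁ := hβ.fst.comp (f := fun q : (I × X) × I => (q.1.2, q.2)) (by fun_prop)
    exact Continuous.prodMk (CInf.continuous_lerp (by fun_prop) h₁
      (CInf.continuous_lerp (by fun_prop) (by fun_prop) continuous_const)) (by fun_prop)
  have hf₁H : ∀ q, f₁ q ∈ spaceH k := fun q =>
    ((hβa q.1.2 q.2).lerp (hl q.1.2 q.2).agreesAtLevel q.1.1.2).mem_spaceH (hb₀ _)
  -- The starting functions differ from the original one only where `Q ≥ b + ε`, away from the
  -- sublevel set.
  have hf₁U : ∀ q, f₁ (q, 0) ∈ spaceU k := by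
    intro q
    refine congr_mem_spaceU (hU q.2) (hf₁H (q, 0)) (fun z => ?_) fun z hz => ?_
    · have h₁ : AgreesAtLevel (f₁ (q, 0)).1.toFun (b q.2) :=
        (hβa q.2 0).lerp (hl q.2 0).agreesAtLevel q.1.2
      rw [← not_lt, ← not_lt, h₁.gt_iff, (hβa q.2 0).gt_iff]
    · have h₁ : Q k z ≤ b q.2 := by
        rw [← not_lt, ← (hβa q.2 0).gt_iff, not_lt]
        exact hz
      have ho : IsOpen {w : E2 k | Q k w < b q.2 + ε} :=
        isOpen_lt (contDiff_Q k).continuous continuous_const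
      filter_upwards [ho.mem_nhds (show Q k z < b q.2 + ε by linarith)] with w hw
      simp only [CInf.lerp_apply, hg₁ q.2 w hw, Set.Icc.coe_zero]
      ring
  have hf₁₁ : ∀ q, (f₁ (q, 1)).1 = CInf.ofQ k := fun q => by
    simp only [f₁, (β q.2).path_one, Set.Icc.coe_one, CInf.lerp_one, CInf.lerp_self]
  have hgU : ∀ x, (g x, b x) ∈ spaceU k := fun x => by
    have := hf₁U (1, x)
    simpa [f₁] using this
  -- raising the level to `1/2`
  let l : I × X → ℝ := fun q => (1 - (q.1 : ℝ)) * b q.2 + q.1 * (1 / 2)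
  have hlb : ∀ q, b q.2 ≤ l q := fun q => by
    have := mul_nonneg q.1.2.1 (sub_nonneg.2 (hb₁ q.2))
    simp only [l]
    linarith
  have hl₀ : ∀ q, l q ∈ Set.Ioo (0 : ℝ) 1 := fun q =>
    lerp_mem_Ioo q.1.2 (hb₀ q.2) (by norm_num)
  let f₂ : (I × X) × I → CInf k × ℝ := fun q =>
    (CInf.lerp q.2 (g q.1.2) (CInf.ofQ k), l q.1)
  have hf₂ : Continuous f₂ :=
    Continuous.prodMk (CInf.continuous_lerp (by fun_prop) (by fun_prop) continuous_const)
      (by fun_prop)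
  have hf₂H : ∀ q, f₂ q ∈ spaceH k := fun q =>
    (((hl q.1.2 q.2).mono (hlb q.1)).agreesAtLevel).mem_spaceH (hl₀ _)
  have hM : ∀ x, ∀ b' ∈ Set.Ioo (0 : ℝ) 1, (g x, b') ∈ spaceM k := fun x b' hb' =>
    (hgs x).mem_spaceM (hgU x) hb'
  have hf₂U : ∀ q, f₂ (q, 0) ∈ spaceU k := fun q => by
    simp only [f₂, Set.Icc.coe_zero, CInf.lerp_zero]
    exact spaceM_subset_spaceU k (hM q.2 _ (hl₀ q))
  have hf₂₁ : ∀ q, (f₂ (q, 1)).1 = CInf.ofQ k := fun q => by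
    simp only [f₂, Set.Icc.coe_one, CInf.lerp_one]
  let g' : C(X, HalfStandard k) := ⟨fun x => ⟨⟨(g x, 1 / 2), hM x _ (by norm_num)⟩, rfl,
    (hgs x).mono (hb₁ x)⟩, Continuous.subtype_mk (Continuous.subtype_mk (by fun_prop) _) _⟩
  let β₁ : C(X, FreeFibre k) := FreeFibre.ofFamily (fun q : X × I => f₁ ((1, q.1), q.2))
    (by fun_prop) (fun q => hf₁H _) (fun x => hf₁U _) (fun x => hf₁₁ _)
  have hβ₁ : ∀ x t, (β₁ x).path t = (CInf.lerp t (g x) (CInf.ofQ k), b x) := fun x t => by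
    simp [β₁, f₁]
  refine ⟨g', ContinuousMap.HomotopicRel.trans (g := β₁) ?_ ?_⟩
  · refine FreeFibre.homotopicRel f₁ hf₁ hf₁H hf₁U hf₁₁ (fun x t => ?_) (fun x t => rfl)
      fun s x hx t => ?_
    · exact Prod.ext (by simp [f₁]) (hβb x t).symm
    · refine Prod.ext ?_ (hβb x t).symm
      simp only [f₁]
      rw [← (hgB x hx).2 t, CInf.lerp_self]
  · refine FreeFibre.homotopicRel f₂ hf₂ hf₂H hf₂U hf₂₁ (fun x t => ?_) (fun x t => ?_)
      fun s x hx t => ?_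
    · simp [hβ₁, f₂, l]
    · change _ = (linearDeformation k (1, g' x)).path t
      rw [linearDeformation_one_path]
      exact Prod.ext rfl (by simp [f₂, l])
    · rw [hβ₁]
      simp only [f₂, l, (hgB x hx).1]
      refine Prod.ext rfl ?_
      simp only
      ring

/-- Maps to the free fibre that are linear paths from quarter-standard functions on `B` can be
compressed to families of linear paths. -/
theorem FreeFibre.exists_homotopicRel [CompactSpace X] {B : Set X} (β : C(X, FreeFibre k))
    (hB : ∀ x ∈ B, ∃ p : HalfStandard k, p.1 ∈ quarterStandard k ∧
      β x = linearDeformation k (1, p)) :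
    ∃ g : C(X, HalfStandard k), β.HomotopicRel
      ((linearDeformation k).comp (ContinuousMap.prodMk (ContinuousMap.const X 1) g)) B := by
  obtain ⟨β₁, b, hb, hb₁, hβ₁, h₁⟩ := FreeFibre.exists_homotopicRel_constant_level (B := B) β
    fun x hx t => by
      obtain ⟨p, -, hp⟩ := hB x hx
      rw [hp, linearDeformation_one_path]
  obtain ⟨β₂, hβ₂, ⟨ε, hε, hQ⟩, ha, h₂⟩ := FreeFibre.exists_homotopicRel_agreesAtLevel (B := B) β₁
    hb hβ₁ fun x hx => by
      obtain ⟨p, hp₀, hp⟩ := hB x hx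
      rw [h₁.fst_eq_snd hx] at hp
      refine ⟨by rw [← hβ₁ x 0, hp, linearDeformation_one_path], fun t => ?_⟩
      rw [hp, linearDeformation_one_path]
      exact hp₀.2.lerp (isStandardAbove_Q _) t.2
  obtain ⟨g, h₃⟩ := FreeFibre.exists_homotopicRel_linear (B := B) β₂ hb hb₁ hβ₂ hε hQ ha
    fun x hx => by
      obtain ⟨p, -, hp⟩ := hB x hx
      exact ⟨p, by rw [← h₂.fst_eq_snd hx, ← h₁.fst_eq_snd hx, hp]⟩
  exact ⟨g, (h₁.trans h₂).trans h₃⟩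

/-- Maps to the free fibre whose restriction to `B` comes from `M_k` can be compressed into
`M_k`. -/
theorem exists_homotopicRel_toFreeFibre [CompactSpace X] {B : Set X} (hB : IsClosedCofibration B)
    (β : C(X, FreeFibre k)) (hβ : ∀ x ∈ B, β x ∈ Set.range (toFreeFibre k)) :
    ∃ g : C(X, spaceM k), β.HomotopicRel ((toFreeFibre k).comp g) B := by
  -- Shrinking by `1/2` leaves a gap between `1/4`, above which the functions are standard, and the
  -- level `1/2`. The normalization needs this gap to be stationary over `B`.
  refine exists_compression_of_deformation hB (isEmbedding_toFreeFibre k) (shrinkDeformation k)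
    shrinkDeformation_zero shrinkDeformation_one_mem (fun β hβ => ?_) β hβ
  let incl : C(HalfStandard k, spaceM k) := ⟨Subtype.val, continuous_subtype_val⟩
  obtain ⟨g, hg⟩ := exists_compression_of_homotopy hB (m := (toFreeFibre k).comp incl)
    ((isEmbedding_toFreeFibre k).comp Topology.IsEmbedding.subtypeVal) (linearDeformation k)
    linearDeformation_zero linearDeformation_one_injective
    (M₀ := {p | p.1 ∈ quarterStandard k}) (fun β hβ => FreeFibre.exists_homotopicRel β
      fun x hx => by
        obtain ⟨p, hp, h⟩ := hβ x hx
        exact ⟨p, hp, h.symm⟩) β fun x hx => by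
      obtain ⟨p, hp, h⟩ := hβ x hx
      exact ⟨⟨p, hp.1, hp.2.isStandardFrom (by norm_num)⟩, hp, h⟩
  exact ⟨incl.comp g, hg⟩

end Normalization

/-! ### The homotopy fibration sequence -/

theorem proposition5p1 (k : ℕ) :
    ∃ (hMU : spaceM k ⊆ spaceU k)
      (N : ((inclusionMap (spaceU_subset_spaceH k)).comp (inclusionMap hMU)).Homotopy
        (ContinuousMap.const (spaceM k) (basePoint k))),
      (∀ (t : unitInterval) (p : spaceM k),
        (N (t, p)).1.1.toFun = nullFun (t : ℝ) p.1.1.toFun p.1.2 ∧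
          (N (t, p)).1.2 = nullLevel (t : ℝ) p.1.2) ∧
      IsHomotopyFibrationSequence (inclusionMap hMU)
        (inclusionMap (spaceU_subset_spaceH k)) N := by
  refine ⟨spaceM_subset_spaceU k, nullHomotopy k, fun t p => ⟨rfl, rfl⟩, ?_⟩
  have hinj : Function.Injective (toHomotopyFibre (inclusionMap (spaceM_subset_spaceU k))
      (inclusionMap (spaceU_subset_spaceH k)) (nullHomotopy k)) := by
    refine Function.Injective.of_comp (f := FreeFibre.ofHomotopyFibre k) ?_
    exact (isEmbedding_toFreeFibre k).injective
  refine isWeakHomotopyEquiv_of_compression hinj fun n β hβ => ?_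
  obtain ⟨g, hg⟩ := exists_homotopicRel_toFreeFibre (isClosedCofibration_boundary n)
    ((FreeFibre.ofHomotopyFibre k).comp β) fun x hx => by
      obtain ⟨p, hp⟩ := hβ x hx
      exact ⟨p, congrArg (FreeFibre.ofHomotopyFibre k) hp⟩
  refine ⟨g, ?_⟩
  -- The compression took place in the free fibre; the retraction carries it back and fixes the
  -- points of the homotopy fibre.
  have h := hg.comp_continuousMap (FreeFibre.retraction k)
  convert h using 1
  · exact ContinuousMap.ext fun x => (FreeFibre.retraction_ofHomotopyFibre _).symm
  · exact ContinuousMap.ext fun x => (FreeFibre.retraction_ofHomotopyFibre _).symm
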